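/- All graphs are finite, simple and undirected; $d_G(u,v)$ is the length of a shortest path, with $d_G(u,v)=\infty$ if there is none. A set $S\subseteq V(G)$ is a resolving set of $G$ if for all distinct $u,v\in V(G)$ there is $w\in S$ with $d_G(w,u)\neq d_G(w,v)$. An instance of Metric Dimension is a pair $(G,k)$ with $k$ an integer; it is a yes-instance if $G$ has a resolving set of size at most $k$. A co-cluster graph is the complement of a disjoint union of cliques, and the distance to co-cluster of $G$ is the least size of a set $X\subseteq V(G)$ such that $G-X$ is a co-cluster graph. If $G-X$ is a co-cluster graph, then $G-X$ consists of disjoint non-empty independent sets that are pairwise completely joined; call them the parts of $G-X$. The signature of a part $I$ is the multiset $\{N(u)\cap X : u\in I\}$, two parts are identical if they have the same signature, and $t(I)$ denotes the number of unordered pairs of distinct vertices $u,v\in I$ with $N(u)=N(v)$ (false twins). Consider two reduction rules for triples $(G,X,k)$ such that $G-X$ is a co-cluster graph (the new set $X$ consists of those vertices of $X$ that are not deleted): - Rule A: if $u,v,w$ are three distinct vertices with $N(u)=N(v)=N(w)$, delete $u$ and decrease $k$ by $1$. - Rule B: if Rule A does not apply and some class of identical parts of $G-X$ has at least $2^{|X|+2}+|X|+2$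 members, delete all vertices of one part $I$ of this class and decrease $k$ by $\max\{1,t(I)\}$. Then: 1. Metric Dimension is fixed-parameter tractable parameterized by the distance to co-cluster: there are an algorithm, a computable function $f$ and a constant $c$ such that on every input $(G,k)$ of size $N$ the algorithm decides whether $(G,k)$ is a yes-instance in time at most $f(\ell)\cdot N^{c}$, where $\ell$ is the distance to co-cluster of $G$. 2. Both rules are safe: if a rule turns $(G,X,k)$ into $(G',X',k')$, then $(G,k)$ is a yes-instance if and only if $(G',k')$ is. 3. If neither rule applies to $(G,X,k)$, then $|V(G)|\le 2^{2^{|X|+1}}\cdot(2^{|X|+2}+|X|+1)\cdot 2^{|X|+1}+|X|$. 4. There is a polynomial-time algorithm which, given $G$, an integer $k$ and a set $X\subseteq V(G)$ such that $G-X$ is a co-cluster graph, computes an instance $(G',k'')$ and a set $X'\subseteq V(G')$ such that: for some integer $k'$, the triple $(G',X',k')$ is obtained from $(G,X,k)$ by applying Rules A and B until neither applies, and $k''=\max\{-1,\min\{k',|V(G')|\}\}$; $(G',k'')$ is a yes-instance if and only if $(G,k)$ is; $G'-X'$ is a co-cluster graph and $|X'|\le|X|$; and $$|V(G')|\le 2^{2^{|X|+1}}\cdot(2^{|X|+2}+|X|+1)\cdot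 2^{|X|+1}+|X|.$$ Running times are those of a unit-cost random access machine with addition, (truncated) subtraction and comparison. -/

import Mathlib

/-! ### Random access machines with unit cost

A machine has registers and a memory, both indexed by `ℕ` and holding natural numbers. A program is a
finite piece of syntax. The arithmetic is addition, truncated subtraction and comparison (there is no
multiplication, so that `t` steps produce numbers with at most `O(t)` bits more than those in the
input, and the running time is polynomially related to that of a Turing machine). -/

namespace RAM

/-- The state of a machine: its registers and its memory. -/
structure State where
  reg : ℕ → ℕ
  mem : ℕ → ℕ

/-- Arithmetic expressions over registers and memory cells. -/
inductive Expr : Type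
  | lit (c : ℕ)
  | reg (r : ℕ)
  | mem (address : Expr)
  | add (a b : Expr)
  | sub (a b : Expr)
  | lt (a b : Expr)
  | eq (a b : Expr)

/-- The value of an expression in a state; comparisons have value `1` (true) or `0` (false). -/
def Expr.eval (s : State) : Expr → ℕ
  | .lit c => c
  | .reg r => s.reg r
  | .mem a => s.mem (a.eval s)
  | .add a b => a.eval s + b.eval s
  | .sub a b => a.eval s - b.eval s
  | .lt a b => if a.eval s < b.eval s then 1 else 0
  | .eq a b => if a.eval s = b.eval s then 1 else 0

/-- The number of steps needed to evaluate an expression: one for each of its nodes. -/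
def Expr.cost : Expr → ℕ
  | .lit _ => 1
  | .reg _ => 1
  | .mem a => a.cost + 1
  | .add a b => a.cost + b.cost + 1
  | .sub a b => a.cost + b.cost + 1
  | .lt a b => a.cost + b.cost + 1
  | .eq a b => a.cost + b.cost + 1

/-- Programs. -/
inductive Prog : Type
  | assign (r : ℕ) (e : Expr)
  | store (address e : Expr)
  | seq (p q : Prog)
  | ite (e : Expr) (p q : Prog)
  | while (e : Expr) (p : Prog)

/-- `Run p s s' t`: started in state `s`, the program `p` halts in state `s'` after exactly `t`
steps. -/
inductive Run : Prog → State → State → ℕ → Prop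
  | assign (r : ℕ) (e : Expr) (s : State) :
      Run (.assign r e) s { s with reg := Function.update s.reg r (e.eval s) } (e.cost + 1)
  | store (a e : Expr) (s : State) :
      Run (.store a e) s { s with mem := Function.update s.mem (a.eval s) (e.eval s) }
        (a.cost + e.cost + 1)
  | seq {p q : Prog} {s₁ s₂ s₃ : State} {t₁ t₂ : ℕ} :
      Run p s₁ s₂ t₁ → Run q s₂ s₃ t₂ → Run (.seq p q) s₁ s₃ (t₁ + t₂)
  | ite_true {e : Expr} {p q : Prog} {s s' : State} {t : ℕ} :
      e.eval s ≠ 0 → Run p s s' t → Run (.ite e p q) s s' (e.cost + 1 + t)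
  | ite_false {e : Expr} {p q : Prog} {s s' : State} {t : ℕ} :
      e.eval s = 0 → Run q s s' t → Run (.ite e p q) s s' (e.cost + 1 + t)
  | while_true {e : Expr} {p : Prog} {s₁ s₂ s₃ : State} {t₁ t₂ : ℕ} :
      e.eval s₁ ≠ 0 → Run p s₁ s₂ t₁ → Run (.while e p) s₂ s₃ t₂ →
      Run (.while e p) s₁ s₃ (e.cost + 1 + t₁ + t₂)
  | while_false {e : Expr} {p : Prog} {s : State} :
      e.eval s = 0 → Run (.while e p) s s (e.cost + 1)

/-- The initial state on an input word: the word stands at the start of the memory, everything else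
is `0`. -/
def State.init (w : List ℕ) : State where
  reg := fun _ => 0
  mem := fun i => w.getD i 0

/-- On the input word `w` the program `p` halts after at most `T` steps, and then the word `out`
stands at the start of the memory. -/
def OutputsWithin (p : Prog) (w out : List ℕ) (T : ℕ) : Prop :=
  ∃ (s : State) (t : ℕ), Run p (State.init w) s t ∧ t ≤ T ∧
    ∀ i < out.length, s.mem i = out.getD i 0

end RAM

open Classical in
/-- The decision problem `yes` over instances of type `ι`, given to the machine through `encode` and
parameterized by `κ`, is fixed-parameter tractable: a program decides it in time
`f (κ I) * |I| ^ c` with `f` computable. The size `|I|` is the number of words of the encoding, which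
is at most its number of bits. -/
def FixedParameterTractable {ι : Type} (encode : ι → List ℕ) (yes : ι → Prop) (κ : ι → ℕ) : Prop :=
  ∃ (p : RAM.Prog) (f : ℕ → ℕ) (c : ℕ), Computable f ∧
    ∀ I : ι, RAM.OutputsWithin p (encode I) (if yes I then [1] else [0])
      (f (κ I) * (encode I).length ^ c)

/-! ### Graphs -/

namespace SimpleGraph

variable {V : Type*}

/-- `S` is a resolving set of `G`. Distances are extended: vertices in different connected components
are at distance `⊤`. -/
def IsResolvingSet (G : SimpleGraph V) (S : Finset V) : Prop :=
  ∀ u v : V, u ≠ v → ∃ w ∈ S, G.edist w u ≠ G.edist w v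

/-- `G` is a disjoint union of cliques. -/
def IsCluster (G : SimpleGraph V) : Prop :=
  ∀ u v : V, G.Reachable u v → u ≠ v → G.Adj u v

/-- `G` is the complement of a cluster graph. -/
def IsCoCluster (G : SimpleGraph V) : Prop :=
  Gᶜ.IsCluster

/-- Deleting `X` from `G` leaves a co-cluster graph. -/
def IsCoClusterModulator (G : SimpleGraph V) (X : Finset V) : Prop :=
  (G.induce {v | v ∉ X}).IsCoCluster

/-- The distance to co-cluster of a finite graph. -/
noncomputable def distToCoCluster (G : SimpleGraph V) : ℕ :=
  sInf {m : ℕ | ∃ X : Finset V, X.card = m ∧ G.IsCoClusterModulator X}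

/-- `u` and `v` have the same open neighbourhood. -/
def FalseTwins (G : SimpleGraph V) (u v : V) : Prop :=
  G.neighborSet u = G.neighborSet v

/-- `G` has three pairwise distinct vertices that are false twins. -/
def HasThreeFalseTwins (G : SimpleGraph V) : Prop :=
  ∃ u v w : V, u ≠ v ∧ u ≠ w ∧ v ≠ w ∧ G.FalseTwins u v ∧ G.FalseTwins u w

open Classical in
/-- The independent sets of which the co-cluster graph `G - X` consists: the classes of the relation
"equal or not adjacent" on the vertices outside `X`, which is an equivalence relation when `G - X` is
a co-cluster graph. -/
noncomputable def coClusterParts [Fintype V] (G : SimpleGraph V) (X : Finset V) :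
    Finset (Finset V) :=
  (Finset.univ.filter fun v => v ∉ X).image
    fun v => Finset.univ.filter fun u => u ∉ X ∧ ¬ G.Adj v u

open Classical in
/-- The signature of `I`: the multiset of the neighbourhoods in `X` of the vertices of `I`. -/
noncomputable def signature (G : SimpleGraph V) (X I : Finset V) : Multiset (Finset V) :=
  I.val.map fun u => X.filter fun x => G.Adj u x

open Classical in
/-- The equivalence class of `I`: the independent sets of `G - X` with the same signature as `I`. -/
noncomputable def identicalParts [Fintype V] (G : SimpleGraph V) (X I : Finset V) :
    Finset (Finset V) :=
  (G.coClusterParts X).filter fun J => G.signature X J = G.signature X I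

open Classical in
/-- The number of (unordered) pairs of distinct false twins of `G` inside `I`. -/
noncomputable def falseTwinPairs (G : SimpleGraph V) (I : Finset V) : ℕ :=
  ((I.powersetCard 2).filter fun P => ∀ u ∈ P, ∀ v ∈ P, G.FalseTwins u v).card

end SimpleGraph

/-! ### Instances of Metric Dimension -/

namespace MetricDimension

/-- An instance `(G, k)` of Metric Dimension; the vertices are numbered. -/
structure Instance where
  n : ℕ
  graph : SimpleGraph (Fin n)
  k : ℤ

/-- `G` has a resolving set of size at most `k`. -/
def Instance.Yes (A : Instance) : Prop :=
  ∃ S : Finset (Fin A.n), A.graph.IsResolvingSet S ∧ (S.card : ℤ) ≤ A.k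

open Classical in
/-- The adjacency matrix, row by row. -/
noncomputable def adjacencyBits {n : ℕ} (G : SimpleGraph (Fin n)) : List ℕ :=
  (List.ofFn fun i => List.ofFn fun j => if G.Adj i j then 1 else 0).flatten

/-- The input word: the number of vertices, the integer `k` (as its positive part and its negative
part), and the adjacency matrix. -/
noncomputable def Instance.encode (A : Instance) : List ℕ :=
  [A.n, A.k.toNat, (-A.k).toNat] ++ adjacencyBits A.graph

/-- An instance of Metric Dimension together with a set `X` of vertices. -/
structure MarkedInstance extends Instance where
  X : Finset (Fin n)

/-- The input word of a marked instance: as for an instance, with the characteristic vector of `X`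
before the adjacency matrix. -/
noncomputable def MarkedInstance.encode (A : MarkedInstance) : List ℕ :=
  [A.n, A.k.toNat, (-A.k).toNat] ++ (List.ofFn fun i => if i ∈ A.X then 1 else 0) ++
    adjacencyBits A.graph

/-- Up to renumbering of vertices, the graph of `B` is that of `A` with the vertices of `D` deleted,
and the marked set of `B` is what remains of that of `A`. -/
def DeletesTo (A : MarkedInstance) (D : Finset (Fin A.n)) (B : MarkedInstance) : Prop :=
  ∃ φ : B.graph ↪g A.graph, (∀ a, a ∈ Set.range φ ↔ a ∉ D) ∧ ∀ b, b ∈ B.X ↔ φ b ∈ A.X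

/-- The rule for false twins: if `u, v, w` are distinct false twins, delete `u` and decrease `k` by
one. -/
def TwinRule (A B : MarkedInstance) : Prop :=
  ∃ u v w : Fin A.n, u ≠ v ∧ u ≠ w ∧ v ≠ w ∧
    A.graph.FalseTwins u v ∧ A.graph.FalseTwins u w ∧
    DeletesTo A {u} B ∧ B.k = A.k - 1

/-- The rule for independent sets: when the rule for false twins no longer applies, and `I` belongs
to a class of at least `2 ^ (|X| + 2) + |X| + 2` independent sets of `G - X` with the same signature,
delete `I` and decrease `k` by `max 1 t`, where `t` is the number of pairs of false twins in `I`. -/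
def IndependentSetRule (A B : MarkedInstance) : Prop :=
  ¬ A.graph.HasThreeFalseTwins ∧
  ∃ I ∈ A.graph.coClusterParts A.X,
    2 ^ (A.X.card + 2) + A.X.card + 2 ≤ (A.graph.identicalParts A.X I).card ∧
    DeletesTo A I B ∧ B.k = A.k - max 1 (A.graph.falseTwinPairs I : ℤ)

/-- One application of one of the two rules. -/
def Reduces (A B : MarkedInstance) : Prop :=
  TwinRule A B ∨ IndependentSetRule A B

/-- Neither rule applies. -/
def Irreducible (A : MarkedInstance) : Prop :=
  ∀ B : MarkedInstance, ¬ Reduces A B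

/-- The same graph and set, with `k` replaced by the closest integer between `-1` and the number of
vertices. -/
def MarkedInstance.clamp (A : MarkedInstance) : MarkedInstance :=
  { A with k := max (-1) (min A.k (A.n : ℤ)) }

/-- The bound on the number of vertices of the kernel, for `x = |X|`. -/
def kernelBound (x : ℕ) : ℕ :=
  2 ^ 2 ^ (x + 1) * (2 ^ (x + 2) + x + 1) * 2 ^ (x + 1) + x

end MetricDimension

/-! Everything about the two rules rests on symmetry. Two false twins can be swapped, and two parts
with the same signature can be exchanged, by an automorphism that fixes all other vertices
(`FalseTwins.exists_aut`, `exists_exchange`). A deleted vertex on a shortest path can therefore be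
replaced by a surviving copy, so neither rule changes distances (`Embedding.edist_eq`). Safety
becomes a statement about sets that resolve the surviving vertices inside the original graph
(`yes_iff_of_isometric`).

Rule A: a resolving set contains at least two of three false twins, and a remaining twin does the
work of the deleted one.

Rule B: let `t` be the number of twin pairs in a part of the class and `m = max 1 t`. Without three
false twins the twin pairs are disjoint, so every part of the class contains at least `t` vertices
of a resolving set, and at most one part is missed entirely. By `ResolvesOn.card_dichotomy` there
are two cases. If more than `|X|` parts contain more than `m` chosen vertices, the surplus pays for
taking all of `X`; after that, `m` suitable vertices per part suffice, and a part can be added or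
removed at the price `m`. Otherwise most parts are tight, that is, contain exactly `m` chosen
vertices. A part is then added by copying the choice made in a tight part. For removal, the
pigeonhole principle gives three tight parts containing chosen vertices with a common neighbourhood
in `X`; this forces the neighbourhoods chosen in one of them to occur in the other two as well, so
the choice in that one is superfluous outside it.

Kernel size: a neighbourhood in `X` occurs at most twice in a part, since its owners are false
twins. This bounds the size of a part and the number of signatures, while Rule B bounds the size of
each class.

Algorithms: `PF` and `MF` are classes of functions and memory transformations computable in time
polynomial in the memory size, closed under bounded loops, so that running times follow from the
shape of the definitions. For fixed-parameter tractability, a greedy search for obstructions yields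
a modulator of at most three times the optimal size, the rules shrink the instance, and brute force
solves the kernel. Brute force is again a polynomial algorithm, run in a memory enlarged to more
than `2 ^ n` cells. -/

/-! ### Polynomially bounded functions -/

/-- `t` is bounded by a polynomial. -/
def PolyBounded (t : ℕ → ℕ) : Prop :=
  ∃ K c : ℕ, ∀ N, t N ≤ K * (N + 2) ^ c

namespace PolyBounded

theorem mono {s t : ℕ → ℕ} (ht : PolyBounded t) (h : ∀ N, s N ≤ t N) : PolyBounded s := by
  obtain ⟨K, c, hK⟩ := ht
  exact ⟨K, c, fun N => (h N).trans (hK N)⟩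

theorem const (k : ℕ) : PolyBounded fun _ => k := ⟨k, 0, by simp⟩

theorem id : PolyBounded fun N => N := ⟨1, 1, by intro N; simp⟩

theorem add {s t : ℕ → ℕ} (hs : PolyBounded s) (ht : PolyBounded t) :
    PolyBounded fun N => s N + t N := by
  obtain ⟨K, c, hK⟩ := hs
  obtain ⟨L, d, hL⟩ := ht
  refine ⟨K + L, max c d, fun N => ?_⟩
  have h1 : (N + 2) ^ c ≤ (N + 2) ^ max c d := Nat.pow_le_pow_right (by omega) (le_max_left _ _)
  have h2 : (N + 2) ^ d ≤ (N + 2) ^ max c d := Nat.pow_le_pow_right (by omega) (le_max_right _ _)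
  calc s N + t N ≤ K * (N + 2) ^ c + L * (N + 2) ^ d := add_le_add (hK N) (hL N)
    _ ≤ K * (N + 2) ^ max c d + L * (N + 2) ^ max c d := by gcongr
    _ = _ := by ring

theorem mul {s t : ℕ → ℕ} (hs : PolyBounded s) (ht : PolyBounded t) :
    PolyBounded fun N => s N * t N := by
  obtain ⟨K, c, hK⟩ := hs
  obtain ⟨L, d, hL⟩ := ht
  refine ⟨K * L, c + d, fun N => ?_⟩
  calc s N * t N ≤ (K * (N + 2) ^ c) * (L * (N + 2) ^ d) := Nat.mul_le_mul (hK N) (hL N)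
    _ = _ := by ring

end PolyBounded

namespace RAM

open Classical

/-! ### Computing functions of a bounded memory -/

/-- The first `size` cells of a memory. -/
structure Mach where
  size : ℕ
  mem : ℕ → ℕ

/-- A context: a bounded memory together with finitely many bound variables. -/
class Ctx (α : Type) where
  mach : α → Mach
  depth : ℕ
  var : α → ℕ → ℕ

instance : Ctx Mach := ⟨fun x => x, 0, fun _ _ => 0⟩

/-- The newest variable gets the largest index. A function on `α × ℕ` thus serves as the body of a
bounded quantifier, sum or loop over a context `α`. -/
instance {α : Type} [Ctx α] : Ctx (α × ℕ) :=
  ⟨fun x => Ctx.mach x.1, Ctx.depth α + 1,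
    fun x k => if k = Ctx.depth α then x.2 else Ctx.var x.1 k⟩

/-- The registers `loc k < d` and the memory of `s` hold the data of the context `x`. -/
def Fits {α : Type} [Ctx α] (s : State) (x : α) (loc : ℕ → ℕ) (d : ℕ) : Prop :=
  0 < d ∧ s.reg 0 = (Ctx.mach x).size ∧ (∀ i < (Ctx.mach x).size, s.mem i = (Ctx.mach x).mem i) ∧
    ∀ k < Ctx.depth α, loc k < d ∧ s.reg (loc k) = Ctx.var x k

theorem Fits.mono {α : Type} [Ctx α] {s s' : State} {x : α} {loc : ℕ → ℕ} {d d' : ℕ}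
    (h : Fits s x loc d) (hd : d ≤ d') (hm : s'.mem = s.mem)
    (hr : ∀ r < d, s'.reg r = s.reg r) : Fits s' x loc d' := by
  obtain ⟨h0, h1, h2, h3⟩ := h
  refine ⟨by omega, by rw [hr 0 h0, h1], by simpa [hm] using h2, fun k hk => ?_⟩
  obtain ⟨h4, h5⟩ := h3 k hk
  exact ⟨by omega, by rw [hr _ h4, h5]⟩

/-- `p` evaluates `f` at level `d`: it leaves the value in the register `d` and changes no register
below `d` and no memory cell. -/
def Evaluates {α : Type} [Ctx α] (p : (ℕ → ℕ) → ℕ → Prog) (f : α → ℕ) (T : ℕ → ℕ) : Prop :=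
  ∀ (x : α) (s : State) (loc : ℕ → ℕ) (d : ℕ), Fits s x loc d →
    ∃ s' t, Run (p loc d) s s' t ∧ t ≤ T (Ctx.mach x).size ∧ s'.mem = s.mem ∧
      (∀ r < d, s'.reg r = s.reg r) ∧ s'.reg d = f x

/-- `f` can be evaluated in time polynomial in the size of the memory. -/
def PF {α : Type} [Ctx α] (f : α → ℕ) : Prop :=
  ∃ p T, PolyBounded T ∧ Evaluates p f T

/-- A predicate that can be decided in time polynomial in the size of the memory. -/
def PFP {α : Type} [Ctx α] (P : α → Prop) : Prop :=
  PF fun x => if P x then 1 else 0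

theorem Run.assign_eq (r : ℕ) (e : Expr) (s : State) {s' : State} {t : ℕ}
    (hs : s' = { s with reg := Function.update s.reg r (e.eval s) }) (ht : t = e.cost + 1) :
    Run (.assign r e) s s' t := by
  subst hs ht; exact Run.assign r e s

/-- The loop rule: `P i` is the invariant after `i` rounds. The test is evaluated `n + 1` times,
which accounts for the factor in the time bound. -/
theorem Run.while_bounded {e : Expr} {p : Prog} (P : ℕ → State → Prop) (n T : ℕ)
    (hstep : ∀ i < n, ∀ s, P i s → e.eval s ≠ 0 ∧ ∃ s' t, Run p s s' t ∧ t ≤ T ∧ P (i + 1) s')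
    (hend : ∀ s, P n s → e.eval s = 0) {s : State} (hs : P 0 s) :
    ∃ s' t, Run (.while e p) s s' t ∧ t ≤ (n + 1) * (e.cost + 1 + T) ∧ P n s' := by
  -- Induction on the number `j` of rounds still to come.
  suffices H : ∀ j ≤ n, ∀ s, P (n - j) s →
      ∃ s' t, Run (.while e p) s s' t ∧ t ≤ (j + 1) * (e.cost + 1 + T) ∧ P n s' by
    exact H n le_rfl s (by simpa using hs)
  intro j
  induction j with
  | zero =>
    intro _ s hs
    refine ⟨s, _, Run.while_false (hend s hs), ?_, hs⟩
    omega
  | succ j ih =>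
    intro hj s hs
    obtain ⟨h1, s', t, h2, h3, h4⟩ := hstep (n - (j + 1)) (by omega) s hs
    rw [show n - (j + 1) + 1 = n - j by omega] at h4
    obtain ⟨s'', t', h5, h6, h7⟩ := ih (by omega) s' h4
    refine ⟨s'', _, Run.while_true h1 h2 h5, ?_, h7⟩
    have : (j + 1 + 1) * (e.cost + 1 + T) = (j + 1) * (e.cost + 1 + T) + (e.cost + 1 + T) := by ring
    omega

namespace PF

variable {α : Type} [Ctx α]

theorem of_expr {f : α → ℕ} (e : (ℕ → ℕ) → ℕ → Expr) (k : ℕ) (hk : ∀ loc d, (e loc d).cost = k)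
    (h : ∀ (x : α) s loc d, Fits s x loc d → (e loc d).eval s = f x) : PF f := by
  refine ⟨fun loc d => .assign d (e loc d), fun _ => k + 1, .const _, fun x s loc d hs => ?_⟩
  refine ⟨_, _, Run.assign _ _ _, by simp [hk], rfl, fun r hr => ?_, ?_⟩
  · simp [Function.update_of_ne hr.ne]
  · simp [h x s loc d hs]

theorem const (c : ℕ) : PF fun _ : α => c :=
  of_expr (fun _ _ => .lit c) 1 (fun _ _ => rfl) fun _ _ _ _ _ => rfl

theorem size : PF fun x : α => (Ctx.mach x).size :=
  of_expr (fun _ _ => .reg 0) 1 (fun _ _ => rfl) fun _ _ _ _ h => h.2.1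

theorem snd : PF fun x : α × ℕ => x.2 := by
  refine of_expr (fun loc _ => .reg (loc (Ctx.depth α))) 1 (fun _ _ => rfl) fun x s loc d h => ?_
  have := (h.2.2.2 (Ctx.depth α) (Nat.lt_succ_self _)).2
  simpa [Expr.eval, Ctx.var] using this

theorem fits_fst {s : State} {x : α × ℕ} {loc : ℕ → ℕ} {d : ℕ} (h : Fits s x loc d) :
    Fits s x.1 loc d := by
  refine ⟨h.1, h.2.1, h.2.2.1, fun k hk => ?_⟩
  have := h.2.2.2 k (Nat.lt_succ_of_lt hk)
  refine ⟨this.1, this.2.trans ?_⟩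
  simp [Ctx.var, hk.ne]

theorem fst {f : α → ℕ} (hf : PF f) : PF fun x : α × ℕ => f x.1 := by
  obtain ⟨p, T, hT, h⟩ := hf
  exact ⟨p, T, hT, fun x s loc d hs => h x.1 s loc d (fits_fst hs)⟩

theorem congr {f g : α → ℕ} (hf : PF f) (h : ∀ x, f x = g x) : PF g := by
  rwa [← funext h]

/-- The first value waits in register `d` while the second is computed at level `d + 1`, where
registers up to `d` are left untouched. -/
theorem binop {a b : α → ℕ} (mk : Expr → Expr → Expr) (g : ℕ → ℕ → ℕ)
    (hmk : ∀ e e' s, (mk e e').eval s = g (e.eval s) (e'.eval s))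
    (hc : ∀ e e', (mk e e').cost = e.cost + e'.cost + 1) (ha : PF a) (hb : PF b) :
    PF fun x => g (a x) (b x) := by
  obtain ⟨p, T, hT, hp⟩ := ha
  obtain ⟨q, U, hU, hq⟩ := hb
  refine ⟨fun loc d => .seq (p loc d) (.seq (q loc (d + 1)) (.assign d (mk (.reg d) (.reg (d + 1))))),
    fun N => T N + (U N + 4), hT.add (hU.add (.const _)), fun x s loc d hs => ?_⟩
  obtain ⟨s1, t1, h1, h1t, h1m, h1r, h1v⟩ := hp x s loc d hs
  obtain ⟨s2, t2, h2, h2t, h2m, h2r, h2v⟩ :=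
    hq x s1 loc (d + 1) (hs.mono (Nat.le_succ d) h1m h1r)
  refine ⟨_, _, h1.seq (h2.seq (Run.assign _ _ _)), ?_, ?_, fun r hr => ?_, ?_⟩
  · rw [hc]
    simp only [Expr.cost]
    omega
  · simp [h2m, h1m]
  · simp only [Function.update_of_ne hr.ne]
    rw [h2r r (by omega), h1r r hr]
  · simp only [Function.update_self, hmk, Expr.eval]
    rw [h2v, h2r d (by omega), h1v]

theorem add {a b : α → ℕ} (ha : PF a) (hb : PF b) : PF fun x => a x + b x :=
  binop .add (· + ·) (fun _ _ _ => rfl) (fun _ _ => rfl) ha hb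

theorem sub {a b : α → ℕ} (ha : PF a) (hb : PF b) : PF fun x => a x - b x :=
  binop .sub (· - ·) (fun _ _ _ => rfl) (fun _ _ => rfl) ha hb

theorem ite_ne_zero {c a b : α → ℕ} (hc : PF c) (ha : PF a) (hb : PF b) :
    PF fun x => if c x ≠ 0 then a x else b x := by
  obtain ⟨r, V, hV, hr⟩ := hc
  obtain ⟨p, T, hT, hp⟩ := ha
  obtain ⟨q, U, hU, hq⟩ := hb
  refine ⟨fun loc d => .seq (r loc d) (.ite (.reg d) (p loc d) (q loc d)),
    fun N => V N + (T N + U N + 2), hV.add ((hT.add hU).add (.const _)), fun x s loc d hs => ?_⟩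
  obtain ⟨s1, t1, h1, h1t, h1m, h1r, h1v⟩ := hr x s loc d hs
  have hs1 : Fits s1 x loc d := hs.mono le_rfl h1m h1r
  by_cases hcx : c x ≠ 0
  · obtain ⟨s2, t2, h2, h2t, h2m, h2r, h2v⟩ := hp x s1 loc d hs1
    refine ⟨s2, _, h1.seq (Run.ite_true (by simpa [Expr.eval, h1v] using hcx) h2), ?_,
      by rw [h2m, h1m], fun r hr => by rw [h2r r hr, h1r r hr], by simp [hcx, h2v]⟩
    simp only [Expr.cost]; omega
  · obtain ⟨s2, t2, h2, h2t, h2m, h2r, h2v⟩ := hq x s1 loc d hs1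
    refine ⟨s2, _, h1.seq (Run.ite_false (by simpa [Expr.eval, h1v] using hcx) h2), ?_,
      by rw [h2m, h1m], fun r hr => by rw [h2r r hr, h1r r hr], by simp [hcx, h2v]⟩
    simp only [Expr.cost]; omega

end PF

/-- A cell of a bounded memory; the cells beyond its size read as `0`. -/
def Mach.read (x : Mach) (i : ℕ) : ℕ :=
  if i < x.size then x.mem i else 0

namespace PF

variable {α : Type} [Ctx α]

theorem read {a : α → ℕ} (ha : PF a) : PF fun x => (Ctx.mach x).read (a x) := by
  obtain ⟨p, T, hT, hp⟩ := ha
  refine ⟨fun loc d => .seq (p loc d) (.ite (.lt (.reg d) (.reg 0)) (.assign d (.mem (.reg d)))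
    (.assign d (.lit 0))), fun N => T N + 7, hT.add (.const _), fun x s loc d hs => ?_⟩
  obtain ⟨s1, t1, h1, h1t, h1m, h1r, h1v⟩ := hp x s loc d hs
  have h0 : s1.reg 0 = (Ctx.mach x).size := by rw [h1r 0 hs.1, hs.2.1]
  by_cases hc : a x < (Ctx.mach x).size
  · refine ⟨_, _, h1.seq (Run.ite_true ?_ (Run.assign _ _ _)), ?_, h1m, fun r hr => ?_, ?_⟩
    · simp [Expr.eval, h1v, h0, hc]
    · simp only [Expr.cost]; omega
    · simp [Function.update_of_ne hr.ne, h1r r hr]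
    · simp [Expr.eval, h1v, h1m, hs.2.2.1 _ hc, Mach.read, hc]
  · refine ⟨_, _, h1.seq (Run.ite_false ?_ (Run.assign _ _ _)), ?_, h1m, fun r hr => ?_, ?_⟩
    · simp [Expr.eval, h1v, h0, hc]
    · simp only [Expr.cost]; omega
    · simp [Function.update_of_ne hr.ne, h1r r hr]
    · simp [Expr.eval, Mach.read, hc]

/-- The only loop construct; sums, quantifiers, products and powers derive from it. Cutting the
bound off at the memory size keeps the time polynomial whatever `B` is. The accumulator may become
exponentially large, because operations have unit cost. -/
theorem iter {B a : α → ℕ} {f : α → ℕ → ℕ → ℕ} (hB : PF B) (ha : PF a)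
    (hf : PF fun y : (α × ℕ) × ℕ => f y.1.1 y.1.2 y.2) :
    PF fun x => Nat.rec (motive := fun _ => ℕ) (a x) (fun i acc => f x i acc)
      (min (B x) (Ctx.mach x).size) := by
  obtain ⟨p, T, hT, hp⟩ := ha
  obtain ⟨q, U, hU, hq⟩ := hB
  obtain ⟨r, V, hV, hr⟩ := hf
  -- Register `d` holds the accumulator, `d + 1` the loop index and `d + 2` the bound; the body
  -- works from level `d + 3`.
  let loc' : (ℕ → ℕ) → ℕ → ℕ → ℕ := fun loc d =>
    Function.update (Function.update loc (Ctx.depth α) (d + 1)) (Ctx.depth α + 1) d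
  refine ⟨fun loc d => .seq (p loc d) (.seq (q loc (d + 2)) (.seq (.assign (d + 1) (.lit 0))
    (.seq (.ite (.lt (.reg 0) (.reg (d + 2))) (.assign (d + 2) (.reg 0))
        (.assign (d + 2) (.reg (d + 2))))
      (.while (.lt (.reg (d + 1)) (.reg (d + 2)))
        (.seq (r (loc' loc d) (d + 3)) (.seq (.assign d (.reg (d + 3)))
          (.assign (d + 1) (.add (.reg (d + 1)) (.lit 1))))))))),
    fun N => T N + U N + 8 + (N + 1) * (4 + (V N + 6)),
    ((hT.add hU).add (.const _)).add
      ((PolyBounded.id.add (.const _)).mul ((PolyBounded.const _).add (hV.add (.const _)))),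
    fun x s loc d hs => ?_⟩
  obtain ⟨s1, t1, h1, h1t, h1m, h1r, h1v⟩ := hp x s loc d hs
  obtain ⟨s2, t2, h2, h2t, h2m, h2r, h2v⟩ :=
    hq x s1 loc (d + 2) (hs.mono (by omega) h1m h1r)
  set N := (Ctx.mach x).size with hN
  set n := min (B x) N with hn
  set g : ℕ → ℕ := fun k => Nat.rec (motive := fun _ => ℕ) (a x) (fun i acc => f x i acc) k with hg
  let P : ℕ → State → Prop := fun i s' => s'.mem = s.mem ∧ (∀ r < d, s'.reg r = s.reg r) ∧
    s'.reg d = g i ∧ s'.reg (d + 1) = i ∧ s'.reg (d + 2) = n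
  have hd : 0 < d := hs.1
  have h20 : s2.reg 0 = N := by rw [h2r 0 (by omega), h1r 0 hd, hs.2.1]
  obtain ⟨s3, t3, h3, h3t, h3P⟩ : ∃ s3 t3, Run (.seq (.assign (d + 1) (.lit 0))
      (.ite (.lt (.reg 0) (.reg (d + 2))) (.assign (d + 2) (.reg 0))
        (.assign (d + 2) (.reg (d + 2))))) s2 s3 t3 ∧ t3 ≤ 8 ∧ P 0 s3 := by
    by_cases hc : N < B x
    · refine ⟨_, _, (Run.assign _ _ _).seq (Run.ite_true ?_ (Run.assign _ _ _)), ?_, ?_⟩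
      · simp [Expr.eval, Function.update_of_ne, h20, h2v, hc]
      · simp [Expr.cost]
      · refine ⟨by simp [h2m, h1m], fun r hr => ?_, ?_, ?_, ?_⟩
        · simp [Function.update_of_ne, show r ≠ d + 2 by omega, show r ≠ d + 1 by omega,
            h2r r (by omega), h1r r hr]
        · simp [Function.update_of_ne, h2r d (by omega), h1v, hg]
        · simp [Expr.eval]
        · simp [Expr.eval, Function.update_of_ne, h20, hn, hc.le]
    · refine ⟨_, _, (Run.assign _ _ _).seq (Run.ite_false ?_ (Run.assign _ _ _)), ?_, ?_⟩
      · simp [Expr.eval, Function.update_of_ne, h20, h2v, hc]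
      · simp [Expr.cost]
      · refine ⟨by simp [h2m, h1m], fun r hr => ?_, ?_, ?_, ?_⟩
        · simp [Function.update_of_ne, show r ≠ d + 2 by omega, show r ≠ d + 1 by omega,
            h2r r (by omega), h1r r hr]
        · simp [Function.update_of_ne, h2r d (by omega), h1v, hg]
        · simp [Expr.eval]
        · simp [Expr.eval, Function.update_of_ne, h2v, hn, not_lt.mp hc]
  obtain ⟨s4, t4, h4, h4t, h4P⟩ := Run.while_bounded (e := .lt (.reg (d + 1)) (.reg (d + 2)))
    (p := .seq (r (loc' loc d) (d + 3)) (.seq (.assign d (.reg (d + 3)))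
          (.assign (d + 1) (.add (.reg (d + 1)) (.lit 1))))) P n (V N + 6) (by
      rintro i hi s' ⟨hm, hreg, hv, hidx, hbd⟩
      refine ⟨by simp [Expr.eval, hidx, hbd, hi], ?_⟩
      have hfit : Fits s' ((x, i), g i) (loc' loc d) (d + 3) := by
        have h' := hs.mono (le_refl d) hm hreg
        refine ⟨by omega, h'.2.1, h'.2.2.1, fun k hk => ?_⟩
        change k < Ctx.depth α + 1 + 1 at hk
        by_cases hk1 : k = Ctx.depth α + 1
        · subst hk1
          simp only [loc', Function.update_self]
          refine ⟨by omega, ?_⟩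
          rw [hv]
          exact (if_pos rfl).symm
        by_cases hk2 : k = Ctx.depth α
        · subst hk2
          simp only [loc', Function.update_self, Function.update_of_ne hk1]
          refine ⟨by omega, ?_⟩
          rw [hidx]
          exact ((if_neg hk1).trans (if_pos rfl)).symm
        · simp only [loc', Function.update_of_ne hk1, Function.update_of_ne hk2]
          obtain ⟨h5, h6⟩ := h'.2.2.2 k (by omega)
          refine ⟨by omega, h6.trans ?_⟩
          exact ((if_neg hk1).trans (if_neg hk2)).symm
      obtain ⟨s5, t5, h5, h5t, h5m, h5r, h5v⟩ := hr _ s' _ _ hfit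
      refine ⟨_, _, h5.seq ((Run.assign _ _ _).seq (Run.assign _ _ _)), ?_, ?_, ?_, ?_, ?_, ?_⟩
      · change t5 ≤ V N at h5t
        simp only [Expr.cost]; omega
      · simp [h5m, hm]
      · intro r hr
        simp [Function.update_of_ne, hr.ne, show r ≠ d + 1 by omega, h5r r (by omega), hreg r hr]
      · simp [Function.update_of_ne, Expr.eval, h5v, hg]
      · simp [Function.update_of_ne, Expr.eval, h5r (d + 1) (by omega), hidx]
      · simp [Function.update_of_ne, h5r (d + 2) (by omega), hbd])
    (by
      rintro s' ⟨-, -, -, hidx, hbd⟩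
      simp [Expr.eval, hidx, hbd]) h3P
  cases h3 with
  | seq h3a h3b =>
  refine ⟨s4, _, h1.seq (h2.seq (h3a.seq (h3b.seq h4))), ?_, h4P.1, h4P.2.1, h4P.2.2.1⟩
  have : (n + 1) * (4 + (V N + 6)) ≤ (N + 1) * (4 + (V N + 6)) :=
    Nat.mul_le_mul_right _ (by have := min_le_right (B x) N; omega)
  simp only [Expr.cost] at h4t
  have h4t' : t4 ≤ (n + 1) * (4 + (V N + 6)) := by simpa using h4t
  beta_reduce
  omega

end PF

end RAM

namespace RAM

open Classical

/-! ### Closure properties -/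

namespace PF

variable {α : Type} [Ctx α]

theorem ite {P : α → Prop} {a b : α → ℕ} (hP : PFP P) (ha : PF a) (hb : PF b) :
    PF fun x => if P x then a x else b x :=
  (ite_ne_zero hP ha hb).congr fun x => by by_cases h : P x <;> simp [h]

theorem sum' {B : α → ℕ} {f : α → ℕ → ℕ} (hB : PF B) (hf : PF fun y : α × ℕ => f y.1 y.2) :
    PF fun x => ∑ i ∈ Finset.range (min (B x) (Ctx.mach x).size), f x i :=
  (iter (f := fun x i acc => acc + f x i) hB (const 0) (snd.add hf.fst)).congr fun x => by
    induction min (B x) (Ctx.mach x).size with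
    | zero => rfl
    | succ k ih => rw [Finset.sum_range_succ, ← ih]

theorem sum {B : α → ℕ} {f : α → ℕ → ℕ} (hB : PF B) (hle : ∀ x, B x ≤ (Ctx.mach x).size)
    (hf : PF fun y : α × ℕ => f y.1 y.2) : PF fun x => ∑ i ∈ Finset.range (B x), f x i :=
  (sum' hB hf).congr fun x => by rw [min_eq_left (hle x)]

end PF

namespace PFP

variable {α : Type} [Ctx α]

theorem congr {P Q : α → Prop} (hP : PFP P) (h : ∀ x, P x ↔ Q x) : PFP Q := by
  have : P = Q := funext fun x => propext (h x)
  rwa [← this]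

theorem lt {a b : α → ℕ} (ha : PF a) (hb : PF b) : PFP fun x => a x < b x :=
  PF.congr (PF.binop .lt (fun m n => if m < n then 1 else 0) (fun _ _ _ => by simp [Expr.eval])
    (fun _ _ => rfl) ha hb) fun x => by by_cases h : a x < b x <;> simp [h]

theorem eq {a b : α → ℕ} (ha : PF a) (hb : PF b) : PFP fun x => a x = b x :=
  PF.congr (PF.binop .eq (fun m n => if m = n then 1 else 0) (fun _ _ _ => by simp [Expr.eval])
    (fun _ _ => rfl) ha hb) fun x => by by_cases h : a x = b x <;> simp [h]

theorem not {P : α → Prop} (hP : PFP P) : PFP fun x => ¬P x :=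
  PF.congr (PF.ite hP (PF.const 0) (PF.const 1)) fun x => by by_cases h : P x <;> simp [h]

theorem and {P Q : α → Prop} (hP : PFP P) (hQ : PFP Q) : PFP fun x => P x ∧ Q x :=
  PF.congr (PF.ite hP hQ (PF.const 0)) fun x => by by_cases h : P x <;> simp [h]

theorem or {P Q : α → Prop} (hP : PFP P) (hQ : PFP Q) : PFP fun x => P x ∨ Q x :=
  PF.congr (PF.ite hP (PF.const 1) hQ) fun x => by by_cases h : P x <;> simp [h]

theorem imp {P Q : α → Prop} (hP : PFP P) (hQ : PFP Q) : PFP fun x => P x → Q x :=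
  (hP.not.or hQ).congr fun x => by tauto

theorem iff {P Q : α → Prop} (hP : PFP P) (hQ : PFP Q) : PFP fun x => P x ↔ Q x :=
  ((hP.imp hQ).and (hQ.imp hP)).congr fun x => by tauto

theorem le {a b : α → ℕ} (ha : PF a) (hb : PF b) : PFP fun x => a x ≤ b x :=
  (lt hb ha).not.congr fun _ => not_lt

theorem ne {a b : α → ℕ} (ha : PF a) (hb : PF b) : PFP fun x => a x ≠ b x :=
  (eq ha hb).not

theorem ite {P Q R : α → Prop} (hP : PFP P) (hQ : PFP Q) (hR : PFP R) :
    PFP fun x => if P x then Q x else R x :=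
  ((hP.and hQ).or (hP.not.and hR)).congr fun x => by by_cases h : P x <;> simp [h]

theorem ex {B : α → ℕ} {P : α → ℕ → Prop} (hB : PF B) (hle : ∀ x, B x ≤ (Ctx.mach x).size)
    (hP : PFP fun y : α × ℕ => P y.1 y.2) : PFP fun x => ∃ i < B x, P x i :=
  (ne (PF.sum (f := fun x i => if P x i then 1 else 0) hB hle hP) (PF.const 0)).congr fun x => by
    simp

theorem all {B : α → ℕ} {P : α → ℕ → Prop} (hB : PF B) (hle : ∀ x, B x ≤ (Ctx.mach x).size)
    (hP : PFP fun y : α × ℕ => P y.1 y.2) : PFP fun x => ∀ i < B x, P x i :=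
  (ex (P := fun x i => ¬P x i) hB hle hP.not).not.congr fun x => by push Not; rfl

end PFP

/-- The number of `i < b` with `P i`. -/
noncomputable def countBelow (b : ℕ) (P : ℕ → Prop) : ℕ :=
  ((Finset.range b).filter P).card

/-- The least `i < b` with `P i`, or `b` if there is none. -/
noncomputable def leastBelow (b : ℕ) (P : ℕ → Prop) : ℕ :=
  countBelow b fun j => ∀ i < b, i ≤ j → ¬P i

theorem countBelow_lt {b c : ℕ} (h : c ≤ b) : countBelow b (fun j => j < c) = c := by
  refine Eq.trans ?_ (Finset.card_range c)
  unfold countBelow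
  congr 1
  ext j
  simp only [Finset.mem_filter, Finset.mem_range]
  omega

theorem countBelow_congr {b : ℕ} {P Q : ℕ → Prop} (h : ∀ i < b, P i ↔ Q i) :
    countBelow b P = countBelow b Q := by
  unfold countBelow
  congr 1
  exact Finset.filter_congr fun i hi => h i (Finset.mem_range.mp hi)

/-- The indices counted by `leastBelow` are those with no witness up to and including them, hence
exactly the numbers below the least witness. In this form a search is just a count. -/
theorem leastBelow_spec {b : ℕ} {P : ℕ → Prop} (h : ∃ i < b, P i) :
    leastBelow b P < b ∧ P (leastBelow b P) := by
  have h' : ∃ i, i < b ∧ P i := h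
  obtain ⟨h1, h2⟩ := Nat.find_spec h'
  have : leastBelow b P = Nat.find h' := by
    rw [leastBelow, countBelow_congr (Q := fun j => j < Nat.find h'), countBelow_lt h1.le]
    intro j hj
    constructor
    · intro h3
      by_contra h4
      exact h3 _ h1 (not_lt.mp h4) h2
    · intro h3 i hi hij hP
      exact Nat.find_min h' (lt_of_le_of_lt hij h3) ⟨hi, hP⟩
  rw [this]
  exact ⟨h1, h2⟩

theorem leastBelow_eq {b : ℕ} {P : ℕ → Prop} (h : ¬∃ i < b, P i) : leastBelow b P = b := by
  push Not at h
  rw [leastBelow, countBelow_congr (Q := fun j => j < b), countBelow_lt le_rfl]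
  exact fun j hj => ⟨fun _ => hj, fun _ i hi _ => h i hi⟩

namespace PF

variable {α : Type} [Ctx α]

theorem count {B : α → ℕ} {P : α → ℕ → Prop} (hB : PF B) (hle : ∀ x, B x ≤ (Ctx.mach x).size)
    (hP : PFP fun y : α × ℕ => P y.1 y.2) : PF fun x => countBelow (B x) (P x) :=
  (sum (f := fun x i => if P x i then 1 else 0) hB hle hP).congr fun x => by
    rw [countBelow, Finset.card_filter]

theorem least {B : α → ℕ} {P : α → ℕ → Prop} (hB : PF B) (hle : ∀ x, B x ≤ (Ctx.mach x).size)
    (hP : PFP fun y : α × ℕ => P y.1 y.2) : PF fun x => leastBelow (B x) (P x) := by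
  -- Inside the quantifier the variable `j` stands between the context and the argument of `P`. It
  -- is skipped by renaming: `P` looks up its argument in the register of the next variable.
  have hP' : PFP fun y : (α × ℕ) × ℕ => P y.1.1 y.2 := by
    obtain ⟨p, T, hT, h⟩ := hP
    refine ⟨fun loc d => p (fun k => if k = Ctx.depth α then loc (k + 1) else loc k) d, T, hT,
      fun y s loc d hs => h (y.1.1, y.2) s _ d ?_⟩
    refine ⟨hs.1, hs.2.1, hs.2.2.1, fun k hk => ?_⟩
    change k < Ctx.depth α + 1 at hk
    by_cases hk' : k = Ctx.depth α
    · have := hs.2.2.2 (k + 1) (by change k + 1 < Ctx.depth α + 1 + 1; omega)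
      simp only [if_pos hk']
      refine ⟨this.1, this.2.trans ?_⟩
      simp [Ctx.var, hk', Ctx.depth]
    · have := hs.2.2.2 k (by change k < Ctx.depth α + 1 + 1; omega)
      simp only [if_neg hk']
      refine ⟨this.1, this.2.trans ?_⟩
      simp [Ctx.var, hk', Ctx.depth, show k ≠ Ctx.depth α + 1 by omega]
  exact count (P := fun x j => ∀ i < B x, i ≤ j → ¬P x i) hB hle
    (PFP.congr (PFP.all (P := fun y i => i ≤ y.2 → ¬P y.1 i) hB.fst (fun y => hle y.1)
      ((PFP.le snd snd.fst).imp hP'.not)) fun _ => Iff.rfl)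

/-- The machine has no multiplication: `b` is added `a` times, so `a` must not exceed the memory
size. -/
theorem mul {a b : α → ℕ} (ha : PF a) (hle : ∀ x, a x ≤ (Ctx.mach x).size) (hb : PF b) :
    PF fun x => a x * b x :=
  (sum (f := fun x _ => b x) ha hle hb.fst).congr fun x => by simp

theorem min {a b : α → ℕ} (ha : PF a) (hb : PF b) : PF fun x => min (a x) (b x) :=
  (ite (PFP.le ha hb) ha hb).congr fun x => by
    by_cases h : a x ≤ b x <;> simp [h, le_of_not_ge]

theorem max {a b : α → ℕ} (ha : PF a) (hb : PF b) : PF fun x => max (a x) (b x) :=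
  (ite (PFP.le ha hb) hb ha).congr fun x => by
    by_cases h : a x ≤ b x <;> simp [h, le_of_not_ge]

theorem two_pow {a : α → ℕ} (ha : PF a) (hle : ∀ x, a x ≤ (Ctx.mach x).size) :
    PF fun x => 2 ^ a x :=
  (iter (f := fun _ _ acc => acc + acc) ha (const 1) (snd.add snd)).congr fun x => by
    rw [min_eq_left (hle x)]
    induction a x with
    | zero => rfl
    | succ k ih => rw [pow_succ, ← ih, mul_two]

theorem div {a b : α → ℕ} (ha : PF a) (hle : ∀ x, a x ≤ (Ctx.mach x).size) (hb : PF b) :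
    PF fun x => a x / b x := by
  have h : PF fun x => countBelow (a x) (fun q => (q + 1) * b x ≤ a x) :=
    -- The minimum bounds the first factor by the memory size in every context; for the counted `q <
    -- a x` it equals `q + 1`.
    count (P := fun x q => Min.min (q + 1) (a x) * b x ≤ a x) ha hle (PFP.le ((mul (α := α × ℕ) (min (snd.add (const 1)) ha.fst)
      (fun x => (min_le_right _ _).trans (hle x.1)) hb.fst)) ha.fst) |>.congr fun x =>
        countBelow_congr fun i hi => by
          rw [min_eq_left (Nat.succ_le_of_lt hi)]
  refine (ite (PFP.eq hb (const 0)) (const 0) h).congr fun x => ?_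
  by_cases hbx : b x = 0
  · simp [hbx]
  · rw [if_neg hbx, countBelow_congr (Q := fun j => j < a x / b x),
      countBelow_lt (Nat.div_le_self _ _)]
    intro i _
    rw [← Nat.succ_le_iff, Nat.le_div_iff_mul_le (by omega)]

theorem mod {a b : α → ℕ} (ha : PF a) (hle : ∀ x, a x ≤ (Ctx.mach x).size) (hb : PF b) :
    PF fun x => a x % b x :=
  (sub ha (mul (div ha hle hb) (fun x => (Nat.div_le_self _ _).trans (hle x)) hb)).congr
    fun x => by
      have := Nat.div_add_mod (a x) (b x)
      rw [mul_comm] at this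
      omega

end PF

/-! ### Transforming a bounded memory -/

/-- The state `s` holds the bounded memory `x`. -/
def Models (s : State) (x : Mach) : Prop :=
  s.reg 0 = x.size ∧ ∀ i < x.size, s.mem i = x.mem i

/-- `F` can be carried out in time polynomial in the size of the memory. -/
def MF (F : Mach → Mach) : Prop :=
  ∃ (p : ℕ → Prog) (T : ℕ → ℕ), PolyBounded T ∧ ∀ (x : Mach) (s : State) (d : ℕ), 0 < d →
    Models s x → ∃ s' t, Run (p d) s s' t ∧ t ≤ T x.size ∧ Models s' (F x) ∧
      ∀ r < d, s'.reg r = s.reg r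

namespace MF

/-- Since `F` keeps the size, both time bounds are taken at the same argument, and no composition of
polynomials arises. -/
theorem comp {F G : Mach → Mach} (hG : MF G) (hF : MF F) (hsize : ∀ x, (F x).size = x.size) :
    MF fun x => G (F x) := by
  obtain ⟨p, T, hT, hp⟩ := hF
  obtain ⟨q, U, hU, hq⟩ := hG
  refine ⟨fun d => .seq (p d) (q d), fun N => T N + U N, hT.add hU, fun x s d hd hs => ?_⟩
  obtain ⟨s1, t1, h1, h1t, h1m, h1r⟩ := hp x s d hd hs
  obtain ⟨s2, t2, h2, h2t, h2m, h2r⟩ := hq (F x) s1 d hd h1m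
  rw [hsize] at h2t
  exact ⟨s2, _, h1.seq h2, by beta_reduce; omega, h2m, fun r hr => by rw [h2r r hr, h1r r hr]⟩

/-- Replace all cells simultaneously. -/
theorem map {f : Mach → ℕ → ℕ} (hf : PF fun y : Mach × ℕ => f y.1 y.2) :
    MF fun x => ⟨x.size, f x⟩ := by
  obtain ⟨p, T, hT, hp⟩ := hf
  -- The new values go to the cells `N, ..., 2 * N - 1` first, because `f` still reads the old
  -- contents; the second loop copies them back.
  refine ⟨fun d => .seq (.assign d (.lit 0)) (.seq
    (.while (.lt (.reg d) (.reg 0)) (.seq (p (fun _ => d) (d + 1))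
      (.seq (.store (.add (.reg 0) (.reg d)) (.reg (d + 1)))
        (.assign d (.add (.reg d) (.lit 1))))))
    (.seq (.assign d (.lit 0))
      (.while (.lt (.reg d) (.reg 0)) (.seq
        (.store (.reg d) (.mem (.add (.reg 0) (.reg d))))
        (.assign d (.add (.reg d) (.lit 1))))))),
    fun N => 2 + ((N + 1) * (4 + (T N + 9)) + (2 + (N + 1) * (4 + 10))), ?_, ?_⟩
  · exact (PolyBounded.const _).add (((PolyBounded.id.add (.const _)).mul
      ((PolyBounded.const _).add (hT.add (.const _)))).add ((PolyBounded.const _).add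
        ((PolyBounded.id.add (.const _)).mul (.const _))))
  intro x s d hd hs
  set N := x.size with hN
  obtain ⟨s1, t1, h1, h1t, h1P⟩ := Run.while_bounded (e := .lt (.reg d) (.reg 0))
    (p := .seq (p (fun _ => d) (d + 1))
      (.seq (.store (.add (.reg 0) (.reg d)) (.reg (d + 1)))
        (.assign d (.add (.reg d) (.lit 1)))))
    (fun i s' => Models s' x ∧ (∀ r < d, s'.reg r = s.reg r) ∧ s'.reg d = i ∧
      ∀ j < i, s'.mem (N + j) = f x j) N (T N + 9) (by
      rintro i hi s' ⟨hm, hr, hd', hout⟩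
      have h0 : s'.reg 0 = N := hm.1
      refine ⟨by simp [Expr.eval, hd', h0, hi], ?_⟩
      obtain ⟨s2, t2, h2, h2t, h2m, h2r, h2v⟩ := hp (x, i) s' (fun _ => d) (d + 1)
        ⟨by omega, hm.1, hm.2, fun k hk => ⟨Nat.lt_succ_self d, by
          have hk : k < 0 + 1 := hk
          have hk0 : k = 0 := by omega
          subst hk0
          exact hd'.trans (if_pos rfl).symm⟩⟩
      refine ⟨_, _, h2.seq ((Run.store _ _ _).seq (Run.assign _ _ _)), ?_, ⟨?_, ?_⟩, ?_, ?_, ?_⟩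
      · change t2 ≤ T N at h2t
        simp only [Expr.cost]; omega
      · simp [Function.update_of_ne, hd.ne, h2r 0 (by omega), h0, hN]
      · intro j hj
        have : j ≠ N + i := by omega
        simp [Expr.eval, h2r 0 (by omega), h2r d (by omega), h0, hd', Function.update_of_ne this,
          h2m, hm.2 j hj]
      · intro r hrd
        simp [Function.update_of_ne hrd.ne, h2r r (by omega), hr r hrd]
      · simp [Expr.eval, h2r d (by omega), hd']
      · intro j hj
        by_cases hji : j = i
        · subst hji
          simp [Expr.eval, h2r 0 (by omega), h2r d (by omega), h0, hd', h2v]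
        · have hji' : N + j ≠ N + i := by omega
          simp only [Expr.eval, h2r 0 (by omega : 0 < d + 1), h2r d (by omega : d < d + 1), h0, hd',
            h2m, Function.update_of_ne hji']
          exact hout j (by omega))
    (by
      rintro s' ⟨hm, -, hd', -⟩
      have h0 : s'.reg 0 = N := hm.1
      simp [Expr.eval, hd', h0])
    (s := { s with reg := Function.update s.reg d 0 })
    ⟨⟨by simp [Function.update_of_ne, hd.ne, hs.1], hs.2⟩,
      fun r hr => by simp [Function.update_of_ne hr.ne], by simp, fun j hj => by omega⟩
  obtain ⟨h1m, h1r, -, h1out⟩ := h1P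
  obtain ⟨s2, t2, h2, h2t, h2P⟩ := Run.while_bounded (e := .lt (.reg d) (.reg 0))
    (p := .seq (.store (.reg d) (.mem (.add (.reg 0) (.reg d))))
        (.assign d (.add (.reg d) (.lit 1))))
    (fun i s' => s'.reg 0 = N ∧ (∀ r < d, s'.reg r = s.reg r) ∧ s'.reg d = i ∧
      (∀ j < N, s'.mem (N + j) = f x j) ∧ ∀ j < i, s'.mem j = f x j) N 10 (by
      rintro i hi s' ⟨h0, hr, hd', hout, hres⟩
      refine ⟨by simp [Expr.eval, hd', h0, hi], ?_⟩
      refine ⟨_, _, (Run.store _ _ _).seq (Run.assign _ _ _), ?_, ?_, ?_, ?_, ?_, ?_⟩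
      · simp [Expr.cost]
      · simp [Function.update_of_ne, hd.ne, h0]
      · intro r hrd
        simp [Function.update_of_ne hrd.ne, hr r hrd]
      · simp [Expr.eval, hd']
      · intro j hj
        have : N + j ≠ i := by omega
        simp [Expr.eval, hd', Function.update_of_ne this, hout j hj]
      · intro j hj
        by_cases hji : j = i
        · subst hji
          simp [Expr.eval, h0, hd', hout j hi]
        · simp only [Expr.eval, hd', Function.update_of_ne hji]
          exact hres j (by omega))
    (by
      rintro s' ⟨h0, -, hd', -⟩
      simp [Expr.eval, hd', h0])
    (s := { s1 with reg := Function.update s1.reg d 0 })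
    ⟨by simp [Function.update_of_ne, hd.ne, h1m.1, hN],
      fun r hr => by simp [Function.update_of_ne hr.ne, h1r r hr], by simp, h1out,
      fun j hj => by omega⟩
  obtain ⟨h20, h2r, -, -, h2res⟩ := h2P
  refine ⟨s2, _, (Run.assign_eq _ _ _ rfl rfl).seq (h1.seq ((Run.assign_eq _ _ _ rfl rfl).seq h2)),
    ?_, ⟨h20, h2res⟩, h2r⟩
  replace h1t : t1 ≤ (N + 1) * (4 + (T N + 9)) := h1t
  replace h2t : t2 ≤ (N + 1) * (4 + 10) := h2t
  simp only [Expr.cost]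
  omega

theorem iterate {F : Mach → Mach} (hF : MF F) (hsize : ∀ x, (F x).size = x.size) :
    MF fun x => F^[x.size] x := by
  obtain ⟨p, T, hT, hp⟩ := hF
  refine ⟨fun d => .seq (.assign d (.lit 0)) (.while (.lt (.reg d) (.reg 0))
    (.seq (p (d + 1)) (.assign d (.add (.reg d) (.lit 1))))),
    fun N => 2 + (N + 1) * (4 + (T N + 4)), ?_, ?_⟩
  · exact (PolyBounded.const _).add ((PolyBounded.id.add (.const _)).mul
      ((PolyBounded.const _).add (hT.add (.const _))))
  intro x s d hd hs
  have hsz : ∀ i, (F^[i] x).size = x.size := by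
    intro i
    induction i with
    | zero => rfl
    | succ i ih => rw [Function.iterate_succ_apply', hsize, ih]
  obtain ⟨s1, t1, h1, h1t, h1P⟩ := Run.while_bounded (e := .lt (.reg d) (.reg 0))
    (p := .seq (p (d + 1)) (.assign d (.add (.reg d) (.lit 1))))
    (fun i s' => Models s' (F^[i] x) ∧ (∀ r < d, s'.reg r = s.reg r) ∧ s'.reg d = i)
    x.size (T x.size + 4) (by
      rintro i hi s' ⟨hm, hr, hd'⟩
      have h0 : s'.reg 0 = x.size := by rw [hm.1, hsz]
      refine ⟨by simp [Expr.eval, hd', h0, hi], ?_⟩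
      obtain ⟨s2, t2, h2, h2t, h2m, h2r⟩ := hp _ s' (d + 1) (by omega) hm
      rw [hsz] at h2t
      refine ⟨_, _, h2.seq (Run.assign _ _ _), ?_, ⟨?_, ?_⟩, ?_, ?_⟩
      · simp only [Expr.cost]; omega
      · rw [Function.iterate_succ_apply']
        simp [Function.update_of_ne, hd.ne, h2m.1]
      · rw [Function.iterate_succ_apply']
        exact h2m.2
      · intro r hrd
        simp [Function.update_of_ne hrd.ne, h2r r (by omega), hr r hrd]
      · simp [Expr.eval, h2r d (by omega), hd'])
    (by
      rintro s' ⟨hm, -, hd'⟩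
      have h0 : s'.reg 0 = x.size := by rw [hm.1, hsz]
      simp [Expr.eval, hd', h0])
    (s := { s with reg := Function.update s.reg d 0 })
    ⟨⟨by simp [Function.update_of_ne, hd.ne, hs.1], hs.2⟩,
      fun r hr => by simp [Function.update_of_ne hr.ne], by simp⟩
  refine ⟨s1, _, (Run.assign_eq _ _ _ rfl rfl).seq h1, ?_, h1P.1, h1P.2.1⟩
  replace h1t : t1 ≤ (x.size + 1) * (4 + (T x.size + 4)) := h1t
  simp only [Expr.cost]
  omega

end MF

/-- Change the size of the memory to a value computed from its present contents. -/
theorem PF.resize {g : Mach → ℕ} (hg : PF g) :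
    ∃ (p : Prog) (T : ℕ → ℕ), PolyBounded T ∧ ∀ (x : Mach) (s : State), Models s x →
      ∃ s' t, Run p s s' t ∧ t ≤ T x.size ∧ s'.mem = s.mem ∧ s'.reg 0 = g x := by
  obtain ⟨p, T, hT, hp⟩ := hg
  refine ⟨.seq (p id 1) (.assign 0 (.reg 1)), fun N => T N + 2, hT.add (.const _),
    fun x s hs => ?_⟩
  obtain ⟨s1, t1, h1, h1t, h1m, -, h1v⟩ := hp x s id 1
    ⟨one_pos, hs.1, hs.2, fun k hk => absurd hk (Nat.not_lt_zero k)⟩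
  refine ⟨_, _, h1.seq (Run.assign _ _ _), ?_, h1m, ?_⟩
  · change t1 ≤ T x.size at h1t
    simp only [Expr.cost]; omega
  · simp [Expr.eval, h1v]

end RAM

namespace SimpleGraph

open Classical

variable {V W : Type*} {G : SimpleGraph V} {H : SimpleGraph W}

/-! ### Distances and deletion of vertices -/

theorem Hom.edist_le (f : G →g H) (a b : V) : H.edist (f a) (f b) ≤ G.edist a b := by
  by_cases h : G.edist a b = ⊤
  · rw [h]; exact le_top
  · obtain ⟨p, hp⟩ := exists_walk_of_edist_ne_top h
    rw [← hp, ← Walk.length_map f p]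
    exact SimpleGraph.edist_le _

theorem Iso.edist_eq (f : G ≃g H) (a b : V) : H.edist (f a) (f b) = G.edist a b := by
  refine le_antisymm (Hom.edist_le f.toHom a b) ?_
  have := Hom.edist_le f.symm.toHom (f a) (f b)
  simpa using this

theorem edist_le_succ_iff {a b : V} {r : ℕ} :
    G.edist a b ≤ (r + 1 : ℕ) ↔ ∃ y, (y = b ∨ G.Adj y b) ∧ G.edist a y ≤ r := by
  constructor
  · intro h
    have hne : G.edist a b ≠ ⊤ := fun h' => by simp [h'] at h
    obtain ⟨p, hp⟩ := exists_walk_of_edist_ne_top hne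
    rw [← hp, Nat.cast_le, ← Walk.length_reverse] at h
    cases hq : p.reverse with
    | nil => exact ⟨a, Or.inl rfl, by simp⟩
    | cons hadj q =>
      rw [hq, Walk.length_cons] at h
      refine ⟨_, Or.inr hadj.symm, ?_⟩
      rw [edist_comm]
      exact (edist_le q).trans (by exact_mod_cast (by omega))
  · rintro ⟨y, rfl | hy, h⟩
    · exact h.trans (by exact_mod_cast Nat.le_succ r)
    · refine G.edist_triangle.trans (add_le_add h (edist_eq_one_iff_adj.mpr hy).le |>.trans ?_)
      push_cast; exact le_rfl

/-- Deleting the vertices outside the range of `φ` preserves distances if they can be moved into the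
range by automorphisms. -/
theorem Embedding.edist_eq (φ : H ↪g G)
    (h : ∀ a b, ∀ y ∉ Set.range φ, G.Adj y (φ b) →
      ∃ σ : G ≃g G, σ (φ a) = φ a ∧ σ (φ b) = φ b ∧ σ y ∈ Set.range φ) (a b : W) :
    G.edist (φ a) (φ b) = H.edist a b := by
  refine le_antisymm (Hom.edist_le φ.toHom a b) ?_
  have key : ∀ r : ℕ, ∀ b, G.edist (φ a) (φ b) ≤ r → H.edist a b ≤ r := by
    intro r
    induction r with
    | zero =>
      intro b hb
      have : φ a = φ b := by simpa using hb
      rw [φ.injective this]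
      simp
    | succ r ih =>
      intro b hb
      obtain ⟨y, hy, hay⟩ := edist_le_succ_iff.mp hb
      refine edist_le_succ_iff.mpr ?_
      by_cases hyr : y ∈ Set.range φ
      · obtain ⟨z, rfl⟩ := hyr
        exact ⟨z, hy.imp (fun h => φ.injective h) φ.map_adj_iff.mp, ih z hay⟩
      · have hyb : G.Adj y (φ b) := hy.resolve_left fun h => hyr (h ▸ ⟨b, rfl⟩)
        -- The penultimate vertex `y` of a shortest path has been deleted. Its image under `σ`
        -- survives, is adjacent to `φ b` and is as far from `φ a` as `y`.
        obtain ⟨σ, ha, hb', z, hz⟩ := h a b y hyr hyb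
        refine ⟨z, Or.inr ?_, ih z ?_⟩
        · rw [← φ.map_adj_iff, hz, ← hb', σ.map_adj_iff]
          exact hyb
        · rw [hz, ← ha, Iso.edist_eq]
          exact hay
  by_cases ht : G.edist (φ a) (φ b) = ⊤
  · rw [ht]; exact le_top
  · obtain ⟨r, hr⟩ := ENat.ne_top_iff_exists.mp ht
    rw [← hr]
    exact key r b hr.ge

/-- `S` distinguishes any two vertices of `U`. -/
def ResolvesOn (G : SimpleGraph V) (S : Finset V) (U : Set V) : Prop :=
  ∀ u ∈ U, ∀ v ∈ U, u ≠ v → ∃ w ∈ S, G.edist w u ≠ G.edist w v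

/-- An adjacency preserving permutation, as an automorphism. -/
def autOfPerm (σ : Equiv.Perm V) (h : ∀ a b, G.Adj (σ a) (σ b) ↔ G.Adj a b) : G ≃g G :=
  ⟨σ, fun {a b} => h a b⟩

theorem FalseTwins.adj_iff {u v : V} (h : G.FalseTwins u v) (z : V) : G.Adj u z ↔ G.Adj v z := by
  have := Set.ext_iff.mp h z
  simpa using this

theorem FalseTwins.not_adj {u v : V} (h : G.FalseTwins u v) : ¬G.Adj u v := fun h' =>
  G.loopless.irrefl v ((h.adj_iff v).mp h')

theorem FalseTwins.exists_aut {u v : V} (h : G.FalseTwins u v) :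
    ∃ σ : G ≃g G, σ u = v ∧ σ v = u ∧ ∀ a, a ≠ u → a ≠ v → σ a = a := by
  refine ⟨autOfPerm (Equiv.swap u v) fun a b => ?_, ?_, ?_, fun a h1 h2 => ?_⟩
  · have h1 : ∀ a b, G.Adj (Equiv.swap u v a) b ↔ G.Adj a b := by
      intro a b
      rcases eq_or_ne a u with rfl | hau
      · rw [Equiv.swap_apply_left, h.adj_iff]
      rcases eq_or_ne a v with rfl | hav
      · rw [Equiv.swap_apply_right, h.adj_iff]
      rw [Equiv.swap_apply_of_ne_of_ne hau hav]
    rw [h1, G.adj_comm, h1, G.adj_comm]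
  · exact Equiv.swap_apply_left u v
  · exact Equiv.swap_apply_right u v
  · exact Equiv.swap_apply_of_ne_of_ne h1 h2

theorem FalseTwins.edist_eq {u v a : V} (h : G.FalseTwins u v) (hu : a ≠ u) (hv : a ≠ v) :
    G.edist u a = G.edist v a := by
  obtain ⟨σ, h1, -, h3⟩ := h.exists_aut
  have := Iso.edist_eq σ u a
  rw [h1, h3 a hu hv] at this
  exact this.symm

/-- The automorphism swapping `u` and `v` fixes every other vertex, so only `u` and `v` themselves
can tell them apart. -/
theorem ResolvesOn.mem_or_mem_of_falseTwins {S : Finset V} {U : Set V} (hS : G.ResolvesOn S U)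
    {u v : V} (hu : u ∈ U) (hv : v ∈ U) (huv : u ≠ v) (h : G.FalseTwins u v) : u ∈ S ∨ v ∈ S := by
  obtain ⟨w, hw, hne⟩ := hS u hu v hv huv
  by_contra hcon
  push Not at hcon
  refine hne ?_
  rw [edist_comm, h.edist_eq (fun h' => hcon.1 (h' ▸ hw)) fun h' => hcon.2 (h' ▸ hw), edist_comm]

theorem ResolvesOn.image {S : Finset V} {U : Set V} (hS : G.ResolvesOn S U) (σ : G ≃g G) :
    G.ResolvesOn (S.image σ) (σ '' U) := by
  rintro _ ⟨u, hu, rfl⟩ _ ⟨v, hv, rfl⟩ huv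
  obtain ⟨w, hw, hne⟩ := hS u hu v hv fun h => huv (h ▸ rfl)
  exact ⟨σ w, Finset.mem_image_of_mem _ hw, by simpa only [Iso.edist_eq] using hne⟩

/-! ### The parts of a co-cluster graph -/

/-- Non-adjacency outside `X` is transitive. A failing triple is an edge together with a vertex
adjacent to neither of its ends, the obstruction used by the greedy algorithm. -/
theorem isCoClusterModulator_iff {X : Finset V} :
    G.IsCoClusterModulator X ↔ ∀ a ∉ X, ∀ b ∉ X, ∀ c ∉ X, ¬G.Adj a b → ¬G.Adj b c → ¬G.Adj a c := by
  unfold IsCoClusterModulator IsCoCluster IsCluster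
  constructor
  · intro h a ha b hb c hc hab hbc hac
    have hne : ∀ x y : V, G.Adj x y → x ≠ y := fun x y h => G.ne_of_adj h
    have h1 : a ≠ b := by rintro rfl; exact hbc hac
    have h2 : b ≠ c := by rintro rfl; exact hab hac
    have r1 : (G.induce {v | v ∉ X})ᶜ.Adj ⟨a, ha⟩ ⟨b, hb⟩ := by
      simp [compl_adj, h1, hab]
    have r2 : (G.induce {v | v ∉ X})ᶜ.Adj ⟨b, hb⟩ ⟨c, hc⟩ := by
      simp [compl_adj, h2, hbc]
    have := h ⟨a, ha⟩ ⟨c, hc⟩ (r1.reachable.trans r2.reachable)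
      (by simpa using hne a c hac)
    simp [compl_adj, hac] at this
  · rintro h u v ⟨p⟩ huv
    refine (compl_adj _ _ _).mpr ⟨huv, ?_⟩
    clear huv
    induction p with
    | nil => exact (G.induce _).loopless.irrefl _
    | @cons a b c hadj q ih =>
      exact h a.1 a.2 b.1 b.2 c.1 c.2
        ((compl_adj _ _ _).mp hadj).2 ih

/-- Equal multisets mean that every neighbourhood occurs equally often in `I` and `J`; bijections
between these fibres are glued together. -/
theorem exists_equiv_of_signature_eq {X I J : Finset V}
    (h : G.signature X I = G.signature X J) :
    ∃ e : I ≃ J, ∀ a : I, ∀ x ∈ X, G.Adj (e a) x ↔ G.Adj a x := by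
  let f : V → Finset V := fun u => X.filter fun x => G.Adj u x
  have hcard : ∀ P : Finset V,
      Fintype.card {a : I // f a = P} = Fintype.card {a : J // f a = P} := by
    intro P
    have h1 : ∀ K : Finset V, Fintype.card {a : K // f a = P} = (G.signature X K).count P := by
      intro K
      rw [signature, Multiset.count_map, Fintype.card_subtype, ← Finset.filter_val, Finset.card_val]
      refine Finset.card_bij (fun a _ => a.1) ?_ ?_ ?_
      · intro a ha
        simp only [Finset.mem_filter, Finset.mem_univ, true_and] at ha
        simp [← ha, f]
      · intro a _ b _ hab
        exact Subtype.ext hab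
      · intro b hb
        simp only [Finset.mem_filter] at hb
        exact ⟨⟨b, hb.1⟩, by simp [hb.2, f], rfl⟩
    rw [h1, h1, h]
  refine ⟨Equiv.ofFiberEquiv (f := fun a : I => f a) (g := fun a : J => f a)
    fun P => Fintype.equivOfCardEq (hcard P), fun a x hx => ?_⟩
  have := Equiv.ofFiberEquiv_map (f := fun a : I => f a) (g := fun a : J => f a)
    (fun P => Fintype.equivOfCardEq (hcard P)) a
  have := Finset.ext_iff.mp this x
  simpa [f, hx] using this

section Parts

variable [Fintype V] {X I J : Finset V}

theorem mem_coClusterParts :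
    I ∈ G.coClusterParts X ↔ ∃ v ∉ X, ∀ u, u ∈ I ↔ u ∉ X ∧ ¬G.Adj v u := by
  simp only [coClusterParts, Finset.mem_image, Finset.mem_filter, Finset.mem_univ, true_and,
    Finset.ext_iff]
  exact ⟨fun ⟨v, h1, h2⟩ => ⟨v, h1, fun u => (h2 u).symm⟩,
    fun ⟨v, h1, h2⟩ => ⟨v, h1, fun u => (h2 u).symm⟩⟩

theorem not_mem_of_mem_part (hI : I ∈ G.coClusterParts X) {a : V} (ha : a ∈ I) : a ∉ X := by
  obtain ⟨v, hv, h⟩ := mem_coClusterParts.mp hI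
  exact ((h a).mp ha).1

theorem part_nonempty (hI : I ∈ G.coClusterParts X) : I.Nonempty := by
  obtain ⟨v, hv, h⟩ := mem_coClusterParts.mp hI
  exact ⟨v, (h v).mpr ⟨hv, G.loopless.irrefl v⟩⟩

theorem mem_part_iff (hX : G.IsCoClusterModulator X) (hI : I ∈ G.coClusterParts X) {a b : V}
    (ha : a ∈ I) : b ∈ I ↔ b ∉ X ∧ ¬G.Adj a b := by
  rw [isCoClusterModulator_iff] at hX
  obtain ⟨v, hv, h⟩ := mem_coClusterParts.mp hI
  obtain ⟨h1, h2⟩ := (h a).mp ha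
  rw [h b]
  refine and_congr_right fun hb => not_iff_not.mp ?_
  rw [not_not, not_not]
  constructor
  · intro h3
    by_contra h4
    exact hX v hv a h1 b hb h2 h4 h3
  · intro h3
    by_contra h4
    exact hX a h1 v hv b hb (fun h5 => h2 h5.symm) h4 h3

theorem part_eq_of_mem (hX : G.IsCoClusterModulator X) (hI : I ∈ G.coClusterParts X)
    (hJ : J ∈ G.coClusterParts X) {a : V} (haI : a ∈ I) (haJ : a ∈ J) : I = J := by
  ext b
  rw [mem_part_iff hX hI haI, mem_part_iff hX hJ haJ]

theorem part_not_adj (hX : G.IsCoClusterModulator X) (hI : I ∈ G.coClusterParts X) {a b : V}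
    (ha : a ∈ I) (hb : b ∈ I) : ¬G.Adj a b :=
  ((mem_part_iff hX hI ha).mp hb).2

theorem part_adj (hX : G.IsCoClusterModulator X) (hI : I ∈ G.coClusterParts X) {a b : V}
    (ha : a ∈ I) (hb : b ∉ I) (hbX : b ∉ X) : G.Adj a b := by
  by_contra h
  exact hb ((mem_part_iff hX hI ha).mpr ⟨hbX, h⟩)

theorem disjoint_parts (hX : G.IsCoClusterModulator X) (hI : I ∈ G.coClusterParts X)
    (hJ : J ∈ G.coClusterParts X) (hne : I ≠ J) : Disjoint I J :=
  Finset.disjoint_left.mpr fun _ h1 h2 => hne (part_eq_of_mem hX hI hJ h1 h2)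

/-- Outside `X`, the neighbours of any vertex of a part are precisely the vertices not in that part.
-/
theorem part_falseTwins_iff (hX : G.IsCoClusterModulator X) (hI : I ∈ G.coClusterParts X) {a b : V}
    (ha : a ∈ I) (hb : b ∈ I) : G.FalseTwins a b ↔ ∀ x ∈ X, G.Adj a x ↔ G.Adj b x := by
  refine ⟨fun h x _ => h.adj_iff x, fun h => ?_⟩
  ext z
  simp only [mem_neighborSet]
  by_cases hz : z ∈ X
  · exact h z hz
  by_cases hzI : z ∈ I
  · simp [part_not_adj hX hI ha hzI, part_not_adj hX hI hb hzI]
  · simp [part_adj hX hI ha hzI hz, part_adj hX hI hb hzI hz]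

/-- An automorphism exchanging the parts `I` and `J` and fixing all other vertices. -/
structure IsExchange (σ : G ≃g G) (I J : Finset V) : Prop where
  map_left : ∀ a ∈ I, σ a ∈ J
  map_right : ∀ a ∈ J, σ a ∈ I
  fixed : ∀ a, a ∉ I → a ∉ J → σ a = a
  involutive : ∀ a, σ (σ a) = a

/-- A signature-preserving bijection keeps neighbours in `X`, and adjacency outside `X` depends only
on whether two vertices share a part. Swapping two whole parts respects both. -/
theorem exists_exchange (hX : G.IsCoClusterModulator X) (hI : I ∈ G.coClusterParts X)
    (hJ : J ∈ G.coClusterParts X) (hne : I ≠ J) (h : G.signature X I = G.signature X J) :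
    ∃ σ : G ≃g G, IsExchange σ I J := by
  obtain ⟨e, he⟩ := exists_equiv_of_signature_eq h
  have hdis := Finset.disjoint_left.mp (disjoint_parts hX hI hJ hne)
  let f : V → V := fun a => if ha : a ∈ I then e ⟨a, ha⟩ else if hb : a ∈ J then e.symm ⟨a, hb⟩ else a
  have f1 : ∀ a (ha : a ∈ I), f a = e ⟨a, ha⟩ := fun a ha => by simp [f, ha]
  have f2 : ∀ a (ha : a ∈ J), f a = e.symm ⟨a, ha⟩ := fun a ha => by
    have : a ∉ I := fun h => hdis h ha
    simp [f, ha, this]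
  have f3 : ∀ a, a ∉ I → a ∉ J → f a = a := fun a h1 h2 => by simp [f, h1, h2]
  have m1 : ∀ a ∈ I, f a ∈ J := fun a ha => by rw [f1 a ha]; exact Subtype.prop _
  have m2 : ∀ a ∈ J, f a ∈ I := fun a ha => by rw [f2 a ha]; exact Subtype.prop _
  have hinv : ∀ a, f (f a) = a := by
    intro a
    by_cases ha : a ∈ I
    · rw [f2 _ (m1 a ha)]
      simp [f1 a ha]
    by_cases hb : a ∈ J
    · rw [f1 _ (m2 a hb)]
      simp [f2 a hb]
    rw [f3 a ha hb, f3 a ha hb]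
  have hXadj : ∀ a, ∀ x ∈ X, G.Adj (f a) x ↔ G.Adj a x := by
    intro a x hx
    by_cases ha : a ∈ I
    · rw [f1 a ha]; exact he _ x hx
    by_cases hb : a ∈ J
    · rw [f2 a hb, ← he _ x hx, Equiv.apply_symm_apply]
    rw [f3 a ha hb]
  have hfX : ∀ x ∈ X, f x = x := fun x hx =>
    f3 x (fun h => not_mem_of_mem_part hI h hx) fun h => not_mem_of_mem_part hJ h hx
  have himp : ∀ a b, G.Adj a b → G.Adj (f a) (f b) := by
    intro a b hab
    by_cases haX : a ∈ X
    · rw [hfX a haX, G.adj_comm, hXadj b a haX]; exact hab.symm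
    by_cases hbX : b ∈ X
    · rw [hfX b hbX, hXadj a b hbX]; exact hab
    have hfnX : ∀ a ∉ X, f a ∉ X := by
      intro a ha
      by_cases h1 : a ∈ I
      · exact not_mem_of_mem_part hJ (m1 a h1)
      by_cases h2 : a ∈ J
      · exact not_mem_of_mem_part hI (m2 a h2)
      rwa [f3 a h1 h2]
    by_cases ha : a ∈ I
    · refine part_adj hX hJ (m1 a ha) (fun h => ?_) (hfnX b hbX)
      have : b ∈ I := by have := m2 _ h; rwa [hinv] at this
      exact part_not_adj hX hI ha this hab
    by_cases hb : a ∈ J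
    · refine part_adj hX hI (m2 a hb) (fun h => ?_) (hfnX b hbX)
      have : b ∈ J := by have := m1 _ h; rwa [hinv] at this
      exact part_not_adj hX hJ hb this hab
    rw [f3 a ha hb]
    by_cases hbI : b ∈ I
    · exact (part_adj hX hJ (m1 b hbI) hb haX).symm
    by_cases hbJ : b ∈ J
    · exact (part_adj hX hI (m2 b hbJ) ha haX).symm
    rwa [f3 b hbI hbJ]
  -- As `f` is an involution, preserving adjacency implies reflecting it.
  refine ⟨autOfPerm ⟨f, f, hinv, hinv⟩ fun a b => ⟨fun h => ?_, himp a b⟩, ⟨m1, m2, f3, hinv⟩⟩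
  have := himp _ _ h
  simpa only [Equiv.coe_fn_mk, hinv] using this

end Parts

end SimpleGraph

namespace SimpleGraph

open Classical

/-! ### False twins inside a part -/

section Twins

variable {V : Type*} {G : SimpleGraph V} {X I J : Finset V}

theorem IsExchange.symm {σ : G ≃g G} (h : IsExchange σ I J) : IsExchange σ J I :=
  ⟨h.map_right, h.map_left, fun a h1 h2 => h.fixed a h2 h1, h.involutive⟩

theorem FalseTwins.map {u v : V} (h : G.FalseTwins u v) (σ : G ≃g G) :
    G.FalseTwins (σ u) (σ v) := by
  ext z
  simp only [mem_neighborSet]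
  rw [← σ.apply_symm_apply z, σ.map_adj_iff, σ.map_adj_iff]
  exact h.adj_iff _

theorem mem_pair_of_falseTwinPairs {P : Finset V} :
    P ∈ (J.powersetCard 2).filter (fun P => ∀ u ∈ P, ∀ v ∈ P, G.FalseTwins u v) ↔
    ∃ u ∈ J, ∃ v ∈ J, u ≠ v ∧ G.FalseTwins u v ∧ P = {u, v} := by
  simp only [Finset.mem_filter, Finset.mem_powersetCard, Finset.card_eq_two]
  constructor
  · rintro ⟨⟨h1, u, v, huv, rfl⟩, h2⟩
    exact ⟨u, h1 (by simp), v, h1 (by simp), huv, h2 u (by simp) v (by simp), rfl⟩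
  · rintro ⟨u, hu, v, hv, huv, h, rfl⟩
    refine ⟨⟨?_, u, v, huv, rfl⟩, ?_⟩
    · intro a ha
      rcases Finset.mem_insert.mp ha with rfl | ha
      · exact hu
      · rwa [Finset.mem_singleton.mp ha]
    · intro a ha b hb
      simp only [Finset.mem_insert, Finset.mem_singleton] at ha hb
      rcases ha with rfl | rfl <;> rcases hb with rfl | rfl
      · rfl
      · exact h
      · exact Eq.symm h
      · rfl

theorem IsExchange.falseTwinPairs_le {σ : G ≃g G} (h : IsExchange σ I J) :
    G.falseTwinPairs I ≤ G.falseTwinPairs J := by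
  unfold falseTwinPairs
  refine Finset.card_le_card_of_injOn (fun P => P.image σ) ?_ ?_
  · intro P hP
    obtain ⟨u, hu, v, hv, huv, ht, rfl⟩ := mem_pair_of_falseTwinPairs.mp hP
    exact mem_pair_of_falseTwinPairs.mpr ⟨σ u, h.map_left u hu, σ v, h.map_left v hv,
      fun h' => huv (σ.injective h'), ht.map σ, by simp [Finset.image_insert]⟩
  · intro P _ Q _ hPQ
    exact Finset.image_injective σ.injective hPQ

theorem falseTwinPairs_eq_of_signature_eq [Fintype V] (hX : G.IsCoClusterModulator X)
    (hI : I ∈ G.coClusterParts X) (hJ : J ∈ G.coClusterParts X)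
    (h : G.signature X I = G.signature X J) : G.falseTwinPairs I = G.falseTwinPairs J := by
  by_cases hne : I = J
  · rw [hne]
  obtain ⟨σ, hσ⟩ := exists_exchange hX hI hJ hne h
  exact le_antisymm hσ.falseTwinPairs_le hσ.symm.falseTwinPairs_le

/-- A resolving set contains an element of every pair of false twins, and these are distinct if there
are no three false twins. If it contains no other element of `J`, then each of its elements in `J` has
a twin in `J`. -/
theorem ResolvesOn.falseTwinPairs_le {S : Finset V} {U : Set V} (h3 : ¬G.HasThreeFalseTwins)
    (hS : G.ResolvesOn S U) (hJ : ∀ a ∈ J, a ∈ U) (hne : J.Nonempty) :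
    G.falseTwinPairs J ≤ (S ∩ J).card ∧ ((S ∩ J).card = G.falseTwinPairs J →
      ∀ s ∈ S ∩ J, ∃ v ∈ J, s ≠ v ∧ G.FalseTwins s v) := by
  obtain ⟨a₀, ha₀⟩ := hne
  have : Nonempty V := ⟨a₀⟩
  unfold falseTwinPairs
  set D := (J.powersetCard 2).filter fun P => ∀ u ∈ P, ∀ v ∈ P, G.FalseTwins u v with hD
  have hex : ∀ P ∈ D, ∃ s ∈ P, s ∈ S ∩ J := by
    intro P hP
    obtain ⟨u, hu, v, hv, huv, h, rfl⟩ := mem_pair_of_falseTwinPairs.mp hP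
    have hor : u ∈ S ∨ v ∈ S := hS.mem_or_mem_of_falseTwins (hJ u hu) (hJ v hv) huv h
    rcases hor with h' | h'
    · exact ⟨u, Finset.mem_insert_self _ _, Finset.mem_inter.mpr ⟨h', hu⟩⟩
    · exact ⟨v, Finset.mem_insert_of_mem (Finset.mem_singleton_self _),
        Finset.mem_inter.mpr ⟨h', hv⟩⟩
  choose! g hg using hex
  have hpair : ∀ P ∈ D, ∃ v ∈ J, g P ≠ v ∧ G.FalseTwins (g P) v ∧ P = {g P, v} := by
    intro P hP
    obtain ⟨u, hu, v, hv, huv, h, hPe⟩ := mem_pair_of_falseTwinPairs.mp hP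
    have h1 := (hg P hP).1
    rw [hPe, Finset.mem_insert, Finset.mem_singleton, ← hPe] at h1
    rcases h1 with h1 | h1 <;> rw [h1]
    · exact ⟨v, hv, huv, h, hPe⟩
    · exact ⟨u, hu, huv.symm, Eq.symm h, by rw [hPe, Finset.pair_comm]⟩
  -- Two different pairs with a common vertex would produce three false twins.
  have hinj : Set.InjOn g D := by
    intro P hP Q hQ hPQ
    obtain ⟨v, -, h1, h2, h4⟩ := hpair P hP
    obtain ⟨w, -, h5, h6, h7⟩ := hpair Q hQ
    rw [h4, h7, hPQ]
    by_cases hvw : v = w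
    · rw [hvw]
    · exact absurd ⟨g P, v, w, h1, hPQ ▸ h5, hvw, h2, hPQ ▸ h6⟩ h3
  have hmaps : Set.MapsTo g D (S ∩ J : Finset V) := fun P hP => (hg P hP).2
  refine ⟨Finset.card_le_card_of_injOn g hmaps hinj, fun hcard s hs => ?_⟩
  obtain ⟨P, hP, rfl⟩ := Finset.surjOn_of_injOn_of_card_le g hmaps hinj hcard.le hs
  obtain ⟨v, h0, h1, h2, -⟩ := hpair P hP
  exact ⟨v, h0, h1, h2⟩

/-- One vertex is taken from each twin pair, or any single vertex if there are no pairs. The size is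
the amount by which Rule B decreases `k`. -/
theorem exists_twin_cover (G : SimpleGraph V) (hne : J.Nonempty) :
    ∃ T ⊆ J, T.Nonempty ∧ T.card ≤ max 1 (G.falseTwinPairs J) ∧
      ∀ u ∈ J, ∀ v ∈ J, u ≠ v → G.FalseTwins u v → u ∈ T ∨ v ∈ T := by
  obtain ⟨a₀, ha₀⟩ := hne
  have : Nonempty V := ⟨a₀⟩
  unfold falseTwinPairs
  set D := (J.powersetCard 2).filter fun P => ∀ u ∈ P, ∀ v ∈ P, G.FalseTwins u v with hD
  have hex : ∀ P ∈ D, ∃ s ∈ P, s ∈ J := by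
    intro P hP
    obtain ⟨u, hu, v, hv, huv, h, rfl⟩ := mem_pair_of_falseTwinPairs.mp hP
    exact ⟨u, by simp, hu⟩
  choose! g hg using hex
  have hcov : ∀ u ∈ J, ∀ v ∈ J, u ≠ v → G.FalseTwins u v → u ∈ D.image g ∨ v ∈ D.image g := by
    intro u hu v hv huv h
    have hP : {u, v} ∈ D := mem_pair_of_falseTwinPairs.mpr ⟨u, hu, v, hv, huv, h, rfl⟩
    have h1 := (hg _ hP).1
    rw [Finset.mem_insert, Finset.mem_singleton] at h1
    rcases h1 with h1 | h1
    · left; rw [← h1]; exact Finset.mem_image_of_mem _ hP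
    · right; rw [← h1]; exact Finset.mem_image_of_mem _ hP
  by_cases hDe : D.Nonempty
  · refine ⟨D.image g, ?_, hDe.image g, Finset.card_image_le.trans (le_max_right _ _), hcov⟩
    intro a ha
    obtain ⟨P, hP, rfl⟩ := Finset.mem_image.mp ha
    exact (hg P hP).2
  · rw [Finset.not_nonempty_iff_eq_empty] at hDe
    refine ⟨{a₀}, by simpa using ha₀, by simp, by simp, fun u hu v hv huv h => ?_⟩
    have := hcov u hu v hv huv h
    simp [hDe] at this

end Twins

/-! ### Deleting one of many identical parts -/

section IdenticalParts

variable {V : Type*} [Fintype V] {G : SimpleGraph V} {X I : Finset V} {C C₁ C₂ : Finset (Finset V)}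

/-- Any two members of `C` are parts with the same signature. -/
def IdenticalClass (G : SimpleGraph V) (X : Finset V) (C : Finset (Finset V)) : Prop :=
  (∀ J ∈ C, J ∈ G.coClusterParts X) ∧ ∀ J ∈ C, ∀ K ∈ C, G.signature X J = G.signature X K

theorem IdenticalClass.mono (h : IdenticalClass G X C) (hC : C₁ ⊆ C) : IdenticalClass G X C₁ :=
  ⟨fun J hJ => h.1 J (hC hJ), fun J hJ K hK => h.2 J (hC hJ) K (hC hK)⟩

/-- A resolving set remains one if its elements in the parts of `C` are replaced by `X` and by a few
elements of each of these parts. -/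
theorem ResolvesOn.replace {S : Finset V} {U U' : Set V} {T : Finset V → Finset V}
    (hX : G.IsCoClusterModulator X) (hC : ∀ J ∈ C, J ∈ G.coClusterParts X) (hC₂ : C₂ ⊆ C)
    (hT : ∀ J ∈ C₂, T J ⊆ J ∧ (T J).Nonempty ∧
      ∀ u ∈ J, ∀ v ∈ J, u ≠ v → G.FalseTwins u v → u ∈ T J ∨ v ∈ T J)
    (hU' : ∀ a ∈ U', a ∈ X ∨ (∃ J ∈ C₂, a ∈ J) ∨ a ∈ U ∧ ∀ J ∈ C, a ∉ J)
    (hS : G.ResolvesOn S U) :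
    G.ResolvesOn ((S.filter fun a => ∀ J ∈ C, a ∉ J) ∪ X ∪ C₂.biUnion T) U' := by
  set S' := (S.filter fun a => ∀ J ∈ C, a ∉ J) ∪ X ∪ C₂.biUnion T with hS'
  have hmem : ∀ a, a ∈ S' ↔ (a ∈ S ∧ ∀ J ∈ C, a ∉ J) ∨ a ∈ X ∨ ∃ J ∈ C₂, a ∈ T J := by
    intro a
    simp [hS']
  have self : ∀ a b, a ≠ b → a ∈ S' → ∃ w ∈ S', G.edist w a ≠ G.edist w b := fun a b hab ha =>
    ⟨a, ha, by rw [edist_self]; exact fun h => hab (edist_eq_zero_iff.mp h.symm)⟩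
  have adj : ∀ w a b, G.Adj w a → ¬G.Adj w b → G.edist w a ≠ G.edist w b := fun w a b h1 h2 h => by
    rw [edist_eq_one_iff_adj.mpr h1] at h
    exact h2 (edist_eq_one_iff_adj.mp h.symm)
  -- Twins in `J` are resolved by `T J`, non-twins in `J` by a vertex of `X`. A vertex `b` outside
  -- `J` is separated from `a` by any `t ∈ T J`, which is adjacent to `b` but not to `a`.
  have main : ∀ a b, a ≠ b → b ∈ U' → a ∉ X → b ∉ X → (∃ J ∈ C₂, a ∈ J) →
      ∃ w ∈ S', G.edist w a ≠ G.edist w b := by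
    rintro a b hab hb haX hbX ⟨J, hJ, haJ⟩
    have hJp := hC J (hC₂ hJ)
    obtain ⟨hT1, ⟨t, ht⟩, hT3⟩ := hT J hJ
    by_cases hbJ : b ∈ J
    · by_cases htw : G.FalseTwins a b
      · rcases hT3 a haJ b hbJ hab htw with h | h
        · exact self a b hab ((hmem a).mpr (Or.inr (Or.inr ⟨J, hJ, h⟩)))
        · obtain ⟨w, h1, h2⟩ := self b a hab.symm ((hmem b).mpr (Or.inr (Or.inr ⟨J, hJ, h⟩)))
          exact ⟨w, h1, h2.symm⟩
      · rw [part_falseTwins_iff hX hJp haJ hbJ] at htw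
        push Not at htw
        obtain ⟨x, hx, h⟩ := htw
        refine ⟨x, (hmem x).mpr (Or.inr (Or.inl hx)), ?_⟩
        rcases h with ⟨h1, h2⟩ | ⟨h1, h2⟩
        · exact adj x a b h1.symm fun h => h2 h.symm
        · exact (adj x b a h2.symm fun h => h1 h.symm).symm
    · exact ⟨t, (hmem t).mpr (Or.inr (Or.inr ⟨J, hJ, ht⟩)),
        (adj t b a (part_adj hX hJp (hT1 ht) hbJ hbX) (part_not_adj hX hJp (hT1 ht) haJ)).symm⟩
  intro a ha b hb hab
  by_cases haX : a ∈ X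
  · exact self a b hab ((hmem a).mpr (Or.inr (Or.inl haX)))
  by_cases hbX : b ∈ X
  · obtain ⟨w, h1, h2⟩ := self b a hab.symm ((hmem b).mpr (Or.inr (Or.inl hbX)))
    exact ⟨w, h1, h2.symm⟩
  by_cases haC : ∃ J ∈ C₂, a ∈ J
  · exact main a b hab hb haX hbX haC
  by_cases hbC : ∃ J ∈ C₂, b ∈ J
  · obtain ⟨w, h1, h2⟩ := main b a hab.symm ha hbX haX hbC
    exact ⟨w, h1, h2.symm⟩
  obtain ⟨haU, haC'⟩ := ((hU' a ha).resolve_left haX).resolve_left haC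
  obtain ⟨hbU, hbC'⟩ := ((hU' b hb).resolve_left hbX).resolve_left hbC
  -- Neither `a` nor `b` lies in `X` or in a part of `C`, so any vertex of a part of `C` is adjacent
  -- to both. The resolving vertex `w` has therefore not been thrown away.
  obtain ⟨w, hw, hne⟩ := hS a haU b hbU hab
  refine ⟨w, (hmem w).mpr (Or.inl ⟨hw, fun J hJ hwJ => hne ?_⟩), hne⟩
  rw [edist_eq_one_iff_adj.mpr (part_adj hX (hC J hJ) hwJ (haC' J hJ) haX),
    edist_eq_one_iff_adj.mpr (part_adj hX (hC J hJ) hwJ (hbC' J hJ) hbX)]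

/-- Two identical parts cannot both avoid a resolving set. -/
theorem ResolvesOn.inter_nonempty {S : Finset V} {U : Set V} (hX : G.IsCoClusterModulator X)
    (hC : IdenticalClass G X C) (hCU : ∀ J ∈ C, ∀ a ∈ J, a ∈ U) (hS : G.ResolvesOn S U) {J K : Finset V}
    (hJ : J ∈ C) (hK : K ∈ C) (hJK : J ≠ K) (hJS : S ∩ J = ∅) : (S ∩ K).Nonempty := by
  by_contra hKS
  rw [Finset.not_nonempty_iff_eq_empty] at hKS
  obtain ⟨σ, hσ⟩ := exists_exchange hX (hC.1 J hJ) (hC.1 K hK) hJK (hC.2 J hJ K hK)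
  obtain ⟨u, hu⟩ := part_nonempty (hC.1 J hJ)
  have hσu := hσ.map_left u hu
  have hne : u ≠ σ u := fun h =>
    Finset.disjoint_left.mp (disjoint_parts hX (hC.1 J hJ) (hC.1 K hK) hJK) hu (h ▸ hσu)
  obtain ⟨w, hw, hd⟩ := hS u (hCU J hJ u hu) (σ u) (hCU K hK _ hσu) hne
  have hwJ : w ∉ J := fun h => by
    have : w ∈ S ∩ J := Finset.mem_inter.mpr ⟨hw, h⟩
    simp [hJS] at this
  have hwK : w ∉ K := fun h => by
    have : w ∈ S ∩ K := Finset.mem_inter.mpr ⟨hw, h⟩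
    simp [hKS] at this
  have := Iso.edist_eq σ w u
  rw [hσ.fixed w hwJ hwK] at this
  exact hd this.symm

/-- Either a resolving set has so many elements in the parts of `C` that these can be replaced by all
of `X` and `m` elements of each part, or it has exactly `m` elements in most of the parts. -/
theorem ResolvesOn.card_dichotomy {S : Finset V} {U : Set V} {m : ℕ} (hX : G.IsCoClusterModulator X)
    (h3 : ¬G.HasThreeFalseTwins) (hC : IdenticalClass G X C) (hCU : ∀ J ∈ C, ∀ a ∈ J, a ∈ U)
    (hm : ∀ J ∈ C, m = max 1 (G.falseTwinPairs J)) (hS : G.ResolvesOn S U) :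
    (S.filter fun a => ∀ J ∈ C, a ∉ J).card + X.card + C.card * m ≤ S.card ∨
      C.card ≤ X.card + 1 + (C.filter fun J => (S ∩ J).card = m ∧ (S ∩ J).Nonempty).card := by
  set Q := C.filter fun J => m < (S ∩ J).card with hQ
  set E := C.filter fun J => S ∩ J = ∅ with hE
  set Ex := C.filter fun J => (S ∩ J).card = m ∧ (S ∩ J).Nonempty with hEx
  have hE1 : E.card ≤ 1 := by
    rw [Finset.card_le_one]
    intro J hJ K hK
    by_contra hne
    simp only [hE, Finset.mem_filter] at hJ hK
    have := hS.inter_nonempty hX hC hCU hJ.1 hK.1 hne hJ.2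
    simp [hK.2] at this
  have hlow : ∀ J ∈ C, G.falseTwinPairs J ≤ (S ∩ J).card := fun J hJ =>
    (hS.falseTwinPairs_le h3 (hCU J hJ) (part_nonempty (hC.1 J hJ))).1
  have hcover : C.card ≤ Q.card + E.card + Ex.card := by
    refine (Finset.card_le_card (t := (Q ∪ E) ∪ Ex) fun J hJ => ?_).trans
      ((Finset.card_union_le _ _).trans (Nat.add_le_add_right (Finset.card_union_le _ _) _))
    simp only [hQ, hE, hEx, Finset.mem_union, Finset.mem_filter, hJ, true_and]
    by_cases h1 : S ∩ J = ∅
    · exact Or.inl (Or.inr h1)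
    have h2 : (S ∩ J).Nonempty := Finset.nonempty_iff_ne_empty.mpr h1
    have h4 := h2.card_pos
    have h5 := hlow J hJ
    have h6 := hm J hJ
    by_cases h7 : m < (S ∩ J).card
    · exact Or.inl (Or.inl h7)
    · exact Or.inr ⟨by omega, h2⟩
  -- A part missed by `S` contains no twin pair, so there `m = 1` and the deficit is one; each part
  -- in `Q` has a surplus of at least one.
  have hsum : C.card * m + Q.card ≤ ∑ J ∈ C, (S ∩ J).card + E.card := by
    rw [hQ, hE, Finset.card_filter, Finset.card_filter, ← smul_eq_mul, ← Finset.sum_const,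
      ← Finset.sum_add_distrib, ← Finset.sum_add_distrib]
    refine Finset.sum_le_sum fun J hJ => ?_
    have h5 := hlow J hJ
    have h6 := hm J hJ
    by_cases h1 : S ∩ J = ∅
    · simp only [h1, Finset.card_empty] at h5 ⊢
      split_ifs <;> omega
    · have h4 := (Finset.nonempty_iff_ne_empty.mpr h1).card_pos
      simp only [h1, if_false]
      split_ifs <;> omega
  have hS' : S.card = (S.filter fun a => ∀ J ∈ C, a ∉ J).card + ∑ J ∈ C, (S ∩ J).card := by
    rw [← Finset.card_filter_add_card_filter_not (s := S) (fun a => ∀ J ∈ C, a ∉ J),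
      ← Finset.card_biUnion]
    · congr 2
      ext a
      simp only [Finset.mem_filter, Finset.mem_biUnion, Finset.mem_inter]
      push Not
      exact ⟨fun ⟨h1, J, h2, h4⟩ => ⟨J, h2, h1, h4⟩, fun ⟨J, h2, h1, h4⟩ => ⟨h1, J, h2, h4⟩⟩
    · intro J hJ K hK hne
      exact (disjoint_parts hX (hC.1 J hJ) (hC.1 K hK) hne).mono Finset.inter_subset_right
        Finset.inter_subset_right
  -- A surplus of `|X| + 1` pays for all of `X` and for the possible missed part.
  by_cases hQX : X.card + 1 ≤ Q.card
  · left; omega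
  · right; omega

end IdenticalParts

end SimpleGraph

namespace SimpleGraph

open Classical

/-! ### Safety of the rule for identical parts: both directions. -/

section DeletePart

variable {V : Type*} [Fintype V] {G : SimpleGraph V} {X I : Finset V} {C C₁ C₂ : Finset (Finset V)}

theorem identicalClass_identicalParts (G : SimpleGraph V) (X I : Finset V) :
    IdenticalClass G X (G.identicalParts X I) := by
  simp only [IdenticalClass, identicalParts, Finset.mem_filter]
  exact ⟨fun J hJ => hJ.1, fun J hJ K hK => hJ.2.trans hK.2.symm⟩

/-- The case of a large surplus: the parts in `C₁` are exchanged for those in `C₂` at the price `m`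
per part. The last clause says where the new set lives, which shows that it avoids a deleted part.
-/
theorem exists_replacement (hX : G.IsCoClusterModulator X) (hC : IdenticalClass G X C) {m : ℕ}
    (hm : ∀ J ∈ C, m = max 1 (G.falseTwinPairs J)) (hC₁ : C₁ ⊆ C) (hC₂ : C₂ ⊆ C)
    {S : Finset V} {U U' : Set V}
    (hU' : ∀ a ∈ U', a ∈ X ∨ (∃ J ∈ C₂, a ∈ J) ∨ a ∈ U ∧ ∀ J ∈ C, a ∉ J)
    (hS : G.ResolvesOn S U)
    (hcard : (S.filter fun a => ∀ J ∈ C₁, a ∉ J).card + X.card + C₁.card * m ≤ S.card) :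
    ∃ S' : Finset V, G.ResolvesOn S' U' ∧ S'.card + C₁.card * m ≤ S.card + C₂.card * m ∧
      ∀ a ∈ S', a ∈ X ∨ (∃ J ∈ C₂, a ∈ J) ∨ a ∈ S ∧ ∀ J ∈ C, a ∉ J := by
  have hT : ∀ J ∈ C₂, ∃ T : Finset V, (T ⊆ J ∧ T.Nonempty ∧
      ∀ u ∈ J, ∀ v ∈ J, u ≠ v → G.FalseTwins u v → u ∈ T ∨ v ∈ T) ∧ T.card ≤ m := by
    intro J hJ
    obtain ⟨T, h1, h2, h3, h4⟩ := exists_twin_cover G (part_nonempty (hC.1 J (hC₂ hJ)))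
    exact ⟨T, ⟨h1, h2, h4⟩, h3.trans (hm J (hC₂ hJ)).ge⟩
  choose! T hT using hT
  refine ⟨_, hS.replace hX hC.1 hC₂ (fun J hJ => (hT J hJ).1) hU', ?_, ?_⟩
  · have h1 : (C₂.biUnion T).card ≤ C₂.card * m :=
      Finset.card_biUnion_le_card_mul _ _ _ fun J hJ => (hT J hJ).2
    have h2 : (S.filter fun a => ∀ J ∈ C, a ∉ J).card ≤
        (S.filter fun a => ∀ J ∈ C₁, a ∉ J).card :=
      Finset.card_le_card (Finset.monotone_filter_right S fun a _ h J hJ => h J (hC₁ hJ))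
    have h4 := Finset.card_union_le ((S.filter fun a => ∀ J ∈ C, a ∉ J) ∪ X) (C₂.biUnion T)
    have h5 := Finset.card_union_le (S.filter fun a => ∀ J ∈ C, a ∉ J) X
    omega
  · intro a ha
    simp only [Finset.mem_union, Finset.mem_filter, Finset.mem_biUnion] at ha
    rcases ha with (h | h) | ⟨J, hJ, h⟩
    · exact Or.inr (Or.inr h)
    · exact Or.inl h
    · exact Or.inr (Or.inl ⟨J, hJ, (hT J hJ).1.1 h⟩)

/-- Putting the part back costs `m`: either all choices in the class are rebuilt, or the choice in a
tight part `J` is copied to `I` by the exchange of `I` and `J`. -/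
theorem exists_resolving_of_deleted_part (hX : G.IsCoClusterModulator X)
    (h3 : ¬G.HasThreeFalseTwins) (hI : I ∈ G.coClusterParts X)
    (hbig : X.card + 3 ≤ (G.identicalParts X I).card) {S : Finset V}
    (hSI : ∀ a ∈ S, a ∉ I) (hS : G.ResolvesOn S {a | a ∉ I}) :
    ∃ S', G.ResolvesOn S' Set.univ ∧ S'.card ≤ S.card + max 1 (G.falseTwinPairs I) := by
  set C := G.identicalParts X I with hCdef
  have hC : IdenticalClass G X C := identicalClass_identicalParts G X I
  have hIC : I ∈ C := by simp [hCdef, identicalParts, hI]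
  set m := max 1 (G.falseTwinPairs I) with hmdef
  have hm : ∀ J ∈ C, m = max 1 (G.falseTwinPairs J) := fun J hJ => by
    rw [hmdef, falseTwinPairs_eq_of_signature_eq hX hI (hC.1 J hJ) (hC.2 I hIC J hJ)]
  have hsub : C.erase I ⊆ C := Finset.erase_subset _ _
  have hC₁ := hC.mono hsub
  have hcard : (C.erase I).card + 1 = C.card := Finset.card_erase_add_one hIC
  rcases hS.card_dichotomy hX h3 hC₁ (fun J hJ a ha haI =>
      (Finset.mem_erase.mp hJ).1 (part_eq_of_mem hX (hC₁.1 J hJ) hI ha haI))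
      (fun J hJ => hm J (hsub hJ)) with h | h
  · obtain ⟨S', h1, h2, -⟩ := exists_replacement (U' := Set.univ) hX hC hm hsub subset_rfl (by
      intro a _
      by_cases ha : ∃ J ∈ C, a ∈ J
      · exact Or.inr (Or.inl ha)
      · push Not at ha
        exact Or.inr (Or.inr ⟨ha I hIC, ha⟩)) hS h
    refine ⟨S', h1, ?_⟩
    rw [← hcard, add_mul] at h2
    omega
  -- At least `|X| + 2` parts remain besides `I`, and all but `|X| + 1` of them are tight.
  · obtain ⟨J, hJ⟩ := Finset.card_pos.mp (show 0 < ((C.erase I).filter fun J =>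
      (S ∩ J).card = m ∧ (S ∩ J).Nonempty).card by omega)
    obtain ⟨hJ, hJm, s₀, hs₀⟩ := Finset.mem_filter.mp hJ
    have hJI : J ≠ I := (Finset.mem_erase.mp hJ).1
    have hJp := hC₁.1 J hJ
    obtain ⟨σ, hσ⟩ := exists_exchange hX hI hJp hJI.symm (hC.2 I hIC J (hsub hJ))
    have hdis : ∀ a ∈ J, a ∉ I := fun a ha haI => hJI (part_eq_of_mem hX hJp hI ha haI)
    refine ⟨S ∪ (S ∩ J).image σ, ?_, (Finset.card_union_le _ _).trans (by
      rw [← hJm]; exact Nat.add_le_add_left Finset.card_image_le _)⟩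
    have main : ∀ a b, a ≠ b → a ∈ I → ∃ w ∈ S ∪ (S ∩ J).image σ, G.edist w a ≠ G.edist w b := by
      intro a b hab ha
      have hσa : σ a ∉ I := hdis _ (hσ.map_left a ha)
      by_cases hb : b ∈ J
      · refine ⟨σ s₀, Finset.mem_union_right _ (Finset.mem_image_of_mem _ hs₀), fun h => ?_⟩
        have hs : σ s₀ ∈ I := hσ.map_right s₀ (Finset.mem_inter.mp hs₀).2
        rw [edist_eq_one_iff_adj.mpr (part_adj hX hI hs (hdis b hb) (not_mem_of_mem_part hJp hb)),
          edist_eq_one_iff_adj] at h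
        exact part_not_adj hX hI hs ha h
      · have hσb : σ b ∉ I := by
          by_cases hbI : b ∈ I
          · exact hdis _ (hσ.map_left b hbI)
          · rwa [hσ.fixed b hbI hb]
        -- The exchange moves the pair out of `I`, where `S` resolves it by some `w`. Moved back,
        -- `w` is a copied vertex if it came from `J`, and otherwise has not changed.
        obtain ⟨w, hw, hne⟩ := hS (σ a) hσa (σ b) hσb fun h => hab (σ.injective h)
        refine ⟨σ w, ?_, ?_⟩
        · by_cases hwJ : w ∈ J
          · exact Finset.mem_union_right _ (Finset.mem_image_of_mem _ (Finset.mem_inter.mpr ⟨hw, hwJ⟩))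
          · rw [hσ.fixed w (hSI w hw) hwJ]
            exact Finset.mem_union_left _ hw
        · intro h
          rw [← Iso.edist_eq σ, ← Iso.edist_eq σ (σ w), hσ.involutive] at h
          exact hne h
    intro a _ b _ hab
    by_cases ha : a ∈ I
    · exact main a b hab ha
    by_cases hb : b ∈ I
    · obtain ⟨w, h1, h2⟩ := main b a hab.symm hb
      exact ⟨w, h1, h2.symm⟩
    · obtain ⟨w, h1, h2⟩ := hS a ha b hb hab
      exact ⟨w, Finset.mem_union_left _ h1, h2⟩

/-- Parts in which a resolving set has the least possible number of elements, and an element with the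
same neighbours in `X`, agree in this respect for all elements of the resolving set. -/
theorem ResolvesOn.exists_same_type {S : Finset V} {m : ℕ} (hX : G.IsCoClusterModulator X)
    (h3 : ¬G.HasThreeFalseTwins) (hC : IdenticalClass G X C)
    (hm : ∀ J ∈ C, m = max 1 (G.falseTwinPairs J)) (hS : G.ResolvesOn S Set.univ)
    {J K : Finset V} (hJ : J ∈ C) (hK : K ∈ C) (hJm : (S ∩ J).card = m) {u v : V}
    (hu : u ∈ S ∩ J) (hv : v ∈ S ∩ K) (huv : ∀ x ∈ X, G.Adj u x ↔ G.Adj v x) {s : V}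
    (hs : s ∈ S ∩ J) : ∃ s' ∈ S ∩ K, ∀ x ∈ X, G.Adj s x ↔ G.Adj s' x := by
  by_cases hJK : J = K
  · exact ⟨s, hJK ▸ hs, fun x _ => Iff.rfl⟩
  have hJp := hC.1 J hJ
  by_cases h0 : G.falseTwinPairs J = 0
  · have h1 : (S ∩ J).card ≤ 1 := by rw [hJm, hm J hJ, h0]; simp
    rw [Finset.card_le_one.mp h1 s hs u hu]
    exact ⟨v, hv, huv⟩
  -- Here `m = t`, so `s` belongs to a twin pair; the exchange carries this pair to one in `K`,
  -- which `S` must also hit.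
  · have h1 : (S ∩ J).card = G.falseTwinPairs J := by rw [hJm, hm J hJ]; omega
    obtain ⟨w, hw, hsw, htw⟩ := (hS.falseTwinPairs_le h3 (fun _ _ => Set.mem_univ _)
      (part_nonempty hJp)).2 h1 s hs
    obtain ⟨σ, hσ⟩ := exists_exchange hX hJp (hC.1 K hK) hJK (hC.2 J hJ K hK)
    have hadj : ∀ a, ∀ x ∈ X, G.Adj (σ a) x ↔ G.Adj a x := fun a x hx => by
      have : σ x = x := hσ.fixed x (fun h => not_mem_of_mem_part hJp h hx)
        fun h => not_mem_of_mem_part (hC.1 K hK) h hx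
      conv_lhs => rw [← this]
      exact σ.map_adj_iff
    have hsJ := (Finset.mem_inter.mp hs).2
    have hor : σ s ∈ S ∨ σ w ∈ S := hS.mem_or_mem_of_falseTwins (Set.mem_univ _) (Set.mem_univ _)
      (fun h => hsw (σ.injective h)) (htw.map σ)
    rcases hor with h | h
    · exact ⟨σ s, Finset.mem_inter.mpr ⟨h, hσ.map_left s hsJ⟩, fun x hx => (hadj s x hx).symm⟩
    · exact ⟨σ w, Finset.mem_inter.mpr ⟨h, hσ.map_left w hw⟩, fun x hx =>
        (htw.adj_iff x).trans (hadj w x hx).symm⟩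

/-- Removing a part saves `m`. In the tight case the choice in some part `I₀` turns out to be
dispensable outside `I₀`, and exchanging `I₀` with `I` moves the saving to the part actually
deleted. -/
theorem exists_resolving_of_part (hX : G.IsCoClusterModulator X)
    (h3 : ¬G.HasThreeFalseTwins) (hI : I ∈ G.coClusterParts X)
    (hbig : 2 ^ (X.card + 2) + X.card + 2 ≤ (G.identicalParts X I).card) {S : Finset V}
    (hS : G.ResolvesOn S Set.univ) :
    ∃ S', (∀ a ∈ S', a ∉ I) ∧ G.ResolvesOn S' {a | a ∉ I} ∧
      S'.card + max 1 (G.falseTwinPairs I) ≤ S.card := by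
  set C := G.identicalParts X I with hCdef
  have hC : IdenticalClass G X C := identicalClass_identicalParts G X I
  have hIC : I ∈ C := by simp [hCdef, identicalParts, hI]
  set m := max 1 (G.falseTwinPairs I) with hmdef
  have hm : ∀ J ∈ C, m = max 1 (G.falseTwinPairs J) := fun J hJ => by
    rw [hmdef, falseTwinPairs_eq_of_signature_eq hX hI (hC.1 J hJ) (hC.2 I hIC J hJ)]
  have hdisj : ∀ J ∈ C, ∀ K ∈ C, J ≠ K → ∀ a ∈ J, a ∉ K := fun J hJ K hK hne a haJ haK =>
    hne (part_eq_of_mem hX (hC.1 J hJ) (hC.1 K hK) haJ haK)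
  have hcard : (C.erase I).card + 1 = C.card := Finset.card_erase_add_one hIC
  rcases hS.card_dichotomy hX h3 hC (fun _ _ _ _ => Set.mem_univ _) hm with h | h
  · obtain ⟨S', h1, h2, h4⟩ := exists_replacement (C₂ := C.erase I) (U' := {a | a ∉ I}) hX hC hm
      subset_rfl (Finset.erase_subset _ _) (by
      intro a haI
      by_cases ha : ∃ J ∈ C, a ∈ J
      · obtain ⟨J, hJ, haJ⟩ := ha
        exact Or.inr (Or.inl ⟨J, Finset.mem_erase.mpr ⟨fun h => haI (h ▸ haJ), hJ⟩, haJ⟩)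
      · push Not at ha
        exact Or.inr (Or.inr ⟨Set.mem_univ _, ha⟩)) hS h
    refine ⟨S', fun a ha haI => ?_, h1, ?_⟩
    · rcases h4 a ha with h | ⟨J, hJ, haJ⟩ | ⟨-, h⟩
      · exact not_mem_of_mem_part hI haI h
      · exact hdisj J (Finset.mem_of_mem_erase hJ) I hIC (Finset.mem_erase.mp hJ).1 a haJ haI
      · exact h I hIC haI
    · rw [← hcard, add_mul] at h2
      omega
  · set Ex := C.filter fun J => (S ∩ J).card = m ∧ (S ∩ J).Nonempty with hEx
    have hne : ∀ J ∈ Ex, ∃ s, s ∈ S ∩ J := fun J hJ => (Finset.mem_filter.mp hJ).2.2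
    have : Nonempty V := ⟨(part_nonempty hI).choose⟩
    choose! s hs using hne
    -- More than `2 * 2 ^ |X|` tight parts and only `2 ^ |X|` neighbourhoods: some neighbourhood `y`
    -- is represented in three tight parts.
    obtain ⟨y, -, hy⟩ := Finset.exists_lt_card_fiber_of_mul_lt_card_of_maps_to (s := Ex)
      (t := X.powerset) (f := fun J => X.filter fun x => G.Adj (s J) x) (n := 2)
      (fun J _ => Finset.mem_powerset.mpr (Finset.filter_subset _ _))
      (by rw [Finset.card_powerset]; rw [pow_add] at hbig; omega)
    obtain ⟨I₀, hI₀, J₁, hJ₁, J₂, hJ₂, h01, h02, h12⟩ := Finset.two_lt_card.mp hy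
    have hEx' : ∀ J ∈ Ex.filter (fun J => (X.filter fun x => G.Adj (s J) x) = y),
        J ∈ C ∧ (S ∩ J).card = m ∧ s J ∈ S ∩ J ∧ ∀ x ∈ X, G.Adj (s J) x ↔ x ∈ y := by
      intro J hJ
      obtain ⟨h1, h2⟩ := Finset.mem_filter.mp hJ
      obtain ⟨h4, h5, -⟩ := Finset.mem_filter.mp h1
      refine ⟨h4, h5, hs J h1, fun x hx => ?_⟩
      rw [← h2]
      simp [hx]
    obtain ⟨hI₀C, hI₀m, hI₀s, hI₀y⟩ := hEx' I₀ hI₀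
    have hsame : ∀ J ∈ Ex.filter (fun J => (X.filter fun x => G.Adj (s J) x) = y), ∀ a ∈ S ∩ I₀,
        ∃ a' ∈ S ∩ J, ∀ x ∈ X, G.Adj a x ↔ G.Adj a' x := by
      intro J hJ a ha
      obtain ⟨h1, h2, h4, h5⟩ := hEx' J hJ
      exact hS.exists_same_type hX h3 hC hm hI₀C h1 hI₀m hI₀s h4
        (fun x hx => (hI₀y x hx).trans (h5 x hx).symm) ha
    have hI₀p := hC.1 I₀ hI₀C
    have key : G.ResolvesOn (S \ I₀) {a | a ∉ I₀} := by
      -- A vertex of `I₀` is adjacent to everything outside `X` and `I₀`, so it is needed only for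
      -- pairs that meet `X`.
      have main : ∀ a ∈ X, ∀ b ∉ I₀, ∀ w ∈ S ∩ I₀, G.edist w a ≠ G.edist w b →
          ∃ w' ∈ S \ I₀, G.edist w' a ≠ G.edist w' b := by
        intro a ha b hb w hw hne
        -- This is why three parts are needed: besides `I₀` there must be one that avoids `b`.
        obtain ⟨J, hJ, hJI, hbJ⟩ : ∃ J ∈ Ex.filter
            (fun J => (X.filter fun x => G.Adj (s J) x) = y), I₀ ≠ J ∧ b ∉ J := by
          by_cases hb1 : b ∈ J₁
          · exact ⟨J₂, hJ₂, h02, hdisj J₁ (hEx' J₁ hJ₁).1 J₂ (hEx' J₂ hJ₂).1 h12 b hb1⟩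
          · exact ⟨J₁, hJ₁, h01, hb1⟩
        have hJC := (hEx' J hJ).1
        have hJp := hC.1 J hJC
        obtain ⟨w', hw', hadj⟩ := hsame J hJ w hw
        obtain ⟨hwS, hwI⟩ := Finset.mem_inter.mp hw
        obtain ⟨hwS', hwJ'⟩ := Finset.mem_inter.mp hw'
        obtain ⟨σ, hσ⟩ := exists_exchange hX hI₀p hJp hJI (hC.2 I₀ hI₀C J hJC)
        have haI : a ∉ I₀ := fun h => not_mem_of_mem_part hI₀p h ha
        have haJ : a ∉ J := fun h => not_mem_of_mem_part hJp h ha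
        have hσw := hσ.map_left w hwI
        have htw : G.FalseTwins (σ w) w' := by
          rw [part_falseTwins_iff hX hJp hσw hwJ']
          intro x hx
          have : σ x = x := hσ.fixed x (fun h => not_mem_of_mem_part hI₀p h hx)
            fun h => not_mem_of_mem_part hJp h hx
          rw [← hadj x hx]
          conv_lhs => rw [← this]
          exact σ.map_adj_iff
        -- The exchange takes `w` to a false twin of `w'`, so `w'` sees the vertices outside both
        -- parts at the same distances as `w`.
        have hdist : ∀ c, c ∉ I₀ → c ∉ J → G.edist w' c = G.edist w c := by
          intro c hcI hcJ
          rw [← htw.edist_eq (a := c) (fun h => hcJ (h ▸ hσw)) (fun h => hcJ (h ▸ hwJ')),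
            ← Iso.edist_eq σ w c, hσ.fixed c hcI hcJ]
        refine ⟨w', Finset.mem_sdiff.mpr ⟨hwS', hdisj J hJC I₀ hI₀C hJI.symm w' hwJ'⟩, ?_⟩
        rwa [hdist a haI haJ, hdist b hb hbJ]
      intro a ha b hb hab
      obtain ⟨w, hw, hne⟩ := hS a (Set.mem_univ _) b (Set.mem_univ _) hab
      by_cases hwI : w ∈ I₀
      · by_cases haX : a ∈ X
        · exact main a haX b hb w (Finset.mem_inter.mpr ⟨hw, hwI⟩) hne
        by_cases hbX : b ∈ X
        · obtain ⟨w', h1, h2⟩ := main b hbX a ha w (Finset.mem_inter.mpr ⟨hw, hwI⟩) hne.symm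
          exact ⟨w', h1, h2.symm⟩
        · exact absurd ((edist_eq_one_iff_adj.mpr (part_adj hX hI₀p hwI ha haX)).trans
            (edist_eq_one_iff_adj.mpr (part_adj hX hI₀p hwI hb hbX)).symm) hne
      · exact ⟨w, Finset.mem_sdiff.mpr ⟨hw, hwI⟩, hne⟩
    have hcardS : (S \ I₀).card + m = S.card := by
      have := Finset.card_sdiff_add_card_inter S I₀
      omega
    by_cases hII : I₀ = I
    · subst hII
      exact ⟨S \ I₀, fun a ha => (Finset.mem_sdiff.mp ha).2, key, hcardS.le⟩
    · obtain ⟨σ, hσ⟩ := exists_exchange hX hI₀p hI hII (hC.2 I₀ hI₀C I hIC)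
      have hback : ∀ a, a ∈ I₀ ↔ σ a ∈ I := fun a =>
        ⟨hσ.map_left a, fun h => by have := hσ.map_right _ h; rwa [hσ.involutive] at this⟩
      have himg := key.image σ
      refine ⟨(S \ I₀).image σ, ?_, ?_, ?_⟩
      · intro a ha
        obtain ⟨b, hb, rfl⟩ := Finset.mem_image.mp ha
        rw [← hback]
        exact (Finset.mem_sdiff.mp hb).2
      · have : σ '' {a | a ∉ I₀} = {a | a ∉ I} := by
          ext a
          constructor
          · rintro ⟨b, hb, rfl⟩
            exact fun h => hb ((hback b).mpr h)
          · intro ha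
            exact ⟨σ a, fun h => ha (by rw [← hσ.involutive a]; exact (hback _).mp h),
              hσ.involutive a⟩
        rwa [← this]
      · rw [Finset.card_image_of_injective _ σ.injective]
        exact hcardS.le

end DeletePart

/-! ### Deleting one of three false twins -/

section DeleteTwin

variable {V : Type*} {G : SimpleGraph V} {u v w : V}

theorem exists_resolving_of_deleted_twin {S : Finset V} (hS : G.ResolvesOn S {a | a ≠ u}) :
    ∃ S' : Finset V, G.ResolvesOn S' Set.univ ∧ S'.card ≤ S.card + 1 := by
  refine ⟨insert u S, ?_, Finset.card_insert_le _ _⟩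
  intro a _ b _ hab
  by_cases ha : a = u
  · subst ha
    refine ⟨a, Finset.mem_insert_self _ _, ?_⟩
    rw [edist_self]
    exact fun h => hab (edist_eq_zero_iff.mp h.symm)
  by_cases hb : b = u
  · subst hb
    refine ⟨b, Finset.mem_insert_self _ _, ?_⟩
    rw [edist_self]
    exact fun h => hab (edist_eq_zero_iff.mp h).symm
  obtain ⟨w, h1, h2⟩ := hS a ha b hb hab
  exact ⟨w, Finset.mem_insert_of_mem h1, h2⟩

/-- After a swap the set may be assumed to contain `u`. It also contains `v` or `w`, and this twin
has the same distances as `u` to all vertices other than the two of them. -/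
theorem exists_resolving_of_twin {S : Finset V} (huv : u ≠ v) (huw : u ≠ w) (hvw : v ≠ w)
    (h1 : G.FalseTwins u v) (h2 : G.FalseTwins u w) (hS : G.ResolvesOn S Set.univ) :
    ∃ S', (∀ a ∈ S', a ≠ u) ∧ G.ResolvesOn S' {a | a ≠ u} ∧ S'.card + 1 ≤ S.card := by
  have key : ∀ T : Finset V, G.ResolvesOn T Set.univ → u ∈ T →
      G.ResolvesOn (T.erase u) {a | a ≠ u} := by
    intro T hT huT
    have h4 : v ∈ T ∨ w ∈ T := hT.mem_or_mem_of_falseTwins (Set.mem_univ _) (Set.mem_univ _) hvw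
      (Eq.trans (Eq.symm h1) h2)
    obtain ⟨z, hzT, hzu, hz⟩ : ∃ z ∈ T, z ≠ u ∧ G.FalseTwins u z := by
      rcases h4 with h | h
      · exact ⟨v, h, huv.symm, h1⟩
      · exact ⟨w, h, huw.symm, h2⟩
    have hzT' : z ∈ T.erase u := Finset.mem_erase.mpr ⟨hzu, hzT⟩
    intro a ha b hb hab
    by_cases haz : a = z
    · subst haz
      refine ⟨a, hzT', ?_⟩
      rw [edist_self]
      exact fun h => hab (edist_eq_zero_iff.mp h.symm)
    by_cases hbz : b = z
    · subst hbz
      refine ⟨b, hzT', ?_⟩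
      rw [edist_self]
      exact fun h => hab (edist_eq_zero_iff.mp h).symm
    obtain ⟨t, ht, hne⟩ := hT a (Set.mem_univ _) b (Set.mem_univ _) hab
    by_cases htu : t = u
    · subst htu
      refine ⟨z, hzT', ?_⟩
      rwa [← hz.edist_eq ha haz, ← hz.edist_eq hb hbz]
    · exact ⟨t, Finset.mem_erase.mpr ⟨htu, ht⟩, hne⟩
  obtain ⟨T, hT, huT, hcard⟩ : ∃ T, G.ResolvesOn T Set.univ ∧ u ∈ T ∧ T.card = S.card := by
    by_cases huS : u ∈ S
    · exact ⟨S, hS, huS, rfl⟩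
    · have hvS : v ∈ S := (hS.mem_or_mem_of_falseTwins (Set.mem_univ _) (Set.mem_univ _) huv
        h1).resolve_left huS
      obtain ⟨σ, -, hσ, -⟩ := h1.exists_aut
      have := hS.image σ
      rw [Set.image_univ, σ.surjective.range_eq] at this
      exact ⟨S.image σ, this, hσ ▸ Finset.mem_image_of_mem _ hvS,
        Finset.card_image_of_injective _ σ.injective⟩
  refine ⟨T.erase u, fun a ha => (Finset.mem_erase.mp ha).1, key T hT huT, ?_⟩
  rw [Finset.card_erase_add_one huT, hcard]

end DeleteTwin

end SimpleGraph

namespace SimpleGraph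

open Classical

/-! ### Counting twin pairs, parts and signatures. -/

section Counting

variable {V : Type*} [Fintype V] {G : SimpleGraph V} {X I : Finset V}

theorem mem_identicalParts {J : Finset V} : J ∈ G.identicalParts X I ↔
    J ∈ G.coClusterParts X ∧ G.signature X J = G.signature X I := by
  simp [identicalParts]

/-- Pairs of false twins, counted by means of a total order `r`. -/
theorem falseTwinPairs_eq_sum (r : V → V → Prop) (hr : ∀ a b, r a b → ¬r b a)
    (hr' : ∀ a b, a ≠ b → r a b ∨ r b a) : G.falseTwinPairs I = ∑ a, (Finset.univ.filter fun b =>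
      (r a b ∧ G.FalseTwins a b) ∧ a ∈ I ∧ b ∈ I).card := by
  rw [← Finset.card_sigma, falseTwinPairs]
  refine Eq.symm (Finset.card_bij (fun p _ => {p.1, p.2}) ?_ ?_ ?_)
  · rintro ⟨a, b⟩ hp
    simp only [Finset.mem_sigma, Finset.mem_filter, Finset.mem_univ, true_and] at hp
    obtain ⟨⟨h2, h3⟩, h4, h5⟩ := hp
    exact mem_pair_of_falseTwinPairs.mpr
      ⟨a, h4, b, h5, fun h => hr a b h2 (h ▸ h2), h3, rfl⟩
  · rintro ⟨a, b⟩ hp ⟨c, d⟩ hq heq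
    simp only [Finset.mem_sigma, Finset.mem_filter, Finset.mem_univ, true_and] at hp hq
    have h2 := hp.1.1
    have h3 := hq.1.1
    have e1 : a = c ∨ a = d := by
      have : a ∈ ({c, d} : Finset _) := heq ▸ Finset.mem_insert_self _ _
      simpa using this
    have e2 : b = c ∨ b = d := by
      have : b ∈ ({c, d} : Finset _) :=
        heq ▸ Finset.mem_insert_of_mem (Finset.mem_singleton_self _)
      simpa using this
    rcases e1 with rfl | rfl <;> rcases e2 with rfl | rfl
    · exact absurd h2 (hr _ _ h2)
    · rfl
    · exact absurd h3 (hr _ _ h2)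
    · exact absurd h2 (hr _ _ h2)
  · intro P hP
    obtain ⟨a, ha, b, hb, hab, ht, rfl⟩ := mem_pair_of_falseTwinPairs.mp hP
    rcases hr' a b hab with hlt | hlt
    · exact ⟨⟨a, b⟩, by simp [hlt, ht, ha, hb], rfl⟩
    · exact ⟨⟨b, a⟩, by simp [hlt, show G.FalseTwins b a from Eq.symm ht, ha, hb],
        Finset.pair_comm _ _⟩

/-- Parts are disjoint, so at most three are excluded: `I`, the one containing `a` and the one
containing `b`. -/
theorem exists_part_avoiding {C : Finset (Finset V)} (hX : G.IsCoClusterModulator X)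
    (hC : ∀ J ∈ C, J ∈ G.coClusterParts X) (hcard : 4 ≤ C.card) (I : Finset V) (a b : V) :
    ∃ J ∈ C, J ≠ I ∧ a ∉ J ∧ b ∉ J := by
  by_contra hcon
  push Not at hcon
  have h1 : ∀ a, (C.filter fun J => a ∈ J).card ≤ 1 := fun a => by
    rw [Finset.card_le_one]
    intro J hJ K hK
    rw [Finset.mem_filter] at hJ hK
    exact part_eq_of_mem hX (hC J hJ.1) (hC K hK.1) hJ.2 hK.2
  have h2 : C ⊆ ({I} ∪ C.filter fun J => a ∈ J) ∪ C.filter fun J => b ∈ J := by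
    intro J hJ
    simp only [Finset.mem_union, Finset.mem_singleton, Finset.mem_filter]
    have := hcon J hJ
    tauto
  have h3 := Finset.card_le_card h2
  have h4 := Finset.card_union_le ({I} ∪ C.filter fun J => a ∈ J) (C.filter fun J => b ∈ J)
  have h5 := Finset.card_union_le {I} (C.filter fun J => a ∈ J)
  have h6 := h1 a
  have h7 := h1 b
  rw [Finset.card_singleton] at h5
  omega

theorem card_fiber_le_two (hX : G.IsCoClusterModulator X) (h3 : ¬G.HasThreeFalseTwins)
    (hI : I ∈ G.coClusterParts X) (P : Finset V) :
    (I.filter fun u => (X.filter fun x => G.Adj u x) = P).card ≤ 2 := by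
  by_contra hcon
  obtain ⟨a, ha, b, hb, c, hc, hab, hac, hbc⟩ := Finset.two_lt_card.mp (not_le.mp hcon)
  rw [Finset.mem_filter] at ha hb hc
  have key : ∀ u v, u ∈ I → v ∈ I → (X.filter fun x => G.Adj u x) = (X.filter fun x => G.Adj v x) →
      G.FalseTwins u v := fun u v hu hv h => by
    rw [part_falseTwins_iff hX hI hu hv]
    intro x hx
    simpa [hx] using Finset.ext_iff.mp h x
  exact h3 ⟨a, b, c, hab, hac, hbc, key a b ha.1 hb.1 (ha.2.trans hb.2.symm),
    key a c ha.1 hc.1 (ha.2.trans hc.2.symm)⟩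

theorem card_part_le (hX : G.IsCoClusterModulator X) (h3 : ¬G.HasThreeFalseTwins)
    (hI : I ∈ G.coClusterParts X) : I.card ≤ 2 ^ (X.card + 1) := by
  have := Finset.card_le_mul_card_image_of_maps_to (s := I) (t := X.powerset)
    (f := fun u => X.filter fun x => G.Adj u x)
    (fun u _ => Finset.mem_powerset.mpr (Finset.filter_subset _ _)) 2
    (fun P _ => card_fiber_le_two hX h3 hI P)
  rwa [Finset.card_powerset, mul_comm, ← pow_succ] at this

/-- Every multiplicity is at most two, so a signature is a submultiset of two copies of the powerset
of `X`, a multiset with `2 ^ (|X| + 1)` elements. -/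
theorem card_signatures_le (hX : G.IsCoClusterModulator X) (h3 : ¬G.HasThreeFalseTwins) :
    ((G.coClusterParts X).image (G.signature X)).card ≤ 2 ^ 2 ^ (X.card + 1) := by
  have hsub : (G.coClusterParts X).image (G.signature X) ⊆
      (Multiset.powerset (2 • X.powerset.val)).toFinset := by
    intro s hs
    obtain ⟨I, hI, rfl⟩ := Finset.mem_image.mp hs
    rw [Multiset.mem_toFinset, Multiset.mem_powerset, Multiset.le_iff_count]
    intro P
    rw [Multiset.count_nsmul, signature, Multiset.count_map, ← Finset.filter_val, Finset.card_val]
    by_cases hP : P ∈ X.powerset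
    · rw [Multiset.count_eq_one_of_mem X.powerset.nodup hP]
      have := card_fiber_le_two hX h3 hI P
      simpa only [eq_comm] using this
    · rw [Finset.filter_false_of_mem]
      · simp
      · rintro u - rfl
        exact hP (Finset.mem_powerset.mpr (Finset.filter_subset _ _))
  refine (Finset.card_le_card hsub).trans ((Multiset.toFinset_card_le _).trans ?_)
  rw [Multiset.card_powerset, Multiset.card_nsmul, Finset.card_val, Finset.card_powerset,
    ← pow_succ']

theorem card_le_of_card_identicalParts_le (hX : G.IsCoClusterModulator X)
    (h3 : ¬G.HasThreeFalseTwins) {M : ℕ}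
    (hM : ∀ I ∈ G.coClusterParts X, (G.identicalParts X I).card ≤ M) :
    Fintype.card V ≤ 2 ^ 2 ^ (X.card + 1) * M * 2 ^ (X.card + 1) + X.card := by
  have h1 : (G.coClusterParts X).card ≤ 2 ^ 2 ^ (X.card + 1) * M := by
    refine (Finset.card_le_mul_card_image (f := G.signature X) _ M ?_).trans ?_
    · intro s hs
      obtain ⟨I, hI, rfl⟩ := Finset.mem_image.mp hs
      exact hM I hI
    · rw [mul_comm]
      exact Nat.mul_le_mul_right _ (card_signatures_le hX h3)
  have h2 : (Finset.univ : Finset V) ⊆ (G.coClusterParts X).biUnion (fun I => I) ∪ X := by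
    intro v _
    rw [Finset.mem_union, Finset.mem_biUnion]
    by_cases hv : v ∈ X
    · exact Or.inr hv
    · refine Or.inl ⟨Finset.univ.filter fun u => u ∉ X ∧ ¬G.Adj v u, ?_, ?_⟩
      · exact mem_coClusterParts.mpr ⟨v, hv, fun u => by simp⟩
      · simp [hv]
  calc Fintype.card V ≤ _ := Finset.card_le_card h2
    _ ≤ _ := Finset.card_union_le _ _
    _ ≤ _ := Nat.add_le_add_right ((Finset.card_biUnion_le_card_mul _ _ _
      fun I hI => card_part_le hX h3 hI).trans (Nat.mul_le_mul_right _ h1)) _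

end Counting

theorem IsCoClusterModulator.comap {V W : Type*} {G : SimpleGraph V} {H : SimpleGraph W}
    {X : Finset V} {Y : Finset W} (hX : G.IsCoClusterModulator X) (φ : H ↪g G)
    (h : ∀ b, b ∈ Y ↔ φ b ∈ X) : H.IsCoClusterModulator Y := by
  rw [isCoClusterModulator_iff] at hX ⊢
  intro a ha b hb c hc
  rw [h] at ha hb hc
  have := hX _ ha _ hb _ hc
  simpa only [φ.map_adj_iff] using this

end SimpleGraph

namespace MetricDimension

open Classical SimpleGraph

/-! ### The reduction rules on instances -/

theorem Instance.yes_iff {A : Instance} :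
    A.Yes ↔ ∃ S, A.graph.ResolvesOn S Set.univ ∧ (S.card : ℤ) ≤ A.k := by
  simp only [Instance.Yes, IsResolvingSet, ResolvesOn, Set.mem_univ, true_imp_iff]

/-- With distances preserved, the reduced instance can be studied inside the graph of `A`. -/
theorem yes_iff_of_isometric {A B : MarkedInstance} {D : Finset (Fin A.n)} (φ : B.graph ↪g A.graph)
    (hφ : ∀ a, a ∈ Set.range φ ↔ a ∉ D)
    (hd : ∀ a b, A.graph.edist (φ a) (φ b) = B.graph.edist a b) :
    B.Yes ↔ ∃ S, (∀ a ∈ S, a ∉ D) ∧ A.graph.ResolvesOn S {a | a ∉ D} ∧ (S.card : ℤ) ≤ B.k := by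
  rw [Instance.yes_iff]
  constructor
  · rintro ⟨S, hS, hk⟩
    refine ⟨S.image φ, ?_, ?_, by rwa [Finset.card_image_of_injective _ φ.injective]⟩
    · intro a ha
      obtain ⟨b, -, rfl⟩ := Finset.mem_image.mp ha
      exact (hφ _).mp ⟨b, rfl⟩
    · intro u hu v hv huv
      obtain ⟨u, rfl⟩ := (hφ u).mpr hu
      obtain ⟨v, rfl⟩ := (hφ v).mpr hv
      obtain ⟨w, hw, hne⟩ := hS u trivial v trivial fun h => huv (h ▸ rfl)
      exact ⟨φ w, Finset.mem_image_of_mem _ hw, by rwa [hd, hd]⟩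
  · rintro ⟨S, hSD, hS, hk⟩
    have himg : (Finset.univ.filter fun b => φ b ∈ S).image φ = S := by
      ext a
      simp only [Finset.mem_image, Finset.mem_filter, Finset.mem_univ, true_and]
      constructor
      · rintro ⟨b, hb, rfl⟩; exact hb
      · intro ha
        obtain ⟨b, rfl⟩ := (hφ a).mpr (hSD a ha)
        exact ⟨b, ha, rfl⟩
    refine ⟨Finset.univ.filter fun b => φ b ∈ S, ?_, ?_⟩
    · intro u _ v _ huv
      obtain ⟨w, hw, hne⟩ := hS (φ u) ((hφ _).mp ⟨u, rfl⟩) (φ v) ((hφ _).mp ⟨v, rfl⟩)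
        fun h => huv (φ.injective h)
      obtain ⟨w, rfl⟩ := (hφ w).mpr (hSD w hw)
      exact ⟨w, by simpa using hw, by rwa [hd, hd] at hne⟩
    · rwa [← himg, Finset.card_image_of_injective _ φ.injective] at hk

theorem TwinRule.yes_iff {A B : MarkedInstance} (h : TwinRule A B) : A.Yes ↔ B.Yes := by
  obtain ⟨u, v, w, huv, huw, hvw, h1, h2, ⟨φ, hφ, -⟩, hk⟩ := h
  have hset : {a | a ∉ ({u} : Finset (Fin A.n))} = {a | a ≠ u} := by ext; simp
  rw [yes_iff_of_isometric φ hφ, Instance.yes_iff, hk, hset]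
  · constructor
    · rintro ⟨S, hS, hk⟩
      obtain ⟨S', h3, h4, h5⟩ := exists_resolving_of_twin huv huw hvw h1 h2 hS
      exact ⟨S', by simpa using h3, h4, by omega⟩
    · rintro ⟨S, -, hS, hk⟩
      obtain ⟨S', h4, h5⟩ := exists_resolving_of_deleted_twin hS
      exact ⟨S', h4, by omega⟩
  · refine Embedding.edist_eq φ fun a b y hy hyb => ?_
    have hyu : y = u := by
      have := mt (hφ y).mpr hy
      simpa using this
    subst hyu
    have ha : φ a ≠ y := by simpa using (hφ (φ a)).mp ⟨a, rfl⟩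
    -- Of the two other twins one differs from `φ a`. Neither is `φ b`, which is adjacent to `y`.
    obtain ⟨z, hzy, hz, hza⟩ : ∃ z, z ≠ y ∧ A.graph.FalseTwins y z ∧ φ a ≠ z := by
      by_cases h : φ a = v
      · exact ⟨w, huw.symm, h2, h ▸ hvw⟩
      · exact ⟨v, huv.symm, h1, h⟩
    obtain ⟨σ, h3, -, h4⟩ := hz.exists_aut
    refine ⟨σ, h4 _ ha hza, h4 _ hyb.ne' ?_, ?_⟩
    · intro h
      exact hz.not_adj (h ▸ hyb)
    · rw [h3, hφ]
      simpa using hzy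

theorem IndependentSetRule.yes_iff {A B : MarkedInstance} (hX : A.graph.IsCoClusterModulator A.X)
    (h : IndependentSetRule A B) : A.Yes ↔ B.Yes := by
  obtain ⟨h3, I, hI, hbig, ⟨φ, hφ, -⟩, hk⟩ := h
  have hC := identicalClass_identicalParts A.graph A.X I
  have hIC : I ∈ A.graph.identicalParts A.X I := by simp [identicalParts, hI]
  have hpow : 4 ≤ 2 ^ (A.X.card + 2) := by
    have := Nat.one_le_two_pow (n := A.X.card)
    rw [pow_add]; omega
  rw [yes_iff_of_isometric φ hφ, Instance.yes_iff, hk]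
  · constructor
    · rintro ⟨S, hS, hk⟩
      obtain ⟨S', h4, h5, h6⟩ := exists_resolving_of_part hX h3 hI hbig hS
      exact ⟨S', h4, h5, by omega⟩
    · rintro ⟨S, hSI, hS, hk⟩
      obtain ⟨S', h4, h5⟩ := exists_resolving_of_deleted_part hX h3 hI (by omega) hSI hS
      exact ⟨S', h4, by omega⟩
  · refine Embedding.edist_eq φ fun a b y hy _ => ?_
    have hyI : y ∈ I := by
      by_contra h
      exact hy ((hφ y).mpr h)
    obtain ⟨J, hJ, hJI, haJ, hbJ⟩ := exists_part_avoiding hX hC.1 (by omega) I (φ a) (φ b)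
    obtain ⟨σ, hσ⟩ := exists_exchange hX hI (hC.1 J hJ) hJI.symm (hC.2 I hIC J hJ)
    refine ⟨σ, hσ.fixed _ ((hφ _).mp ⟨a, rfl⟩) haJ, hσ.fixed _ ((hφ _).mp ⟨b, rfl⟩) hbJ, ?_⟩
    rw [hφ]
    exact fun h => hJI (part_eq_of_mem hX (hC.1 J hJ) hI (hσ.map_left y hyI) h)

theorem DeletesTo.modulator {A B : MarkedInstance} {D : Finset (Fin A.n)} (h : DeletesTo A D B)
    (hX : A.graph.IsCoClusterModulator A.X) : B.graph.IsCoClusterModulator B.X := by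
  obtain ⟨φ, -, h⟩ := h
  exact hX.comap φ h

theorem DeletesTo.card_le {A B : MarkedInstance} {D : Finset (Fin A.n)} (h : DeletesTo A D B) :
    B.X.card ≤ A.X.card := by
  obtain ⟨φ, -, h⟩ := h
  exact Finset.card_le_card_of_injOn φ (fun b hb => (h b).mp hb) φ.injective.injOn

theorem Reduces.exists_deletesTo {A B : MarkedInstance} (h : Reduces A B) :
    ∃ D, D.Nonempty ∧ DeletesTo A D B := by
  rcases h with ⟨u, v, w, -, -, -, -, -, h, -⟩ | ⟨-, I, hI, -, h, -⟩
  exacts [⟨_, Finset.singleton_nonempty u, h⟩, ⟨_, part_nonempty hI, h⟩]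

theorem Reduces.n_lt {A B : MarkedInstance} (h : Reduces A B) : B.n < A.n := by
  obtain ⟨D, ⟨a, ha⟩, φ, hφ, -⟩ := h.exists_deletesTo
  have := Fintype.card_lt_of_injective_of_notMem φ φ.injective (b := a) fun h => (hφ a).mp h ha
  simpa using this

theorem Reduces.yes_iff {A B : MarkedInstance} (hX : A.graph.IsCoClusterModulator A.X)
    (h : Reduces A B) : A.Yes ↔ B.Yes :=
  h.elim TwinRule.yes_iff (IndependentSetRule.yes_iff hX)

theorem reduces_star {A B : MarkedInstance} (h : Relation.ReflTransGen Reduces A B)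
    (hX : A.graph.IsCoClusterModulator A.X) :
    (A.Yes ↔ B.Yes) ∧ B.graph.IsCoClusterModulator B.X ∧ B.X.card ≤ A.X.card := by
  induction h with
  | refl => exact ⟨Iff.rfl, hX, le_rfl⟩
  | tail _ hr ih =>
    obtain ⟨D, -, hD⟩ := hr.exists_deletesTo
    exact ⟨ih.1.trans (hr.yes_iff ih.2.1), hD.modulator ih.2.1, hD.card_le.trans ih.2.2⟩

/-- Delete the vertices in `D`, keep the order of the others, and replace `k`. -/
noncomputable def MarkedInstance.delete (A : MarkedInstance) (D : Finset (Fin A.n)) (k : ℤ) :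
    MarkedInstance where
  n := Dᶜ.card
  graph := A.graph.comap (Dᶜ.orderEmbOfFin rfl)
  k := k
  X := Finset.univ.filter fun p => Dᶜ.orderEmbOfFin rfl p ∈ A.X

theorem MarkedInstance.mem_delete_X {A : MarkedInstance} {D : Finset (Fin A.n)} {k : ℤ}
    {p : Fin (A.delete D k).n} :
    p ∈ (A.delete D k).X ↔ Dᶜ.orderEmbOfFin rfl p ∈ A.X := by
  unfold delete at p ⊢
  simp

theorem MarkedInstance.deletesTo_delete (A : MarkedInstance) (D : Finset (Fin A.n)) (k : ℤ) :
    DeletesTo A D (A.delete D k) := by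
  refine ⟨⟨(Dᶜ.orderEmbOfFin rfl).toEmbedding, Iff.rfl⟩, fun a => ?_, fun b => ?_⟩
  · change a ∈ Set.range (Dᶜ.orderEmbOfFin rfl) ↔ _
    rw [Finset.range_orderEmbOfFin]
    simp
  · exact mem_delete_X

theorem irreducible_iff {A : MarkedInstance} : Irreducible A ↔ ¬A.graph.HasThreeFalseTwins ∧
    ∀ I ∈ A.graph.coClusterParts A.X,
      (A.graph.identicalParts A.X I).card < 2 ^ (A.X.card + 2) + A.X.card + 2 := by
  constructor
  · intro h
    have h3 : ¬A.graph.HasThreeFalseTwins := fun ⟨u, v, w, h1, h2, h3, h4, h5⟩ =>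
      h _ (Or.inl ⟨u, v, w, h1, h2, h3, h4, h5, A.deletesTo_delete {u} (A.k - 1), rfl⟩)
    refine ⟨h3, fun I hI => ?_⟩
    by_contra hcon
    exact h _ (Or.inr ⟨h3, I, hI, not_lt.mp hcon,
      A.deletesTo_delete I (A.k - max 1 (A.graph.falseTwinPairs I : ℤ)), rfl⟩)
  · rintro ⟨h1, h2⟩ B (⟨u, v, w, h3, h4, h5, h6, h7, -⟩ | ⟨-, I, hI, h3, -⟩)
    · exact h1 ⟨u, v, w, h3, h4, h5, h6, h7⟩
    · exact absurd h3 (not_le.mpr (h2 I hI))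

theorem Irreducible.le_kernelBound {A : MarkedInstance} (hX : A.graph.IsCoClusterModulator A.X)
    (h : Irreducible A) : A.n ≤ kernelBound A.X.card := by
  obtain ⟨h1, h2⟩ := irreducible_iff.mp h
  have := card_le_of_card_identicalParts_le (M := 2 ^ (A.X.card + 2) + A.X.card + 1) hX h1
    fun I hI => Nat.le_of_lt_succ (h2 I hI)
  simpa [kernelBound] using this

theorem kernelBound_mono {x y : ℕ} (h : x ≤ y) : kernelBound x ≤ kernelBound y := by
  unfold kernelBound
  gcongr <;> omega

/-- The size of a vertex set lies between `0` and `n`, so all negative `k` are equivalent, and so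
are all `k ≥ n`. -/
theorem MarkedInstance.clamp_yes (A : MarkedInstance) : A.clamp.Yes ↔ A.Yes := by
  rw [Instance.yes_iff, Instance.yes_iff]
  change (∃ S, A.graph.ResolvesOn S Set.univ ∧ (S.card : ℤ) ≤ max (-1) (min A.k A.n)) ↔ _
  constructor
  · rintro ⟨S, h1, h2⟩
    exact ⟨S, h1, by omega⟩
  · rintro ⟨S, h1, h2⟩
    have := Finset.card_le_univ S
    rw [Fintype.card_fin] at this
    exact ⟨S, h1, by omega⟩

end MetricDimension

namespace MetricDimension

open Classical SimpleGraph RAM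

/-! ### Encodings in memory -/

theorem adjacencyBits_eq {n : ℕ} (G : SimpleGraph (Fin n)) : adjacencyBits G =
    List.ofFn fun k : Fin (n * n) => if G.Adj k.divNat k.modNat then 1 else 0 := by
  rw [List.ofFn_mul, adjacencyBits]
  congr 2
  funext i
  congr 1
  funext j
  have hn : 0 < n := i.pos
  have h1 : ∀ h, (⟨↑i * n + ↑j, h⟩ : Fin (n * n)).divNat = i := fun h => by
    ext
    simp [Fin.divNat, Nat.mul_comm (i : ℕ) n, Nat.mul_add_div hn, Nat.div_eq_of_lt j.2]
  have h2 : ∀ h, (⟨↑i * n + ↑j, h⟩ : Fin (n * n)).modNat = j := fun h => by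
    ext
    simp [Fin.modNat, Nat.mul_comm (i : ℕ) n, Nat.mod_eq_of_lt j.2]
  rw [h1, h2]

theorem pair_lt {n i j : ℕ} (hi : i < n) (hj : j < n) : n * i + j < n * n :=
  calc n * i + j < n * i + n := by omega
    _ = n * (i + 1) := by ring
    _ ≤ n * n := Nat.mul_le_mul_left _ hi

theorem length_adjacencyBits {n : ℕ} (G : SimpleGraph (Fin n)) :
    (adjacencyBits G).length = n * n := by
  rw [adjacencyBits_eq, List.length_ofFn]

theorem getD_adjacencyBits {n : ℕ} (G : SimpleGraph (Fin n)) (i j : Fin n) :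
    (adjacencyBits G).getD (n * i + j) 0 = if G.Adj i j then 1 else 0 := by
  have hn : 0 < n := i.pos
  have hlt := pair_lt i.2 j.2
  rw [adjacencyBits_eq, List.getD_eq_getElem _ _ (by simpa using hlt), List.getElem_ofFn]
  have h1 : ∀ h, (⟨n * ↑i + ↑j, h⟩ : Fin (n * n)).divNat = i := fun h => by
    ext
    simp [Fin.divNat, Nat.mul_add_div hn, Nat.div_eq_of_lt j.2]
  have h2 : ∀ h, (⟨n * ↑i + ↑j, h⟩ : Fin (n * n)).modNat = j := fun h => by
    ext
    simp [Fin.modNat, Nat.mod_eq_of_lt j.2]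
  rw [h1, h2]

theorem Instance.length_encode (A : Instance) : A.encode.length = 3 + A.n * A.n := by
  simp [Instance.encode, length_adjacencyBits]
  omega

theorem MarkedInstance.length_encode (A : MarkedInstance) :
    A.encode.length = 3 + A.n + A.n * A.n := by
  simp [MarkedInstance.encode, length_adjacencyBits]
  omega

theorem Instance.getD_encode_adj (A : Instance) (i j : Fin A.n) :
    A.encode.getD (3 + (A.n * i + j)) 0 = if A.graph.Adj i j then 1 else 0 := by
  rw [Instance.encode, List.getD_append_right _ _ _ _ (by simp), ← getD_adjacencyBits]
  congr 1
  simp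

theorem MarkedInstance.getD_encode_mark (A : MarkedInstance) (i : Fin A.n) :
    A.encode.getD (3 + i) 0 = if i ∈ A.X then 1 else 0 := by
  rw [MarkedInstance.encode, List.getD_append _ _ _ _ (by simp; omega),
    List.getD_append_right _ _ _ _ (by simp), List.getD_eq_getElem _ _ (by simp), List.getElem_ofFn]
  simp

theorem MarkedInstance.getD_encode_adj (A : MarkedInstance) (i j : Fin A.n) :
    A.encode.getD (3 + A.n + (A.n * i + j)) 0 = if A.graph.Adj i j then 1 else 0 := by
  rw [MarkedInstance.encode, List.getD_append_right _ _ _ _ (by simp; omega), ← getD_adjacencyBits]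
  congr 1
  simp
  omega

/-- The memory holds the encoding of the marked instance `A`. -/
structure Holds (x : Mach) (A : MarkedInstance) : Prop where
  size : 3 + A.n + A.n * A.n ≤ x.size
  n : x.read 0 = A.n
  pos : x.read 1 = A.k.toNat
  neg : x.read 2 = (-A.k).toNat
  mark : ∀ i : Fin A.n, x.read (3 + i) = if i ∈ A.X then 1 else 0
  adj : ∀ i j : Fin A.n, x.read (3 + A.n + (A.n * i + j)) = if A.graph.Adj i j then 1 else 0

theorem Holds.of_encode {x : Mach} {A : MarkedInstance} (hs : A.encode.length ≤ x.size)
    (h : ∀ i < A.encode.length, x.mem i = A.encode.getD i 0) : Holds x A := by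
  have hr : ∀ i < A.encode.length, x.read i = A.encode.getD i 0 := fun i hi => by
    rw [Mach.read, if_pos (hi.trans_le hs), h i hi]
  rw [A.length_encode] at hs hr
  refine ⟨hs, ?_, ?_, ?_, fun i => ?_, fun i j => ?_⟩
  · rw [hr 0 (by omega)]; rfl
  · rw [hr 1 (by omega)]; rfl
  · rw [hr 2 (by omega)]; rfl
  · rw [hr _ (by omega), A.getD_encode_mark]
  · have := pair_lt i.2 j.2
    rw [hr _ (by omega), A.getD_encode_adj]

theorem Holds.read_eq {x : Mach} {A : MarkedInstance} (h : Holds x A) {i : ℕ}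
    (hi : i < A.encode.length) : x.read i = A.encode.getD i 0 := by
  rw [A.length_encode] at hi
  obtain rfl | rfl | rfl | hi3 : i = 0 ∨ i = 1 ∨ i = 2 ∨ 3 ≤ i := by omega
  · exact h.n
  · exact h.pos
  · exact h.neg
  by_cases hin : i < 3 + A.n
  · obtain ⟨j, rfl⟩ := Nat.exists_eq_add_of_le hi3
    have hj : j < A.n := by omega
    exact (h.mark ⟨j, hj⟩).trans (A.getD_encode_mark ⟨j, hj⟩).symm
  · obtain ⟨j, rfl⟩ := Nat.exists_eq_add_of_le (not_lt.mp hin)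
    have hj : j < A.n * A.n := by omega
    have hn : 0 < A.n := Nat.pos_of_mul_pos_left (by omega : 0 < A.n * A.n)
    have h1 : j / A.n < A.n := Nat.div_lt_of_lt_mul hj
    have h2 : j % A.n < A.n := Nat.mod_lt _ hn
    have := (h.adj ⟨_, h1⟩ ⟨_, h2⟩).trans (A.getD_encode_adj ⟨_, h1⟩ ⟨_, h2⟩).symm
    rwa [Fin.val_mk, Fin.val_mk, Nat.div_add_mod] at this

theorem Holds.mem_eq {x : Mach} {A : MarkedInstance} (h : Holds x A) {i : ℕ}
    (hi : i < A.encode.length) : x.mem i = A.encode.getD i 0 := by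
  rw [← h.read_eq hi, Mach.read, if_pos]
  have := h.size
  rw [A.length_encode] at hi
  omega

/-! ### Evaluating predicates of the encoded instance -/

section Cells

variable (x : Mach)

/-- The number of vertices of the encoded instance. -/
def nv : ℕ := min (x.read 0) x.size

/-- The vertex `i` is marked. -/
def markP (i : ℕ) : Prop := x.read (3 + i) ≠ 0

/-- The vertices `i` and `j` are adjacent. -/
def adjP (i j : ℕ) : Prop := x.read (3 + nv x + (nv x * i + j)) ≠ 0

/-- `u` and `v` are false twins. -/
def twinP (u v : ℕ) : Prop := ∀ z < nv x, adjP x u z ↔ adjP x v z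

/-- `u` has two further false twins. -/
def tripleP (u : ℕ) : Prop :=
  ∃ v < nv x, ∃ w < nv x, ((u ≠ v ∧ u ≠ w) ∧ v ≠ w) ∧ twinP x u v ∧ twinP x u w

/-- `u` is in the part of `v`. -/
def partP (v u : ℕ) : Prop := ¬markP x u ∧ ¬adjP x v u

/-- `a` and `u` have the same marked neighbours. -/
def sameP (a u : ℕ) : Prop := ∀ z < nv x, markP x z → (adjP x a z ↔ adjP x u z)

/-- The number of vertices in the part of `v` with the marked neighbours of `a`. -/
noncomputable def typeCount (v a : ℕ) : ℕ :=
  countBelow (nv x) fun u => partP x v u ∧ sameP x a u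

/-- The parts of `v` and `w` have the same signature. -/
def signatureP (v w : ℕ) : Prop := ∀ a < nv x, typeCount x v a = typeCount x w a

/-- `w` is the first vertex of its part. -/
def firstP (w : ℕ) : Prop := ¬markP x w ∧ ∀ u < nv x, partP x w u → w ≤ u

/-- The number of parts identical to that of `v`. -/
noncomputable def classCount (v : ℕ) : ℕ :=
  countBelow (nv x) fun w => firstP x w ∧ signatureP x w v

/-- The number of marked vertices. -/
noncomputable def markCount : ℕ := countBelow (nv x) (markP x)

/-- The part of `v` can be deleted. -/
def bigP (v : ℕ) : Prop :=
  ¬markP x v ∧ 2 ^ min (markCount x + 2) x.size + markCount x + 2 ≤ classCount x v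

/-- The number of pairs of false twins in the part of `v`. -/
noncomputable def twinCount (v : ℕ) : ℕ :=
  ∑ a ∈ Finset.range (nv x), countBelow (nv x) fun b =>
    (a < b ∧ twinP x a b) ∧ partP x v a ∧ partP x v b

end Cells

section Evaluate

variable {α : Type} [Ctx α] {a b : α → ℕ}

theorem PF_nv : PF fun y : α => nv (Ctx.mach y) := (PF.read (PF.const 0)).min PF.size

theorem nv_le (x : Mach) : nv x ≤ x.size := min_le_right _ _

theorem PFP_markP (ha : PF a) : PFP fun y => markP (Ctx.mach y) (a y) :=
  PFP.ne (PF.read ((PF.const 3).add ha)) (PF.const 0)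

theorem PFP_adjP (ha : PF a) (hb : PF b) : PFP fun y => adjP (Ctx.mach y) (a y) (b y) :=
  PFP.ne (PF.read (((PF.const 3).add PF_nv).add ((PF_nv.mul (fun _ => nv_le _) ha).add hb)))
    (PF.const 0)

theorem PFP_all {P : α → ℕ → Prop} (hP : PFP fun y : α × ℕ => P y.1 y.2) :
    PFP fun y => ∀ i < nv (Ctx.mach y), P y i :=
  PFP.all PF_nv (fun _ => nv_le _) hP

theorem PFP_ex {P : α → ℕ → Prop} (hP : PFP fun y : α × ℕ => P y.1 y.2) :
    PFP fun y => ∃ i < nv (Ctx.mach y), P y i :=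
  PFP.ex PF_nv (fun _ => nv_le _) hP

theorem PF_count {P : α → ℕ → Prop} (hP : PFP fun y : α × ℕ => P y.1 y.2) :
    PF fun y => countBelow (nv (Ctx.mach y)) (P y) :=
  PF.count PF_nv (fun _ => nv_le _) hP

theorem PF_least {P : α → ℕ → Prop} (hP : PFP fun y : α × ℕ => P y.1 y.2) :
    PF fun y => leastBelow (nv (Ctx.mach y)) (P y) :=
  PF.least PF_nv (fun _ => nv_le _) hP

theorem PFP_twinP (ha : PF a) (hb : PF b) : PFP fun y => twinP (Ctx.mach y) (a y) (b y) :=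
  PFP_all (P := fun y z => adjP (Ctx.mach y) (a y) z ↔ adjP (Ctx.mach y) (b y) z)
    ((PFP_adjP ha.fst PF.snd).iff (PFP_adjP hb.fst PF.snd))

theorem PFP_tripleP (ha : PF a) : PFP fun y => tripleP (Ctx.mach y) (a y) :=
  PFP_ex (P := fun y v => ∃ w < nv (Ctx.mach y), ((a y ≠ v ∧ a y ≠ w) ∧ v ≠ w) ∧
      twinP (Ctx.mach y) (a y) v ∧ twinP (Ctx.mach y) (a y) w)
    (PFP_ex (α := α × ℕ) (P := fun y w => ((a y.1 ≠ y.2 ∧ a y.1 ≠ w) ∧ y.2 ≠ w) ∧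
      twinP (Ctx.mach y) (a y.1) y.2 ∧ twinP (Ctx.mach y) (a y.1) w)
      ((((PFP.ne ha.fst.fst PF.snd.fst).and (PFP.ne ha.fst.fst PF.snd)).and
        (PFP.ne PF.snd.fst PF.snd)).and
        ((PFP_twinP ha.fst.fst PF.snd.fst).and (PFP_twinP ha.fst.fst PF.snd))))

theorem PFP_partP (ha : PF a) (hb : PF b) : PFP fun y => partP (Ctx.mach y) (a y) (b y) :=
  (PFP_markP hb).not.and (PFP_adjP ha hb).not

theorem PFP_sameP (ha : PF a) (hb : PF b) : PFP fun y => sameP (Ctx.mach y) (a y) (b y) :=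
  PFP_all (P := fun y z => markP (Ctx.mach y) z →
      (adjP (Ctx.mach y) (a y) z ↔ adjP (Ctx.mach y) (b y) z))
    ((PFP_markP PF.snd).imp ((PFP_adjP ha.fst PF.snd).iff (PFP_adjP hb.fst PF.snd)))

theorem PF_typeCount (ha : PF a) (hb : PF b) : PF fun y => typeCount (Ctx.mach y) (a y) (b y) :=
  PF_count (P := fun y u => partP (Ctx.mach y) (a y) u ∧ sameP (Ctx.mach y) (b y) u)
    ((PFP_partP ha.fst PF.snd).and (PFP_sameP hb.fst PF.snd))

theorem PFP_signatureP (ha : PF a) (hb : PF b) :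
    PFP fun y => signatureP (Ctx.mach y) (a y) (b y) :=
  PFP_all (P := fun y z => typeCount (Ctx.mach y) (a y) z = typeCount (Ctx.mach y) (b y) z)
    (PFP.eq (PF_typeCount ha.fst PF.snd) (PF_typeCount hb.fst PF.snd))

theorem PFP_firstP (ha : PF a) : PFP fun y => firstP (Ctx.mach y) (a y) :=
  (PFP_markP ha).not.and (PFP_all (P := fun y u => partP (Ctx.mach y) (a y) u → a y ≤ u)
    ((PFP_partP ha.fst PF.snd).imp (PFP.le ha.fst PF.snd)))

theorem PF_classCount (ha : PF a) : PF fun y => classCount (Ctx.mach y) (a y) :=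
  PF_count (P := fun y w => firstP (Ctx.mach y) w ∧ signatureP (Ctx.mach y) w (a y))
    ((PFP_firstP PF.snd).and (PFP_signatureP PF.snd ha.fst))

theorem PF_markCount : PF fun y : α => markCount (Ctx.mach y) :=
  PF_count (P := fun y w => markP (Ctx.mach y) w) (PFP_markP PF.snd)

theorem PFP_bigP (ha : PF a) : PFP fun y => bigP (Ctx.mach y) (a y) :=
  (PFP_markP ha).not.and (PFP.le
    ((((PF.min (PF_markCount.add (PF.const 2)) PF.size).two_pow fun _ => min_le_right _ _).add
      PF_markCount).add (PF.const 2)) (PF_classCount ha))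

theorem PF_twinCount (ha : PF a) : PF fun y => twinCount (Ctx.mach y) (a y) :=
  PF.sum (f := fun y u => countBelow (nv (Ctx.mach y)) fun v =>
      (u < v ∧ twinP (Ctx.mach y) u v) ∧ partP (Ctx.mach y) (a y) u ∧ partP (Ctx.mach y) (a y) v)
    PF_nv (fun _ => nv_le _)
    (PF_count (α := α × ℕ) (P := fun y v => (y.2 < v ∧ twinP (Ctx.mach y) y.2 v) ∧
      partP (Ctx.mach y) (a y.1) y.2 ∧ partP (Ctx.mach y) (a y.1) v)
      (((PFP.lt PF.snd.fst PF.snd).and (PFP_twinP PF.snd.fst PF.snd)).and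
        ((PFP_partP ha.fst.fst PF.snd.fst).and (PFP_partP ha.fst.fst PF.snd))))

end Evaluate

end MetricDimension

namespace MetricDimension

open Classical SimpleGraph RAM

/-! ### One reduction step in memory -/

section Step

variable (x : Mach)

/-- The first vertex with two further false twins. -/
noncomputable def tripleVertex : ℕ := leastBelow (nv x) (tripleP x)

/-- The first vertex whose part can be deleted. -/
noncomputable def bigVertex : ℕ := leastBelow (nv x) (bigP x)

/-- The vertex `u` is deleted in the next step. -/
def deleteP (u : ℕ) : Prop :=
  if tripleVertex x < nv x then u = tripleVertex x
  else bigVertex x < nv x ∧ partP x (bigVertex x) u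

/-- The amount by which `k` decreases in the next step. -/
noncomputable def decrease : ℕ :=
  if tripleVertex x < nv x then 1 else max 1 (twinCount x (bigVertex x))

/-- The number of vertices that are kept in the next step. -/
noncomputable def keepCount : ℕ := countBelow (nv x) fun u => ¬deleteP x u

/-- The `p`-th vertex that is kept in the next step. -/
noncomputable def kept (p : ℕ) : ℕ :=
  countBelow (nv x) fun j => countBelow (nv x) (fun u => u ≤ j ∧ ¬deleteP x u) ≤ p

/-- The content of the cell `i` after the next step. -/
noncomputable def stepCell (i : ℕ) : ℕ :=
  if ∃ u < nv x, deleteP x u then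
    if i = 0 then keepCount x
    else if i = 1 then x.read 1 - (x.read 2 + decrease x)
    else if i = 2 then x.read 2 + decrease x - x.read 1
    else if i < 3 + keepCount x then if markP x (kept x (i - 3)) then 1 else 0
    else if adjP x (kept x (min (i - (3 + keepCount x)) x.size / keepCount x))
      (kept x (min (i - (3 + keepCount x)) x.size % keepCount x)) then 1 else 0
  else x.read i

/-- One reduction step. -/
noncomputable def stepMach : Mach := ⟨x.size, stepCell x⟩

end Step

section EvaluateStep

variable {α : Type} [Ctx α] {a : α → ℕ}

theorem PF_tripleVertex : PF fun y : α => tripleVertex (Ctx.mach y) :=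
  PF_least (P := fun y u => tripleP (Ctx.mach y) u) (PFP_tripleP PF.snd)

theorem PF_bigVertex : PF fun y : α => bigVertex (Ctx.mach y) :=
  PF_least (P := fun y u => bigP (Ctx.mach y) u) (PFP_bigP PF.snd)

theorem PFP_deleteP (ha : PF a) : PFP fun y => deleteP (Ctx.mach y) (a y) :=
  (PFP.ite (PFP.lt PF_tripleVertex PF_nv) (PFP.eq ha PF_tripleVertex)
    ((PFP.lt PF_bigVertex PF_nv).and (PFP_partP PF_bigVertex ha))).congr fun y => by
      unfold deleteP
      by_cases h : tripleVertex (Ctx.mach y) < nv (Ctx.mach y) <;> simp [h]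

theorem PF_decrease : PF fun y : α => decrease (Ctx.mach y) :=
  PF.congr (PF.ite (PFP.lt PF_tripleVertex PF_nv) (PF.const 1)
    ((PF.const 1).max (PF_twinCount PF_bigVertex))) fun y => by
      unfold decrease
      by_cases h : tripleVertex (Ctx.mach y) < nv (Ctx.mach y) <;> simp [h]

theorem PF_keepCount : PF fun y : α => keepCount (Ctx.mach y) :=
  PF_count (P := fun y u => ¬deleteP (Ctx.mach y) u) (PFP_deleteP PF.snd).not

theorem PF_kept (ha : PF a) : PF fun y => kept (Ctx.mach y) (a y) :=
  PF_count (P := fun y j =>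
      countBelow (nv (Ctx.mach y)) (fun u => u ≤ j ∧ ¬deleteP (Ctx.mach y) u) ≤ a y)
    (PFP.le (PF_count (α := α × ℕ) (P := fun y u => u ≤ y.2 ∧ ¬deleteP (Ctx.mach y) u)
      ((PFP.le PF.snd PF.snd.fst).and (PFP_deleteP PF.snd).not)) ha.fst)

theorem PF_stepCell (ha : PF a) : PF fun y => stepCell (Ctx.mach y) (a y) := by
  have h3 : PF fun y : α => 3 + keepCount (Ctx.mach y) := (PF.const 3).add PF_keepCount
  have hm : PF fun y => min (a y - (3 + keepCount (Ctx.mach y))) (Ctx.mach y).size :=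
    (ha.sub h3).min PF.size
  have hle : ∀ y, min (a y - (3 + keepCount (Ctx.mach y))) (Ctx.mach y).size ≤
    (Ctx.mach y).size := fun y => min_le_right _ _
  refine PF.congr (PF.ite (PFP_ex (P := fun y u => deleteP (Ctx.mach y) u) (PFP_deleteP PF.snd))
    (PF.ite (PFP.eq ha (PF.const 0)) PF_keepCount
      (PF.ite (PFP.eq ha (PF.const 1))
        ((PF.read (PF.const 1)).sub ((PF.read (PF.const 2)).add PF_decrease))
        (PF.ite (PFP.eq ha (PF.const 2))
          (((PF.read (PF.const 2)).add PF_decrease).sub (PF.read (PF.const 1)))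
          (PF.ite (PFP.lt ha h3) (PFP_markP (PF_kept (ha.sub (PF.const 3))))
            (PFP_adjP (PF_kept (hm.div hle PF_keepCount)) (PF_kept (hm.mod hle PF_keepCount)))))))
    (PF.read ha)) fun y => ?_
  unfold stepCell
  congr 1
  split_ifs <;> rfl

theorem MF_stepMach : MF stepMach := MF.map (PF_stepCell (α := Mach × ℕ) PF.snd)

end EvaluateStep

/-! ### Correctness of the evaluation -/

theorem countBelow_eq_card {n : ℕ} {P : ℕ → Prop} {Q : Fin n → Prop}
    {_ : DecidablePred Q} (h : ∀ i : Fin n, P i ↔ Q i) :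
    countBelow n P = (Finset.univ.filter Q).card := by
  refine Eq.symm (Finset.card_bij (fun i _ => (i : ℕ)) ?_ ?_ ?_)
  · intro i hi
    rw [Finset.mem_filter, Finset.mem_range]
    exact ⟨i.2, (h i).mpr (Finset.mem_filter.mp hi).2⟩
  · exact fun i _ j _ hij => Fin.ext hij
  · intro i hi
    rw [Finset.mem_filter, Finset.mem_range] at hi
    exact ⟨⟨i, hi.1⟩, Finset.mem_filter.mpr ⟨Finset.mem_univ _, (h ⟨i, hi.1⟩).mp hi.2⟩, rfl⟩

namespace Holds

variable {x : Mach} {A : MarkedInstance}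

theorem nv_eq (h : Holds x A) : nv x = A.n := by
  have := h.size
  rw [nv, h.n]
  omega

theorem markP_iff (h : Holds x A) (i : Fin A.n) : markP x i ↔ i ∈ A.X := by
  rw [markP, h.mark]
  by_cases hi : i ∈ A.X <;> simp [hi]

theorem adjP_iff (h : Holds x A) (i j : Fin A.n) : adjP x i j ↔ A.graph.Adj i j := by
  rw [adjP, h.nv_eq, h.adj]
  by_cases hi : A.graph.Adj i j <;> simp [hi]

theorem forall_iff (h : Holds x A) {P : ℕ → Prop} : (∀ i < nv x, P i) ↔ ∀ i : Fin A.n, P i := by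
  rw [h.nv_eq, Fin.forall_iff]

theorem exists_iff (h : Holds x A) {P : ℕ → Prop} : (∃ i < nv x, P i) ↔ ∃ i : Fin A.n, P i := by
  rw [h.nv_eq, Fin.exists_iff]
  simp only [exists_prop]

theorem count_eq (h : Holds x A) {P : ℕ → Prop} {Q : Fin A.n → Prop}
    {hQ : DecidablePred Q} (hPQ : ∀ i : Fin A.n, P i ↔ Q i) :
    countBelow (nv x) P = (Finset.univ.filter Q).card := by
  rw [h.nv_eq]
  exact countBelow_eq_card hPQ

theorem twinP_iff (h : Holds x A) (u v : Fin A.n) : twinP x u v ↔ A.graph.FalseTwins u v := by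
  rw [twinP, h.forall_iff, FalseTwins, Set.ext_iff]
  simp only [mem_neighborSet, h.adjP_iff]

theorem tripleP_iff (h : Holds x A) (u : Fin A.n) : tripleP x u ↔ ∃ v w, u ≠ v ∧ u ≠ w ∧ v ≠ w ∧
    A.graph.FalseTwins u v ∧ A.graph.FalseTwins u w := by
  rw [tripleP, h.exists_iff]
  simp only [h.exists_iff, h.twinP_iff, ne_eq, Fin.val_inj, and_assoc]

/-- The part of the vertex `v`. -/
noncomputable def part (A : MarkedInstance) (v : Fin A.n) : Finset (Fin A.n) :=
  Finset.univ.filter fun u => u ∉ A.X ∧ ¬A.graph.Adj v u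

theorem partP_iff (h : Holds x A) (v u : Fin A.n) : partP x v u ↔ u ∈ part A v := by
  rw [partP, h.markP_iff, h.adjP_iff]
  simp [part]

theorem part_mem {v : Fin A.n} (hv : v ∉ A.X) : part A v ∈ A.graph.coClusterParts A.X :=
  mem_coClusterParts.mpr ⟨v, hv, fun u => by simp [part]⟩

theorem self_mem_part {v : Fin A.n} (hv : v ∉ A.X) : v ∈ part A v := by
  simp [part, hv]

theorem sameP_iff (h : Holds x A) (a u : Fin A.n) : sameP x a u ↔
    (A.X.filter fun z => A.graph.Adj u z) = A.X.filter fun z => A.graph.Adj a z := by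
  rw [sameP, h.forall_iff]
  simp only [h.markP_iff, h.adjP_iff, Finset.ext_iff, Finset.mem_filter]
  exact forall_congr' fun z => by tauto

theorem typeCount_eq (h : Holds x A) (v a : Fin A.n) : typeCount x v a =
    (A.graph.signature A.X (part A v)).count (A.X.filter fun z => A.graph.Adj a z) := by
  rw [typeCount, h.count_eq (hQ := inferInstance) (Q := fun u => u ∈ part A v ∧
      (A.X.filter fun z => A.graph.Adj u z) = A.X.filter fun z => A.graph.Adj a z)
    (fun u => and_congr (h.partP_iff v u) (h.sameP_iff a u)), signature, Multiset.count_map,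
    ← Finset.filter_val, Finset.card_val]
  congr 1
  ext u
  simp [eq_comm]

/-- It is enough to compare multiplicities of neighbourhoods of actual vertices; all other subsets
of `X` have multiplicity zero in both signatures. -/
theorem signatureP_iff (h : Holds x A) (v w : Fin A.n) : signatureP x v w ↔
    A.graph.signature A.X (part A v) = A.graph.signature A.X (part A w) := by
  rw [signatureP, h.forall_iff]
  simp only [h.typeCount_eq]
  refine ⟨fun h1 => ?_, fun h1 a => by rw [h1]⟩
  ext P
  by_cases hP : ∃ a : Fin A.n, (A.X.filter fun z => A.graph.Adj a z) = P
  · obtain ⟨a, rfl⟩ := hP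
    exact h1 a
  · have h0 : ∀ J, (A.graph.signature A.X J).count P = 0 := by
      intro J
      rw [Multiset.count_eq_zero, signature, Multiset.mem_map]
      rintro ⟨a, -, ha⟩
      exact hP ⟨a, ha⟩
    rw [h0, h0]

theorem firstP_iff (h : Holds x A) (w : Fin A.n) :
    firstP x w ↔ w ∉ A.X ∧ ∀ u ∈ part A w, w ≤ u := by
  rw [firstP, h.forall_iff, h.markP_iff]
  simp only [h.partP_iff, Fin.val_fin_le]

/-- Each part is represented by its least vertex. -/
theorem classCount_eq (h : Holds x A) (hX : A.graph.IsCoClusterModulator A.X) (v : Fin A.n) :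
    classCount x v = (A.graph.identicalParts A.X (part A v)).card := by
  rw [classCount, h.count_eq (Q := fun w => (w ∉ A.X ∧ ∀ u ∈ part A w, w ≤ u) ∧
    A.graph.signature A.X (part A w) = A.graph.signature A.X (part A v))
    (fun w => and_congr (h.firstP_iff w) (h.signatureP_iff w v))]
  refine Finset.card_bij (fun w _ => part A w) ?_ ?_ ?_
  · intro w hw
    obtain ⟨-, ⟨h1, -⟩, h2⟩ := Finset.mem_filter.mp hw
    exact mem_identicalParts.mpr ⟨part_mem h1, h2⟩
  · intro w hw z hz hwz
    obtain ⟨-, ⟨h1, h2⟩, -⟩ := Finset.mem_filter.mp hw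
    obtain ⟨-, ⟨h3, h4⟩, -⟩ := Finset.mem_filter.mp hz
    exact le_antisymm (h2 z (hwz ▸ self_mem_part h3)) (h4 w (hwz ▸ self_mem_part h1))
  · intro J hJ
    obtain ⟨hJp, hJs⟩ := mem_identicalParts.mp hJ
    have hne := part_nonempty hJp
    have hmin := Finset.min'_mem J hne
    have hmX := not_mem_of_mem_part hJp hmin
    have hpart : part A (J.min' hne) = J :=
      part_eq_of_mem hX (part_mem hmX) hJp (self_mem_part hmX) hmin
    refine ⟨J.min' hne, ?_, hpart⟩
    rw [Finset.mem_filter, hpart]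
    exact ⟨Finset.mem_univ _, ⟨hmX, fun u hu => Finset.min'_le J u hu⟩, hJs⟩

theorem markCount_eq (h : Holds x A) : markCount x = A.X.card := by
  rw [markCount, h.count_eq (hQ := inferInstance) (Q := fun i => i ∈ A.X) h.markP_iff]
  congr 1
  ext
  simp

theorem bigP_iff (h : Holds x A) (hX : A.graph.IsCoClusterModulator A.X) (v : Fin A.n) :
    bigP x v ↔ v ∉ A.X ∧
      2 ^ (A.X.card + 2) + A.X.card + 2 ≤ (A.graph.identicalParts A.X (part A v)).card := by
  have h1 : A.X.card ≤ A.n := by simpa using Finset.card_le_univ A.X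
  have h2 := h.size
  rw [bigP, h.markP_iff, h.markCount_eq, h.classCount_eq hX, min_eq_left]
  -- What remains is that the exponent `|X| + 2` fits into the memory size, so its truncation in
  -- `bigP` has no effect.
  have := v.pos
  nlinarith

theorem twinCount_eq (h : Holds x A) (v : Fin A.n) :
    twinCount x v = A.graph.falseTwinPairs (part A v) := by
  rw [falseTwinPairs_eq_sum (fun a b : Fin A.n => a < b) (fun _ _ h => h.not_gt)
    (fun _ _ h => lt_or_gt_of_ne h), twinCount, Finset.sum_range]
  have hn := h.nv_eq
  refine Fintype.sum_equiv (finCongr hn) _ _ fun a => ?_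
  refine h.count_eq fun b => ?_
  rw [← h.twinP_iff, ← h.partP_iff, ← h.partP_iff]
  rfl

end Holds

end MetricDimension

namespace MetricDimension

open Classical SimpleGraph RAM

/-! ### Correctness of a reduction step -/

namespace Holds

variable {x : Mach} {A : MarkedInstance}

theorem congr {y : Mach} (h : Holds x A) (hs : 3 + A.n + A.n * A.n ≤ y.size)
    (hr : ∀ i < 3 + A.n + A.n * A.n, y.read i = x.read i) : Holds y A where
  size := hs
  n := by rw [hr 0 (by omega), h.n]
  pos := by rw [hr 1 (by omega), h.pos]
  neg := by rw [hr 2 (by omega), h.neg]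
  mark i := by rw [hr _ (by omega), h.mark]
  adj i j := by
    have := pair_lt i.2 j.2
    rw [hr _ (by omega), h.adj]

theorem keepCount_eq (h : Holds x A) {D : Finset (Fin A.n)}
    (hD : ∀ u : Fin A.n, deleteP x u ↔ u ∈ D) : keepCount x = Dᶜ.card := by
  rw [keepCount, h.count_eq (hQ := inferInstance) (Q := fun u => u ∉ D) fun u => not_congr (hD u)]
  congr 1
  ext
  simp

/-- Up to position `j` there are at most `p` kept vertices exactly when `j` lies before the kept
vertex number `p`, counted from zero. The number of such `j` is that vertex. -/
theorem kept_eq (h : Holds x A) {D : Finset (Fin A.n)}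
    (hD : ∀ u : Fin A.n, deleteP x u ↔ u ∈ D) (p : Fin Dᶜ.card) :
    kept x p = Dᶜ.orderEmbOfFin rfl p := by
  set φ := Dᶜ.orderEmbOfFin rfl with hφ
  have hle : (φ p : ℕ) ≤ nv x := by rw [h.nv_eq]; exact (φ p).2.le
  have hmem : ∀ q, φ q ∉ D := fun q => Finset.mem_compl.mp (Finset.orderEmbOfFin_mem _ rfl q)
  rw [kept, countBelow_congr (Q := fun j => j < φ p), countBelow_lt hle]
  intro j hj
  rw [h.nv_eq] at hj
  rw [h.count_eq (hQ := inferInstance) (Q := fun u => u ≤ ⟨j, hj⟩ ∧ u ∉ D)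
    fun u => and_congr Iff.rfl (not_congr (hD u))]
  constructor
  · intro hcard
    by_contra hlt
    have h1 : (Finset.Iic p).card ≤
        (Finset.univ.filter fun u : Fin A.n => u ≤ ⟨j, hj⟩ ∧ u ∉ D).card := by
      refine Finset.card_le_card_of_injOn φ (fun q hq => ?_) φ.injective.injOn
      have h2 : φ q ≤ φ p := φ.monotone (Finset.mem_Iic.mp hq)
      rw [Finset.mem_coe, Finset.mem_filter]
      refine ⟨Finset.mem_univ _, ?_, hmem q⟩
      exact h2.trans (Fin.le_def.mpr (not_lt.mp hlt))
    rw [Fin.card_Iic] at h1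
    omega
  · intro hlt
    have h1 : (Finset.univ.filter fun u : Fin A.n => u ≤ ⟨j, hj⟩ ∧ u ∉ D) ⊆
        (Finset.Iio p).image φ := by
      intro u hu
      obtain ⟨-, h2, h3⟩ := Finset.mem_filter.mp hu
      have : u ∈ Set.range φ := by
        rw [hφ, Finset.range_orderEmbOfFin]
        simpa using h3
      obtain ⟨q, rfl⟩ := this
      refine Finset.mem_image_of_mem _ (Finset.mem_Iio.mpr ?_)
      rw [← φ.lt_iff_lt]
      exact lt_of_le_of_lt h2 (Fin.lt_def.mpr hlt)
    have h2 := (Finset.card_le_card h1).trans Finset.card_image_le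
    rwa [Fin.card_Iio] at h2

theorem step_delete (h : Holds x A) {D : Finset (Fin A.n)}
    (hD : ∀ u : Fin A.n, deleteP x u ↔ u ∈ D) (hne : D.Nonempty) :
    Holds (stepMach x) (A.delete D (A.k - decrease x)) := by
  have hk := h.keepCount_eq hD
  set m := Dᶜ.card with hm
  have hmn : m ≤ A.n := by simpa using Finset.card_le_univ Dᶜ
  have hex : ∃ u < nv x, deleteP x u := by
    obtain ⟨u, hu⟩ := hne
    exact h.exists_iff.mpr ⟨u, (hD u).mpr hu⟩
  have hmm := Nat.mul_le_mul hmn hmn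
  have hs : 3 + m + m * m ≤ x.size := by
    have := h.size
    omega
  have hr : ∀ i < 3 + m + m * m, (stepMach x).read i = stepCell x i := fun i hi =>
    if_pos (show i < x.size by omega)
  refine ⟨hs, ?_, ?_, ?_, fun p => ?_, fun p q => ?_⟩
  · rw [hr 0 (by omega), stepCell, if_pos hex, if_pos rfl, hk]
    rfl
  · rw [hr 1 (by omega), stepCell, if_pos hex, if_neg one_ne_zero, if_pos rfl, h.pos, h.neg]
    -- At most one of the two stored parts of `k` is nonzero, so truncated subtraction gives the
    -- parts of the new value.
    change _ = (A.k - decrease x).toNat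
    omega
  · rw [hr 2 (by omega), stepCell, if_pos hex, if_neg two_ne_zero, if_neg (by omega), if_pos rfl,
      h.pos, h.neg]
    change _ = (-(A.k - decrease x)).toNat
    omega
  · have hp : (p : ℕ) < m := p.2
    rw [hr _ (by omega), stepCell, if_pos hex, if_neg (by omega), if_neg (by omega),
      if_neg (by omega), if_pos (by omega), Nat.add_sub_cancel_left, h.kept_eq hD p, h.markP_iff]
    have hiff := MarkedInstance.mem_delete_X (A := A) (k := A.k - decrease x) (p := p)
    by_cases hpX : Dᶜ.orderEmbOfFin rfl p ∈ A.X
    · rw [if_pos hpX, if_pos (hiff.mpr hpX)]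
    · rw [if_neg hpX, if_neg (mt hiff.mp hpX)]
  · have hp : (p : ℕ) < m := p.2
    have hq : (q : ℕ) < m := q.2
    have hlt := pair_lt hp hq
    change (stepMach x).read (3 + m + (m * p + q)) = _
    rw [hr _ (by omega), stepCell, if_pos hex, if_neg (by omega), if_neg (by omega),
      if_neg (by omega), if_neg (by omega), hk, Nat.add_sub_cancel_left, min_eq_left (by omega),
      Nat.mul_add_div (by omega), Nat.div_eq_of_lt hq, add_zero, Nat.mul_add_mod,
      Nat.mod_eq_of_lt hq, h.kept_eq hD p, h.kept_eq hD q, h.adjP_iff]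
    rfl

theorem step (h : Holds x A) (hX : A.graph.IsCoClusterModulator A.X) :
    (Irreducible A ∧ Holds (stepMach x) A) ∨ ∃ B, Reduces A B ∧ Holds (stepMach x) B := by
  by_cases ht : ∃ u < nv x, tripleP x u
  · obtain ⟨h1, h2⟩ := leastBelow_spec ht
    change tripleVertex x < nv x at h1
    change tripleP x (tripleVertex x) at h2
    obtain ⟨u, hu⟩ : ∃ u : Fin A.n, (u : ℕ) = tripleVertex x := ⟨⟨_, h.nv_eq ▸ h1⟩, rfl⟩
    rw [← hu, h.tripleP_iff] at h2
    obtain ⟨v, w, huv, huw, hvw, h3, h4⟩ := h2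
    have hst := h.step_delete (D := {u}) (fun z => by
      rw [deleteP, if_pos h1, ← hu, Fin.val_inj, Finset.mem_singleton]) (by simp)
    rw [decrease, if_pos h1] at hst
    exact Or.inr ⟨_, Or.inl ⟨u, v, w, huv, huw, hvw, h3, h4, A.deletesTo_delete _ _, rfl⟩, hst⟩
  have h3 : ¬A.graph.HasThreeFalseTwins := fun ⟨u, v, w, h1, h2, h3, h4, h5⟩ =>
    ht (h.exists_iff.mpr ⟨u, (h.tripleP_iff u).mpr ⟨v, w, h1, h2, h3, h4, h5⟩⟩)
  have ht' : ¬tripleVertex x < nv x := (leastBelow_eq ht).ge.not_gt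
  by_cases hb : ∃ v < nv x, bigP x v
  · obtain ⟨h1, h2⟩ := leastBelow_spec hb
    change bigVertex x < nv x at h1
    change bigP x (bigVertex x) at h2
    obtain ⟨v, hv⟩ : ∃ v : Fin A.n, (v : ℕ) = bigVertex x := ⟨⟨_, h.nv_eq ▸ h1⟩, rfl⟩
    rw [← hv, h.bigP_iff hX] at h2
    have hst := h.step_delete (D := part A v) (fun z => by
      rw [deleteP, if_neg ht', ← hv, h.partP_iff]
      exact and_iff_right (hv ▸ h1)) ⟨v, self_mem_part h2.1⟩
    rw [decrease, if_neg ht', ← hv, h.twinCount_eq] at hst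
    refine Or.inr ⟨_, Or.inr ⟨h3, _, part_mem h2.1, h2.2, A.deletesTo_delete _ _, ?_⟩, hst⟩
    change A.k - _ = _
    push_cast
    rfl
  · refine Or.inl ⟨irreducible_iff.mpr ⟨h3, fun I hI => ?_⟩, ?_⟩
    · by_contra hcon
      obtain ⟨v, hv⟩ := part_nonempty hI
      have hvX := not_mem_of_mem_part hI hv
      refine hb (h.exists_iff.mpr ⟨v, (h.bigP_iff hX v).mpr ⟨hvX, ?_⟩⟩)
      rw [part_eq_of_mem hX (part_mem hvX) hI (self_mem_part hvX) hv]
      exact not_lt.mp hcon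
    · have hb' : ¬bigVertex x < nv x := (leastBelow_eq hb).ge.not_gt
      have hnone : ¬∃ u < nv x, deleteP x u := by
        rintro ⟨u, -, hu⟩
        rw [deleteP, if_neg ht'] at hu
        exact hb' hu.1
      refine h.congr h.size fun i hi => ?_
      have := h.size
      rw [Mach.read, if_pos (show i < (stepMach x).size from hi.trans_le this)]
      exact if_neg hnone

/-- Every reduction deletes a vertex, and a step on an irreducible instance changes nothing. More
rounds than there are vertices therefore suffice. -/
theorem iterate_step (h : Holds x A) (hX : A.graph.IsCoClusterModulator A.X) (j : ℕ) :
    ∃ B, Relation.ReflTransGen Reduces A B ∧ Holds (stepMach^[j] x) B ∧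
      (Irreducible B ∨ B.n + j ≤ A.n) := by
  induction j with
  | zero => exact ⟨A, .refl, h, Or.inr le_rfl⟩
  | succ j ih =>
    obtain ⟨B, h1, h2, h3⟩ := ih
    rw [Function.iterate_succ_apply']
    rcases h2.step (reduces_star h1 hX).2.1 with ⟨h4, h5⟩ | ⟨C, h4, h5⟩
    · exact ⟨B, h1, h5, Or.inl h4⟩
    · refine ⟨C, h1.tail h4, h5, ?_⟩
      rcases h3 with h3 | h3
      · exact absurd h4 (h3 C)
      · have := h4.n_lt
        exact Or.inr (by omega)

theorem exists_irreducible (h : Holds x A) (hX : A.graph.IsCoClusterModulator A.X) :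
    ∃ B, Relation.ReflTransGen Reduces A B ∧ Irreducible B ∧ Holds (stepMach^[x.size] x) B := by
  obtain ⟨B, h1, h2, h3⟩ := h.iterate_step hX x.size
  refine ⟨B, h1, h3.resolve_right fun h4 => ?_, h2⟩
  have := h.size
  omega

end Holds

/-! ### The kernelization algorithm -/

/-- Replace `k` by the closest integer between `-1` and the number of vertices. -/
noncomputable def clampMach (x : Mach) : Mach :=
  ⟨x.size, fun i => if i = 1 then min (x.read 1) (nv x) else if i = 2 then min (x.read 2) 1
    else x.read i⟩

theorem MF_clampMach : MF clampMach :=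
  MF.map (f := fun x i => if i = 1 then min (x.read 1) (nv x) else if i = 2 then min (x.read 2) 1
    else x.read i) (PF.congr (PF.ite (α := Mach × ℕ) (PFP.eq PF.snd (PF.const 1))
      ((PF.read (PF.const 1)).min PF_nv) (PF.ite (PFP.eq PF.snd (PF.const 2))
        ((PF.read (PF.const 2)).min (PF.const 1)) (PF.read PF.snd)))
      fun x => by split_ifs <;> rfl)

theorem Holds.clamp {x : Mach} {A : MarkedInstance} (h : Holds x A) :
    Holds (clampMach x) A.clamp := by
  have hs := h.size
  have hr : ∀ i < 3 + A.n + A.n * A.n, (clampMach x).read i = if i = 1 then min (x.read 1) (nv x)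
      else if i = 2 then min (x.read 2) 1 else x.read i := fun i hi =>
    if_pos (show i < x.size by omega)
  refine ⟨hs, ?_, ?_, ?_, fun i => ?_, fun i j => ?_⟩
  · rw [hr 0 (by omega)]
    exact h.n
  · rw [hr 1 (by omega), if_pos rfl, h.pos, h.nv_eq]
    change _ = (max (-1) (min A.k A.n)).toNat
    omega
  · rw [hr 2 (by omega), if_neg (by omega), if_pos rfl, h.neg]
    change _ = (-max (-1) (min A.k A.n)).toNat
    omega
  · have hi : (i : ℕ) < A.n := i.2
    rw [hr _ (by omega), if_neg (by omega), if_neg (by omega)]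
    exact h.mark i
  · have hlt := pair_lt (n := A.n) i.2 j.2
    change (clampMach x).read (3 + A.n + (A.n * i + j)) = _
    rw [hr _ (by omega), if_neg (by omega), if_neg (by omega)]
    exact h.adj i j

theorem MF_iterate_stepMach : MF fun x => stepMach^[x.size] x :=
  MF_stepMach.iterate fun _ => rfl

theorem size_iterate {F : Mach → Mach} (hF : ∀ x, (F x).size = x.size) (x : Mach) (j : ℕ) :
    (F^[j] x).size = x.size := by
  induction j with
  | zero => rfl
  | succ j ih => rw [Function.iterate_succ_apply', hF, ih]

theorem PF_markedSize : PF fun y : Mach => 3 + nv y + nv y * nv y :=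
  ((PF.const 3).add PF_nv).add (PF.mul (α := Mach) PF_nv (fun _ => nv_le _) PF_nv)

end MetricDimension

theorem PolyBounded.exists_monotone {T : ℕ → ℕ} (hT : PolyBounded T) :
    ∃ K c, ∀ N L, N ≤ L → T N ≤ K * (L + 2) ^ c := by
  obtain ⟨K, c, h⟩ := hT
  refine ⟨K, c, fun N L hNL => (h N).trans ?_⟩
  gcongr

/-- A polynomial bound in the form used for running times. -/
theorem PolyBounded.exists_le_mul_pow {T : ℕ → ℕ} (hT : PolyBounded T) :
    ∃ c, ∀ L, 0 < L → T L ≤ c * L ^ c := by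
  obtain ⟨K, c, h⟩ := hT
  refine ⟨K * 3 ^ c + c, fun L hL => (h L).trans ?_⟩
  calc K * (L + 2) ^ c ≤ K * (3 * L) ^ c := by gcongr; omega
    _ = K * 3 ^ c * L ^ c := by rw [mul_pow]; ring
    _ ≤ (K * 3 ^ c + c) * L ^ (K * 3 ^ c + c) := by
      gcongr
      · omega
      · omega

namespace MetricDimension

open RAM SimpleGraph

/-- Set up the memory so that its size is that of the encoding of a marked instance. -/
theorem exists_setup : ∃ (p : Prog) (T : ℕ → ℕ), PolyBounded T ∧ ∀ (w : List ℕ) (n : ℕ),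
    w.getD 0 0 = n → ∃ s t, Run p (State.init w) s t ∧ t ≤ T (3 + n + n * n) ∧
      Models s ⟨3 + n + n * n, fun i => w.getD i 0⟩ := by
  obtain ⟨p, T, hT, hp⟩ := PF_markedSize.resize
  obtain ⟨K, c, hK⟩ := hT.exists_monotone
  -- A provisional size above `n` makes cell `0` readable and ensures that `nv` is not truncated
  -- while the final size is computed.
  refine ⟨.seq (.assign 0 (.add (.mem (.lit 0)) (.lit 4))) p,
    fun L => 5 + K * (L + 1 + 2) ^ c, ?_, fun w n hn => ?_⟩
  · refine (PolyBounded.const 5).add ((PolyBounded.const K).mul ?_)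
    refine PolyBounded.mono (t := fun N => 2 ^ c * (N + 2) ^ c) ⟨2 ^ c, c, fun _ => le_rfl⟩ fun N => ?_
    rw [← mul_pow]
    gcongr
    omega
  · have hn' : w[0]?.getD 0 = n := by simpa using hn
    set s₁ : State := ⟨Function.update (fun _ => 0) 0 (n + 4), fun i => w.getD i 0⟩ with hs₁
    obtain ⟨s₂, t₂, h1, h2, h3, h4⟩ := hp ⟨n + 4, fun i => w.getD i 0⟩ s₁
      ⟨by simp [hs₁], fun i _ => rfl⟩
    have hnv : nv ⟨n + 4, fun i => w.getD i 0⟩ = n := by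
      simp [nv, Mach.read, hn']
    rw [hnv] at h4
    refine ⟨s₂, _, (Run.assign_eq (t := 5) _ _ _ ?_ rfl).seq h1, ?_, h4, fun i _ => by rw [h3]⟩
    · simp [hs₁, Expr.eval, State.init, hn']
    · refine Nat.add_le_add_left (h2.trans (hK _ _ ?_)) _
      change n + 4 ≤ _
      omega

theorem exists_kernelization : ∃ (p : Prog) (c : ℕ), ∀ A : MarkedInstance,
    A.graph.IsCoClusterModulator A.X → ∃ B : MarkedInstance,
      Relation.ReflTransGen Reduces A B ∧ Irreducible B ∧
      OutputsWithin p A.encode B.clamp.encode (c * A.encode.length ^ c) := by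
  obtain ⟨p, T, hT, hp⟩ := exists_setup
  obtain ⟨q, U, hU, hq⟩ := MF_clampMach.comp MF_iterate_stepMach
    fun x => size_iterate (F := stepMach) (fun _ => rfl) x _
  obtain ⟨c, hc⟩ := (hT.add hU).exists_le_mul_pow
  refine ⟨.seq p (q 1), c, fun A hX => ?_⟩
  obtain ⟨s₁, t₁, h1, h2, h3⟩ := hp A.encode A.n rfl
  rw [← A.length_encode] at h2 h3
  have hH : Holds ⟨A.encode.length, fun i => A.encode.getD i 0⟩ A :=
    .of_encode le_rfl fun i _ => rfl
  obtain ⟨s₂, t₂, h4, h5, h6, -⟩ := hq _ s₁ 1 one_pos h3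
  obtain ⟨B, h7, h8, h9⟩ := hH.exists_irreducible hX
  refine ⟨B, h7, h8, s₂, _, h1.seq h4, (add_le_add h2 h5).trans (hc _ ?_), fun i hi => ?_⟩
  · rw [A.length_encode]; omega
  · have h10 := h9.clamp
    rw [h6.2 i, h10.mem_eq hi]
    rw [MarkedInstance.length_encode] at hi
    exact hi.trans_le h10.size

end MetricDimension

namespace MetricDimension

open Classical SimpleGraph RAM

/-! ### Computing a modulator -/

/-- The instance `A` with the marked set `X`. -/
def MarkedInstance.mark (A : MarkedInstance) (X : Finset (Fin A.n)) : MarkedInstance :=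
  { A with X := X }

/-- Insert the characteristic vector of the empty set into the encoding of an instance. -/
noncomputable def unmarkMach (x : Mach) : Mach :=
  ⟨x.size, fun i => if i < 3 then x.read i else if i < 3 + nv x then 0 else x.read (i - nv x)⟩

theorem MF_unmarkMach : MF unmarkMach :=
  MF.map (f := fun x i => if i < 3 then x.read i else if i < 3 + nv x then 0
    else x.read (i - nv x)) (PF.congr (PF.ite (α := Mach × ℕ) (PFP.lt PF.snd (PF.const 3))
      (PF.read PF.snd) (PF.ite (PFP.lt PF.snd ((PF.const 3).add PF_nv)) (PF.const 0)
        (PF.read (PF.snd.sub PF_nv)))) fun x => by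
          rw [show Ctx.mach x = x.1 from rfl]; split_ifs <;> rfl)

theorem holds_unmarkMach (A : Instance) : Holds
    (unmarkMach ⟨3 + A.n + A.n * A.n, fun i => A.encode.getD i 0⟩) { A with X := ∅ } := by
  set x : Mach := ⟨3 + A.n + A.n * A.n, fun i => A.encode.getD i 0⟩ with hx
  have hnv : nv x = A.n := by
    have : x.read 0 = A.n := if_pos (show 0 < 3 + A.n + A.n * A.n by omega)
    rw [nv, this]
    exact min_eq_left (by simp only [hx]; omega)
  have hr : ∀ i < 3 + A.n + A.n * A.n, (unmarkMach x).read i =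
      if i < 3 then x.read i else if i < 3 + A.n then 0 else x.read (i - A.n) := fun i hi => by
    rw [← hnv]
    exact if_pos hi
  have hrx : ∀ i < 3 + A.n + A.n * A.n, x.read i = A.encode.getD i 0 := fun i hi => if_pos hi
  refine ⟨le_rfl, ?_, ?_, ?_, fun i => ?_, fun i j => ?_⟩
  · rw [hr 0 (by omega), if_pos (by omega), hrx _ (by omega)]; rfl
  · rw [hr 1 (by omega), if_pos (by omega), hrx _ (by omega)]; rfl
  · rw [hr 2 (by omega), if_pos (by omega), hrx _ (by omega)]; rfl
  · have hi : (i : ℕ) < A.n := i.2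
    rw [hr _ (by omega), if_neg (by omega), if_pos (by omega)]
    simp
  · have hlt := pair_lt (n := A.n) i.2 j.2
    change (unmarkMach x).read (3 + A.n + (A.n * i + j)) = _
    rw [hr _ (by omega), if_neg (by omega), if_neg (by omega), hrx _ (by omega), ←
      A.getD_encode_adj i j]
    congr 1
    omega

section Greedy

variable (x : Mach)

/-- The vertices `a`, `b`, `c` show that the unmarked vertices do not induce a co-cluster graph. -/
def conflictP (a b c : ℕ) : Prop :=
  ((¬markP x a ∧ ¬markP x b) ∧ ¬markP x c) ∧ (¬adjP x a b ∧ ¬adjP x b c) ∧ adjP x a c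

noncomputable def conflict₁ : ℕ :=
  leastBelow (nv x) fun a => ∃ b < nv x, ∃ c < nv x, conflictP x a b c

noncomputable def conflict₂ : ℕ :=
  leastBelow (nv x) fun b => ∃ c < nv x, conflictP x (conflict₁ x) b c

noncomputable def conflict₃ : ℕ :=
  leastBelow (nv x) fun c => conflictP x (conflict₁ x) (conflict₂ x) c

/-- Mark the vertices of the first conflict. -/
noncomputable def markMach : Mach :=
  ⟨x.size, fun i => if conflict₁ x < nv x ∧
    ((i = 3 + conflict₁ x ∨ i = 3 + conflict₂ x) ∨ i = 3 + conflict₃ x) then 1 else x.read i⟩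

end Greedy

section EvaluateGreedy

variable {α : Type} [Ctx α] {a b c : α → ℕ}

theorem PFP_conflictP (ha : PF a) (hb : PF b) (hc : PF c) :
    PFP fun y => conflictP (Ctx.mach y) (a y) (b y) (c y) :=
  (((PFP_markP ha).not.and (PFP_markP hb).not).and (PFP_markP hc).not).and
    (((PFP_adjP ha hb).not.and (PFP_adjP hb hc).not).and (PFP_adjP ha hc))

theorem PF_conflict₁ : PF fun y : α => conflict₁ (Ctx.mach y) :=
  PF_least (P := fun y a => ∃ b < nv (Ctx.mach y), ∃ c < nv (Ctx.mach y),
      conflictP (Ctx.mach y) a b c)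
    (PFP_ex (α := α × ℕ) (P := fun y b => ∃ c < nv (Ctx.mach y), conflictP (Ctx.mach y) y.2 b c)
      (PFP_ex (α := (α × ℕ) × ℕ) (P := fun y c => conflictP (Ctx.mach y) y.1.2 y.2 c)
        (PFP_conflictP PF.snd.fst.fst PF.snd.fst PF.snd)))

theorem PF_conflict₂ : PF fun y : α => conflict₂ (Ctx.mach y) :=
  PF_least (P := fun y b => ∃ c < nv (Ctx.mach y),
      conflictP (Ctx.mach y) (conflict₁ (Ctx.mach y)) b c)
    (PFP_ex (α := α × ℕ) (P := fun y c => conflictP (Ctx.mach y) (conflict₁ (Ctx.mach y)) y.2 c)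
      (PFP_conflictP PF_conflict₁ PF.snd.fst PF.snd))

theorem PF_conflict₃ : PF fun y : α => conflict₃ (Ctx.mach y) :=
  PF_least (P := fun y c => conflictP (Ctx.mach y) (conflict₁ (Ctx.mach y))
      (conflict₂ (Ctx.mach y)) c)
    (PFP_conflictP PF_conflict₁ PF_conflict₂ PF.snd)

theorem MF_markMach : MF markMach :=
  MF.map (f := fun x i => if conflict₁ x < nv x ∧
    ((i = 3 + conflict₁ x ∨ i = 3 + conflict₂ x) ∨ i = 3 + conflict₃ x) then 1 else x.read i)
    (PF.congr (PF.ite (α := Mach × ℕ) ((PFP.lt PF_conflict₁ PF_nv).and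
      (((PFP.eq PF.snd ((PF.const 3).add PF_conflict₁)).or
        (PFP.eq PF.snd ((PF.const 3).add PF_conflict₂))).or
        (PFP.eq PF.snd ((PF.const 3).add PF_conflict₃)))) (PF.const 1) (PF.read PF.snd))
      fun x => by rw [show Ctx.mach x = x.1 from rfl]; split_ifs <;> rfl)

end EvaluateGreedy

theorem Holds.conflictP_iff {x : Mach} {A : MarkedInstance} (h : Holds x A) (a b c : Fin A.n) :
    conflictP x a b c ↔ ((a ∉ A.X ∧ b ∉ A.X) ∧ c ∉ A.X) ∧
      (¬A.graph.Adj a b ∧ ¬A.graph.Adj b c) ∧ A.graph.Adj a c := by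
  simp only [conflictP, h.markP_iff, h.adjP_iff]

theorem Holds.mark_step {x : Mach} {A : MarkedInstance} (h : Holds x A) :
    (A.graph.IsCoClusterModulator A.X ∧ Holds (markMach x) A) ∨
    ∃ a b c : Fin A.n, (((a ∉ A.X ∧ b ∉ A.X) ∧ c ∉ A.X) ∧
      (¬A.graph.Adj a b ∧ ¬A.graph.Adj b c) ∧ A.graph.Adj a c) ∧
      Holds (markMach x) (A.mark (insert a (insert b (insert c A.X)))) := by
  have hs := h.size
  have hr : ∀ i < 3 + A.n + A.n * A.n, (markMach x).read i = if conflict₁ x < nv x ∧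
      ((i = 3 + conflict₁ x ∨ i = 3 + conflict₂ x) ∨ i = 3 + conflict₃ x) then 1 else x.read i :=
    fun i hi => if_pos (show i < x.size by omega)
  by_cases hc : ∃ a < nv x, ∃ b < nv x, ∃ c < nv x, conflictP x a b c
  · obtain ⟨h1, h2⟩ := leastBelow_spec hc
    change conflict₁ x < nv x at h1
    obtain ⟨h3, h4⟩ := leastBelow_spec h2
    change conflict₂ x < nv x at h3
    obtain ⟨h5, h6⟩ := leastBelow_spec h4
    change conflict₃ x < nv x at h5
    obtain ⟨a, ha⟩ : ∃ a : Fin A.n, (a : ℕ) = conflict₁ x := ⟨⟨_, h.nv_eq ▸ h1⟩, rfl⟩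
    obtain ⟨b, hb⟩ : ∃ b : Fin A.n, (b : ℕ) = conflict₂ x := ⟨⟨_, h.nv_eq ▸ h3⟩, rfl⟩
    obtain ⟨c, hc⟩ : ∃ c : Fin A.n, (c : ℕ) = conflict₃ x := ⟨⟨_, h.nv_eq ▸ h5⟩, rfl⟩
    change conflictP x (conflict₁ x) (conflict₂ x) (conflict₃ x) at h6
    rw [← ha, ← hb, ← hc, h.conflictP_iff] at h6
    rw [← ha, ← hb, ← hc] at hr
    have hlt : (a : ℕ) < nv x := ha ▸ h1
    have h7 : (a : ℕ) < A.n := a.2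
    have h8 : (b : ℕ) < A.n := b.2
    have h9 : (c : ℕ) < A.n := c.2
    refine Or.inr ⟨a, b, c, h6, hs, ?_, ?_, ?_, fun i => ?_, fun i j => ?_⟩
    · rw [hr _ (by omega), if_neg (by omega), h.n]; rfl
    · rw [hr _ (by omega), if_neg (by omega), h.pos]; rfl
    · rw [hr _ (by omega), if_neg (by omega), h.neg]; rfl
    · have hi : (i : ℕ) < A.n := i.2
      have hmem : i ∈ (A.mark (insert a (insert b (insert c A.X)))).X ↔
          ((i : ℕ) = a ∨ (i : ℕ) = b ∨ (i : ℕ) = c) ∨ i ∈ A.X := by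
        unfold MarkedInstance.mark at i ⊢
        simp only [Finset.mem_insert, Fin.val_inj, or_assoc]
      rw [hr _ (by omega)]
      by_cases hi3 : (i : ℕ) = a ∨ (i : ℕ) = b ∨ (i : ℕ) = c
      · rw [if_pos ⟨hlt, by omega⟩, if_pos (hmem.mpr (Or.inl hi3))]
      · rw [if_neg (by omega)]
        refine (h.mark i).trans ?_
        by_cases hiX : i ∈ A.X
        · exact (if_pos hiX).trans (if_pos (hmem.mpr (Or.inr hiX))).symm
        · exact (if_neg hiX).trans (if_neg fun h => (hmem.mp h).elim hi3 hiX).symm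
    · have hlt := pair_lt (n := A.n) i.2 j.2
      change (markMach x).read (3 + A.n + (A.n * i + j)) = _
      rw [hr _ (by omega), if_neg (by omega)]
      exact h.adj i j
  · have h1 : ¬conflict₁ x < nv x := (leastBelow_eq hc).ge.not_gt
    refine Or.inl ⟨?_, h.congr hs fun i hi => ?_⟩
    · rw [isCoClusterModulator_iff]
      intro a ha b hb c hc' hab hbc hac
      refine hc (h.exists_iff.mpr ⟨a, h.exists_iff.mpr ⟨b, h.exists_iff.mpr ⟨c, ?_⟩⟩⟩)
      exact (h.conflictP_iff a b c).mpr ⟨⟨⟨ha, hb⟩, hc'⟩, ⟨hab, hbc⟩, hac⟩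
    · rw [hr i hi, if_neg fun h2 => h1 h2.1]

/-- Every modulator `Y` meets every obstruction. A round marks at most three vertices, at least one
of them a new vertex of `Y`, so the greedy set stays within three times the size of `Y`. -/
theorem Holds.iterate_mark {x : Mach} {A : MarkedInstance} (h : Holds x A) (hA : A.X = ∅)
    {Y : Finset (Fin A.n)} (hY : A.graph.IsCoClusterModulator Y) (j : ℕ) :
    ∃ X, Holds (markMach^[j] x) (A.mark X) ∧ X.card ≤ 3 * (X ∩ Y).card ∧
      (A.graph.IsCoClusterModulator X ∨ j ≤ X.card) := by
  induction j with
  | zero =>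
    refine ⟨∅, ?_, by simp, Or.inr (Nat.zero_le _)⟩
    rw [← hA]
    exact h
  | succ j ih =>
    obtain ⟨X, h1, h2, h3⟩ := ih
    rw [Function.iterate_succ_apply']
    rcases h1.mark_step with ⟨h4, h5⟩ | ⟨a, b, c, h4, h5⟩
    · exact ⟨X, h5, h2, Or.inl h4⟩
    · change Fin A.n at a b c
      change ((a ∉ X ∧ b ∉ X) ∧ c ∉ X) ∧ (¬A.graph.Adj a b ∧ ¬A.graph.Adj b c) ∧
        A.graph.Adj a c at h4
      obtain ⟨⟨⟨ha, hb⟩, hc⟩, ⟨hab, hbc⟩, hac⟩ := h4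
      refine ⟨insert a (insert b (insert c X)), h5, ?_, ?_⟩
      · have hlt : (X ∩ Y).card + 1 ≤ (insert a (insert b (insert c X)) ∩ Y).card := by
          refine Nat.succ_le_of_lt (Finset.card_lt_card ?_)
          have hsub : X ∩ Y ⊆ insert a (insert b (insert c X)) ∩ Y :=
            Finset.inter_subset_inter_right fun z hz => by simp [hz]
          refine (Finset.ssubset_iff_of_subset hsub).mpr ?_
          -- If `a`, `b`, `c` all avoided `Y`, they would form an obstruction outside `Y`.
          obtain ⟨z, hz, hzX, hzY⟩ : ∃ z ∈ insert a (insert b (insert c X)), z ∉ X ∧ z ∈ Y := by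
            by_contra hcon
            push Not at hcon
            exact (isCoClusterModulator_iff.mp hY) a (hcon a (by simp) ha) b (hcon b (by simp) hb) c
              (hcon c (by simp) hc) hab hbc hac
          exact ⟨z, Finset.mem_inter.mpr ⟨hz, hzY⟩, fun h => hzX (Finset.mem_inter.mp h).1⟩
        have h6 := Finset.card_insert_le a (insert b (insert c X))
        have h7 := Finset.card_insert_le b (insert c X)
        have h8 := Finset.card_insert_le c X
        omega
      · rcases h3 with h3 | h3
        · exact absurd hac ((isCoClusterModulator_iff.mp h3) a ha b hb c hc hab hbc)
        · refine Or.inr ?_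
          have : X ⊂ insert a (insert b (insert c X)) := by
            refine (Finset.ssubset_iff_of_subset fun z hz => by simp [hz]).mpr ⟨a, by simp, ha⟩
          have := Finset.card_lt_card this
          omega

theorem exists_card_eq_distToCoCluster {n : ℕ} (G : SimpleGraph (Fin n)) :
    ∃ Y : Finset (Fin n), Y.card = G.distToCoCluster ∧ G.IsCoClusterModulator Y := by
  refine Nat.sInf_mem (s := {m : ℕ | ∃ X : Finset (Fin n), X.card = m ∧ G.IsCoClusterModulator X})
    ⟨_, Finset.univ, rfl, ?_⟩
  rw [isCoClusterModulator_iff]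
  intro a ha
  simp at ha

theorem Holds.exists_modulator {x : Mach} {A : MarkedInstance} (h : Holds x A) (hA : A.X = ∅) :
    ∃ X, Holds (markMach^[x.size] x) (A.mark X) ∧ X.card ≤ 3 * A.graph.distToCoCluster ∧
      A.graph.IsCoClusterModulator X := by
  obtain ⟨Y, hYc, hY⟩ := exists_card_eq_distToCoCluster A.graph
  obtain ⟨X, h1, h2, h3⟩ := h.iterate_mark hA hY x.size
  refine ⟨X, h1, ?_, h3.resolve_right fun h4 => ?_⟩
  · rw [← hYc]
    exact h2.trans (Nat.mul_le_mul_left _ (Finset.card_le_card Finset.inter_subset_right))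
  · have h5 : X.card ≤ A.n := by simpa using Finset.card_le_univ X
    have h6 := h.size
    omega

/-! ### Brute force -/

section Brute

variable (x : Mach)

/-- `i` belongs to the set encoded by the binary digits of `s`. -/
def bitP (s i : ℕ) : Prop := min s x.size / 2 ^ min i x.size % 2 = 1

/-- The vertices at distance at most one from a vertex in the set encoded by `s`. -/
noncomputable def expand (s : ℕ) : ℕ :=
  ∑ v ∈ Finset.range (nv x),
    if ∃ u < nv x, bitP x s u ∧ (u = v ∨ adjP x u v) then 2 ^ min v x.size else 0

/-- The vertices at distance at most `r` from `w`. -/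
noncomputable def ballCode (w r : ℕ) : ℕ :=
  Nat.rec (motive := fun _ => ℕ) (2 ^ min w x.size) (fun _ s => expand x s) (min r x.size)

/-- The vertices `u` and `v` have different distances from some vertex in the set encoded by `s`. -/
def resolvedP (s u v : ℕ) : Prop :=
  ∃ w < nv x, bitP x s w ∧ ∃ r < nv x,
    ¬(bitP x (ballCode x w r) u ↔ bitP x (ballCode x w r) v)

/-- The encoded instance is a yes-instance. -/
def yesP : Prop :=
  x.read 2 = 0 ∧ ∃ s < min (2 ^ nv x) x.size, countBelow (nv x) (bitP x s) ≤ x.read 1 ∧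
    ∀ u < nv x, ∀ v < nv x, u ≠ v → resolvedP x s u v

end Brute

section EvaluateBrute

variable {α : Type} [Ctx α] {a b c : α → ℕ}

theorem PF_two_pow_min (ha : PF a) : PF fun y => 2 ^ min (a y) (Ctx.mach y).size :=
  (ha.min PF.size).two_pow fun _ => min_le_right _ _

theorem PFP_bitP (ha : PF a) (hb : PF b) : PFP fun y => bitP (Ctx.mach y) (a y) (b y) :=
  PFP.eq (((PF.div (ha.min PF.size) (fun _ => min_le_right _ _) (PF_two_pow_min hb)).mod
    (fun _ => (Nat.div_le_self _ _).trans (min_le_right _ _)) (PF.const 2))) (PF.const 1)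

theorem PF_expand (ha : PF a) : PF fun y => expand (Ctx.mach y) (a y) := by
  refine PF.congr (PF.sum (f := fun y v => if ∃ u < nv (Ctx.mach y), bitP (Ctx.mach y) (a y) u ∧
    (u = v ∨ adjP (Ctx.mach y) u v) then 2 ^ min v (Ctx.mach y).size else 0) PF_nv
    (fun _ => nv_le _) ?_) fun y => Finset.sum_congr rfl fun v _ => by split_ifs <;> rfl
  exact PF.ite (PFP_ex (α := α × ℕ) (P := fun y u => bitP (Ctx.mach y) (a y.1) u ∧
      (u = y.2 ∨ adjP (Ctx.mach y) u y.2))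
    ((PFP_bitP ha.fst.fst PF.snd).and ((PFP.eq PF.snd PF.snd.fst).or
      (PFP_adjP PF.snd PF.snd.fst)))) (PF_two_pow_min (α := α × ℕ) PF.snd) (PF.const 0)

theorem PF_ballCode (ha : PF a) (hb : PF b) : PF fun y => ballCode (Ctx.mach y) (a y) (b y) :=
  PF.iter (f := fun y _ s => expand (Ctx.mach y) s) hb (PF_two_pow_min ha)
    (PF_expand (α := (α × ℕ) × ℕ) PF.snd)

theorem PFP_resolvedP (ha : PF a) (hb : PF b) (hc : PF c) :
    PFP fun y => resolvedP (Ctx.mach y) (a y) (b y) (c y) :=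
  PFP_ex (P := fun y w => bitP (Ctx.mach y) (a y) w ∧ ∃ r < nv (Ctx.mach y),
      ¬(bitP (Ctx.mach y) (ballCode (Ctx.mach y) w r) (b y) ↔
        bitP (Ctx.mach y) (ballCode (Ctx.mach y) w r) (c y)))
    ((PFP_bitP ha.fst PF.snd).and (PFP_ex (α := α × ℕ)
      (P := fun y r => ¬(bitP (Ctx.mach y) (ballCode (Ctx.mach y) y.2 r) (b y.1) ↔
        bitP (Ctx.mach y) (ballCode (Ctx.mach y) y.2 r) (c y.1)))
      ((PFP_bitP (PF_ballCode PF.snd.fst PF.snd) hb.fst.fst).iff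
        (PFP_bitP (PF_ballCode PF.snd.fst PF.snd) hc.fst.fst)).not))

theorem PFP_yesP : PFP fun y : α => yesP (Ctx.mach y) :=
  (PFP.eq (PF.read (PF.const 2)) (PF.const 0)).and (PFP.ex
    (B := fun y => min (2 ^ nv (Ctx.mach y)) (Ctx.mach y).size)
    (P := fun y s => countBelow (nv (Ctx.mach y)) (bitP (Ctx.mach y) s) ≤ (Ctx.mach y).read 1 ∧
      ∀ u < nv (Ctx.mach y), ∀ v < nv (Ctx.mach y), u ≠ v → resolvedP (Ctx.mach y) s u v)
    ((PF_nv.two_pow fun _ => nv_le _).min PF.size) (fun _ => min_le_right _ _)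
    ((PFP.le (PF_count (α := α × ℕ) (P := fun y i => bitP (Ctx.mach y) y.2 i)
      (PFP_bitP PF.snd.fst PF.snd)) (PF.read (PF.const 1))).and
      (PFP_all (α := α × ℕ) (P := fun y u => ∀ v < nv (Ctx.mach y), u ≠ v →
        resolvedP (Ctx.mach y) y.2 u v)
        (PFP_all (α := (α × ℕ) × ℕ) (P := fun y v => y.2 ≠ v →
          resolvedP (Ctx.mach y) y.1.2 y.2 v)
          ((PFP.ne PF.snd.fst PF.snd).imp
            (PFP_resolvedP PF.snd.fst.fst PF.snd.fst PF.snd))))))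

theorem MF_yesP : MF fun x => ⟨x.size, fun _ => if yesP x then 1 else 0⟩ :=
  MF.map (f := fun x _ => if yesP x then 1 else 0) (PFP_yesP (α := Mach × ℕ))

end EvaluateBrute

end MetricDimension

/-! ### Correctness of brute force: sets as binary numbers, distances through balls. -/

theorem Nat.sum_two_pow_spec (n : ℕ) (P : ℕ → Prop) [DecidablePred P] :
    (∑ v ∈ Finset.range n, if P v then 2 ^ v else 0) < 2 ^ n ∧
      ∀ i, (∑ v ∈ Finset.range n, if P v then 2 ^ v else 0).testBit i ↔ i < n ∧ P i := by
  induction n with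
  | zero => simp
  | succ n ih =>
    obtain ⟨h1, h2⟩ := ih
    have h3 : (∑ v ∈ Finset.range (n + 1), if P v then 2 ^ v else 0) < 2 ^ (n + 1) := by
      rw [Finset.sum_range_succ, pow_succ]
      split_ifs <;> omega
    refine ⟨h3, fun i => ?_⟩
    rcases lt_trichotomy i n with hi | rfl | hi
    · rw [Finset.sum_range_succ]
      split_ifs with hP
      · rw [add_comm, Nat.testBit_two_pow_add_gt hi, h2]
        exact and_congr_left fun _ => ⟨fun _ => by omega, fun _ => hi⟩
      · rw [add_zero, h2]
        exact and_congr_left fun _ => ⟨fun _ => by omega, fun _ => hi⟩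
    · rw [Finset.sum_range_succ]
      have h4 : ¬((∑ v ∈ Finset.range i, if P v then 2 ^ v else 0).testBit i = true) := fun h =>
        ((h2 i).mp h).1.false
      split_ifs with hP
      · rw [add_comm, Nat.testBit_two_pow_add_eq]
        simpa [hP] using h4
      · rw [add_zero]
        exact iff_of_false h4 fun h => hP h.2
    · have h4 : 2 ^ (n + 1) ≤ 2 ^ i := Nat.pow_le_pow_right two_pos hi
      rw [Nat.testBit_lt_two_pow (h3.trans_le h4)]
      exact iff_of_false (by simp) fun h => by omega

/-- The smaller distance is finite and attained by a path, hence less than `n`. This also covers the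
case of an infinite larger distance, so balls of radius below `n` detect every difference. -/
theorem SimpleGraph.exists_edist_le_of_lt {n : ℕ} (G : SimpleGraph (Fin n)) {w u v : Fin n}
    (h : G.edist w u < G.edist w v) : ∃ r < n, G.edist w u ≤ r ∧ ¬G.edist w v ≤ r := by
  have hr : G.Reachable w u := edist_ne_top_iff_reachable.mp h.ne_top
  obtain ⟨p, hp, hlen⟩ := hr.exists_path_of_dist
  refine ⟨p.length, by simpa using hp.length_lt, ?_, ?_⟩
  · exact edist_le p
  · rw [hlen, hr.coe_dist_eq_edist, not_le]
    exact h

theorem SimpleGraph.edist_ne_iff {n : ℕ} (G : SimpleGraph (Fin n)) {w u v : Fin n} :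
    G.edist w u ≠ G.edist w v ↔ ∃ r < n, ¬(G.edist w u ≤ r ↔ G.edist w v ≤ r) := by
  constructor
  · intro h
    rcases h.lt_or_gt with h | h
    · obtain ⟨r, h1, h2, h3⟩ := G.exists_edist_le_of_lt h
      exact ⟨r, h1, fun h4 => h3 (h4.mp h2)⟩
    · obtain ⟨r, h1, h2, h3⟩ := G.exists_edist_le_of_lt h
      exact ⟨r, h1, fun h4 => h3 (h4.mpr h2)⟩
  · rintro ⟨r, -, h⟩ h2
    exact h (by rw [h2])

namespace MetricDimension

open Classical SimpleGraph RAM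

theorem bitP_iff {x : Mach} {s i : ℕ} (hs : s ≤ x.size) (hi : i ≤ x.size) :
    bitP x s i ↔ s.testBit i := by
  rw [bitP, min_eq_left hs, min_eq_left hi, Nat.testBit_eq_decide_div_mod_eq, decide_eq_true_iff]

namespace Holds

variable {x : Mach} {A : MarkedInstance}

theorem bitP_iff (h : Holds x A) (hx : 2 ^ A.n ≤ x.size) {s : ℕ} (hs : s < 2 ^ A.n)
    (i : Fin A.n) : bitP x s i ↔ s.testBit i :=
  MetricDimension.bitP_iff (hs.le.trans hx) (by have := h.size; omega)

theorem expand_spec (h : Holds x A) (hx : 2 ^ A.n ≤ x.size) {s : ℕ} (hs : s < 2 ^ A.n) :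
    expand x s < 2 ^ A.n ∧ ∀ v : Fin A.n, (expand x s).testBit v ↔
      ∃ u : Fin A.n, (u = v ∨ A.graph.Adj u v) ∧ s.testBit u := by
  have hsize := h.size
  have h1 : expand x s = ∑ v ∈ Finset.range A.n,
      if ∃ u < nv x, bitP x s u ∧ (u = v ∨ adjP x u v) then 2 ^ v else 0 := by
    rw [expand, h.nv_eq]
    refine Finset.sum_congr rfl fun v hv => ?_
    rw [min_eq_left (by have := Finset.mem_range.mp hv; omega)]
  obtain ⟨h2, h3⟩ := Nat.sum_two_pow_spec A.n
    fun v => ∃ u < nv x, bitP x s u ∧ (u = v ∨ adjP x u v)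
  rw [h1]
  refine ⟨h2, fun v => (h3 v).trans ?_⟩
  rw [and_iff_right v.2, h.exists_iff]
  refine exists_congr fun u => ?_
  rw [h.bitP_iff hx hs, h.adjP_iff, Fin.val_inj, and_comm]

theorem ballCode_spec (h : Holds x A) (hx : 2 ^ A.n ≤ x.size) (w : Fin A.n) (r : ℕ)
    (hr : r ≤ x.size) : ballCode x w r < 2 ^ A.n ∧
      ∀ v : Fin A.n, (ballCode x w r).testBit v ↔ A.graph.edist w v ≤ r := by
  have hsize := h.size
  have hw : (w : ℕ) < A.n := w.2
  induction r with
  | zero =>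
    have h1 : ballCode x w 0 = 2 ^ (w : ℕ) := by
      rw [ballCode, Nat.zero_min, min_eq_left (by omega)]
      rfl
    rw [h1]
    refine ⟨Nat.pow_lt_pow_right one_lt_two w.2, fun v => ?_⟩
    rw [Nat.testBit_two_pow, decide_eq_true_iff, Fin.val_inj, Nat.cast_zero, nonpos_iff_eq_zero,
      edist_eq_zero_iff]
  | succ r ih =>
    obtain ⟨h1, h2⟩ := ih (by omega)
    have h3 : ballCode x w (r + 1) = expand x (ballCode x w r) := by
      rw [ballCode, ballCode, min_eq_left hr, min_eq_left (show r ≤ x.size by omega)]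
    rw [h3]
    obtain ⟨h4, h5⟩ := h.expand_spec hx h1
    refine ⟨h4, fun v => (h5 v).trans ?_⟩
    rw [edist_le_succ_iff]
    exact exists_congr fun u => and_congr_right fun _ => h2 u

theorem resolvedP_iff (h : Holds x A) (hx : 2 ^ A.n ≤ x.size) (s : ℕ) (u v : Fin A.n) :
    resolvedP x s u v ↔ ∃ w : Fin A.n, bitP x s w ∧ A.graph.edist w u ≠ A.graph.edist w v := by
  rw [resolvedP, h.exists_iff]
  refine exists_congr fun w => and_congr_right fun _ => ?_
  rw [edist_ne_iff, h.nv_eq]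
  refine exists_congr fun r => and_congr_right fun hr => not_congr ?_
  obtain ⟨h1, h2⟩ := h.ballCode_spec hx w r (by have := h.size; omega)
  rw [h.bitP_iff hx h1, h.bitP_iff hx h1, h2, h2]

/-- With at least `2 ^ n` cells, a loop bounded by the memory size runs through the codes of all
vertex sets, and no truncation in `bitP` takes effect. -/
theorem yesP_iff (h : Holds x A) (hx : 2 ^ A.n ≤ x.size) : yesP x ↔ A.Yes := by
  have hk : ∀ m : ℕ, (x.read 2 = 0 ∧ m ≤ x.read 1) ↔ (m : ℤ) ≤ A.k := fun m => by
    rw [h.pos, h.neg]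
    omega
  have hcard : ∀ (s : ℕ) (S : Finset (Fin A.n)), (∀ i : Fin A.n, bitP x s i ↔ i ∈ S) →
      countBelow (nv x) (bitP x s) = S.card := fun s S hS => by
    rw [h.count_eq (hQ := inferInstance) hS]
    simp
  have hres : ∀ (s : ℕ) (S : Finset (Fin A.n)), (∀ i : Fin A.n, bitP x s i ↔ i ∈ S) →
      ((∀ u < nv x, ∀ v < nv x, u ≠ v → resolvedP x s u v) ↔ A.graph.IsResolvingSet S) := by
    intro s S hS
    rw [h.forall_iff]
    refine forall_congr' fun u => ?_
    rw [h.forall_iff]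
    refine forall_congr' fun v => imp_congr (not_congr Fin.val_inj) ?_
    rw [h.resolvedP_iff hx]
    exact exists_congr fun w => and_congr_left fun _ => hS w
  constructor
  · rintro ⟨h1, s, -, h2, h3⟩
    have hS : ∀ i : Fin A.n, bitP x s i ↔ i ∈ Finset.univ.filter fun i : Fin A.n => bitP x s i :=
      fun i => by simp
    refine ⟨_, (hres s _ hS).mp h3, (hk _).mp ⟨h1, ?_⟩⟩
    rwa [← hcard s _ hS]
  · rintro ⟨S, h1, h2⟩
    obtain ⟨h3, h4⟩ := (hk _).mpr h2
    obtain ⟨h5, h6⟩ := Nat.sum_two_pow_spec A.n fun v => ∃ i ∈ S, (i : ℕ) = v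
    set s := ∑ v ∈ Finset.range A.n, if ∃ i ∈ S, (i : ℕ) = v then 2 ^ v else 0
    have hS : ∀ i : Fin A.n, bitP x s i ↔ i ∈ S := fun i => by
      rw [h.bitP_iff hx h5, h6, and_iff_right i.2]
      simp [Fin.val_inj]
    refine ⟨h3, s, ?_, ?_, (hres s S hS).mpr h1⟩
    · rw [h.nv_eq, min_eq_left hx]
      exact h5
    · rwa [hcard s S hS]

end Holds

end MetricDimension

namespace MetricDimension

open Classical SimpleGraph RAM

/-! ### Assembling the fixed-parameter algorithm. -/

theorem primrec_two_pow : Primrec fun n : ℕ => 2 ^ n :=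
  (Primrec₂.unpaired'.1 Nat.Primrec.pow).comp (Primrec.const 2) Primrec.id

theorem primrec_kernelBound : Primrec kernelBound := by
  have h1 (c : ℕ) : Primrec fun x : ℕ => x + c := Primrec.nat_add.comp Primrec.id (Primrec.const c)
  have h2 : Primrec fun x : ℕ => 2 ^ (x + 1) := primrec_two_pow.comp (h1 1)
  exact Primrec.nat_add.comp (Primrec.nat_mul.comp (Primrec.nat_mul.comp (primrec_two_pow.comp h2)
    (Primrec.nat_add.comp (Primrec.nat_add.comp (primrec_two_pow.comp (h1 2)) Primrec.id)
      (Primrec.const 1))) h2) Primrec.id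

/-- The size of the memory used by the brute force algorithm on a graph with `n` vertices. -/
def bruteSize (n : ℕ) : ℕ := 2 ^ n + (3 + n + n * n)

theorem bruteSize_mono : Monotone bruteSize := fun m n h => by
  unfold bruteSize
  gcongr
  exact one_le_two

theorem primrec_bruteSize : Primrec bruteSize :=
  Primrec.nat_add.comp primrec_two_pow (Primrec.nat_add.comp
    (Primrec.nat_add.comp (Primrec.const 3) Primrec.id) (Primrec.nat_mul.comp Primrec.id Primrec.id))

theorem PF_bruteSize : PF fun y : Mach => bruteSize (nv y) :=
  (PF_nv.two_pow fun _ => nv_le _).add PF_markedSize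

/-- Compute a modulator, apply the reduction rules exhaustively, and solve the kernel by brute
force. -/
theorem fixedParameterTractable_distToCoCluster : FixedParameterTractable Instance.encode
    Instance.Yes fun A => A.graph.distToCoCluster := by
  obtain ⟨p, T, hT, hp⟩ := exists_setup
  have hmark (x : Mach) : (markMach^[x.size] x).size = x.size :=
    size_iterate (F := markMach) (fun _ => rfl) x _
  obtain ⟨q, U, hU, hq⟩ := MF_iterate_stepMach.comp
    ((MF_markMach.iterate fun _ => rfl).comp MF_unmarkMach fun _ => rfl) fun x => hmark _
  obtain ⟨r, V, hV, hr⟩ := PF_bruteSize.resize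
  obtain ⟨b, W, hW, hb⟩ := MF_yesP
  obtain ⟨c, hc⟩ := ((hT.add hU).add hV).exists_le_mul_pow
  obtain ⟨e, he⟩ := hW.exists_le_mul_pow
  -- The modulator found has at most `3 * l` vertices, so the kernel has at most `kernelBound (3 *
  -- l)`. The second summand is the cost of brute force on it, the first that of the polynomial
  -- phases.
  refine ⟨.seq p (.seq (q 1) (.seq r (b 1))),
    fun l => c * 2 ^ c + e * bruteSize (kernelBound (3 * l)) ^ e, c, ?_, fun A => ?_⟩
  · refine Primrec.to_comp (Primrec.nat_add.comp (Primrec.const _) (Primrec.nat_mul.comp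
      (Primrec.const _) ((Primrec₂.unpaired'.1 Nat.Primrec.pow).comp (primrec_bruteSize.comp
        (primrec_kernelBound.comp (Primrec.nat_mul.comp (Primrec.const _) Primrec.id)))
        (Primrec.const _))))
  set m := kernelBound (3 * A.graph.distToCoCluster) with hm
  obtain ⟨s₁, t₁, h1, h2, h3⟩ := hp A.encode A.n rfl
  have hA := holds_unmarkMach A
  set x : Mach := ⟨3 + A.n + A.n * A.n, fun i => A.encode.getD i 0⟩ with hx
  obtain ⟨s₂, t₂, h4, h5, h6, -⟩ := hq x s₁ 1 one_pos h3
  obtain ⟨X, h7, h8, h9⟩ := hA.exists_modulator rfl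
  obtain ⟨B, h10, h11, h12⟩ := h7.exists_irreducible h9
  obtain ⟨h13, h14, h15⟩ := reduces_star h10 h9
  set y := stepMach^[(markMach^[(unmarkMach x).size] (unmarkMach x)).size]
    (markMach^[(unmarkMach x).size] (unmarkMach x)) with hy
  have hysize : y.size = 3 + A.n + A.n * A.n := by
    rw [hy, size_iterate (F := stepMach) (fun _ => rfl), hmark]
    rfl
  obtain ⟨s₃, t₃, h16, h17, h18, h19⟩ := hr y s₂ h6
  rw [h12.nv_eq] at h19
  set z : Mach := ⟨bruteSize B.n, s₃.mem⟩ with hz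
  -- Resizing leaves the cells alone, and the code of `B` fits into both the old and the new memory.
  -- The contents of the additional cells are irrelevant.
  have hB : Holds z B := h12.congr (Nat.le_add_left _ _) fun i hi => by
    have hi' : i < y.size := hi.trans_le h12.size
    have hz' : i < z.size := hi.trans_le (Nat.le_add_left _ _)
    rw [Mach.read, Mach.read, if_pos hi', if_pos hz', hz, h18]
    exact h6.2 i hi'
  obtain ⟨s₄, t₄, h20, h21, h22, -⟩ := hb z s₃ 1 one_pos ⟨h19, fun _ _ => rfl⟩
  have hyes : yesP z ↔ A.Yes := (hB.yesP_iff (Nat.le_add_right _ _)).trans h13.symm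
  refine ⟨s₄, _, h1.seq (h4.seq (h16.seq h20)), ?_, fun i hi => ?_⟩
  · have hBm : B.n ≤ m := (h11.le_kernelBound h14).trans (kernelBound_mono (h15.trans h8))
    have h23 : t₄ ≤ e * bruteSize m ^ e := by
      refine (h21.trans (he _ (by rw [hz]; unfold bruteSize; positivity))).trans ?_
      gcongr
      exact bruteSize_mono hBm
    -- The memory has `3 + n + n * n` cells, at most twice the input length `3 + n * n`.
    have h24 : t₁ + t₂ + t₃ ≤ c * (2 * A.encode.length) ^ c := by
      rw [hysize] at h17
      refine (add_le_add (add_le_add h2 h5) h17).trans ((hc _ (by omega)).trans ?_)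
      rw [A.length_encode]
      gcongr
      have := Nat.le_mul_self A.n
      omega
    have h25 : 1 ≤ A.encode.length ^ c := Nat.one_le_pow _ _ (by rw [A.length_encode]; omega)
    calc t₁ + (t₂ + (t₃ + t₄)) = t₁ + t₂ + t₃ + t₄ := by ring
      _ ≤ c * (2 * A.encode.length) ^ c + e * bruteSize m ^ e * A.encode.length ^ c :=
        add_le_add h24 (h23.trans (Nat.le_mul_of_pos_right _ h25))
      _ = (c * 2 ^ c + e * bruteSize m ^ e) * A.encode.length ^ c := by rw [mul_pow]; ring
  · have h26 : s₄.mem 0 = if yesP z then 1 else 0 :=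
      h22.2 0 (by rw [hz]; change 0 < bruteSize B.n; unfold bruteSize; positivity)
    have hi0 : i = 0 := by split_ifs at hi <;> simpa using hi
    rw [hi0, h26]
    by_cases hA : A.Yes
    · rw [if_pos (hyes.mpr hA), if_pos hA]
      rfl
    · rw [if_neg (mt hyes.mp hA), if_neg hA]
      rfl

end MetricDimension

theorem mainTheorem3 :
    -- Metric Dimension is fixed-parameter tractable for the distance to co-cluster
    FixedParameterTractable MetricDimension.Instance.encode MetricDimension.Instance.Yes
      (fun A => A.graph.distToCoCluster) ∧
    -- both reduction rules are safe
    (∀ A B : MetricDimension.MarkedInstance, A.graph.IsCoClusterModulator A.X →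
      MetricDimension.TwinRule A B → (A.Yes ↔ B.Yes)) ∧
    (∀ A B : MetricDimension.MarkedInstance, A.graph.IsCoClusterModulator A.X →
      MetricDimension.IndependentSetRule A B → (A.Yes ↔ B.Yes)) ∧
    -- instances to which no rule applies are small
    (∀ A : MetricDimension.MarkedInstance, A.graph.IsCoClusterModulator A.X →
      MetricDimension.Irreducible A → A.n ≤ MetricDimension.kernelBound A.X.card) ∧
    -- exhaustive application of the rules is a polynomial-time kernelization
    (∃ (p : RAM.Prog) (c : ℕ), ∀ A : MetricDimension.MarkedInstance,
      A.graph.IsCoClusterModulator A.X →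
      ∃ B : MetricDimension.MarkedInstance,
        Relation.ReflTransGen MetricDimension.Reduces A B ∧
        MetricDimension.Irreducible B ∧
        RAM.OutputsWithin p A.encode B.clamp.encode (c * A.encode.length ^ c) ∧
        (A.Yes ↔ B.clamp.Yes) ∧
        B.clamp.graph.IsCoClusterModulator B.clamp.X ∧
        B.clamp.X.card ≤ A.X.card ∧
        B.clamp.n ≤ MetricDimension.kernelBound A.X.card) := by
  refine ⟨MetricDimension.fixedParameterTractable_distToCoCluster,
    fun A B _ h => h.yes_iff, fun A B hX h => h.yes_iff hX,
    fun A hX h => h.le_kernelBound hX, ?_⟩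
  obtain ⟨p, c, hp⟩ := MetricDimension.exists_kernelization
  refine ⟨p, c, fun A hX => ?_⟩
  obtain ⟨B, h1, h2, h3⟩ := hp A hX
  obtain ⟨h4, h5, h6⟩ := MetricDimension.reduces_star h1 hX
  exact ⟨B, h1, h2, h3, h4.trans B.clamp_yes.symm, h5, h6,
    (h2.le_kernelBound h5).trans (MetricDimension.kernelBound_mono h6)⟩
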